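/- Let $K$ be a field and $r\ge 0$ an integer. A multi-graded ring of finite type is a commutative, finitely generated $K$-algebra $R=\bigoplus_{d\in\mathbb N^r}R_d$, graded by $K$-subspaces, with $R_0$ finite dimensional over $K$. For a finitely generated $\mathbb Z^r$-graded $R$-module $M=\bigoplus_{d\in\mathbb Z^r}M_d$ and a multi-graded submodule $P\subseteq M$, let $H(P,t)=\sum_{d\in\mathbb Z^r}\dim_K(P\cap M_d)\,t^d$ be its Hilbert series in $t=(t_1,\dots,t_r)$. The universal denominator $\operatorname{udenom}_R(M,t)\in\mathbb Q[t_1,\dots,t_r]$ is the unique polynomial $B(t)$ that is smallest with respect to divisibility among the polynomials such that $B(0)=1$ and $B(t)H(P,t)$ is a Laurent polynomial for every multi-graded $R$-submodule $P\subseteq M$. Let $R$ and $S$ be multi-graded rings of finite type over $K$ (both graded by $\mathbb N^r$), let $M$ be a nonzero finitely generated $\mathbb Z^r$-graded $R$-module and $N$ a nonzero finitely generated $\mathbb Z^r$-graded $S$-module. Consider $M\otimes_K N$ as a module over $R\otimes_K S$ via $(a\otimes b)(m\otimes n)=am\otimes bn$, with the grading $(M\otimes_K N)_d=\bigoplus_{e\in\mathbb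 Z^r}M_e\otimes_K N_{d-e}$. Then the universal denominators of $M$ over $R$, of $N$ over $S$ and of $M\otimes_K N$ over $R\otimes_K S$ exist, and $$\operatorname{udenom}_{R\otimes_K S}(M\otimes_K N,t)=\operatorname{udenom}_R(M,t)\cdot\operatorname{udenom}_S(N,t).$$ -/

import Mathlib

open scoped TensorProduct DirectSum

noncomputable section

namespace UDenom

/-! ### Multi-graded modules -/

/-- The inclusion `ℕ^r → ℤ^r` of multidegrees. -/
def natToInt {r : ℕ} (d : Fin r → ℕ) : Fin r → ℤ := fun i => (d i : ℤ)

/-- `𝓜` makes `M` a `ℤ^r`-graded module over the `ℕ^r`-graded `K`-algebra `(R, 𝓡)`: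
`M = ⨁ M_d` and `R_d M_e ⊆ M_{d+e}`. -/
structure IsGradedModule {K R M : Type*} [Field K] [CommRing R] [Algebra K R]
    [AddCommGroup M] [Module K M] [Module R M] {r : ℕ}
    (𝓡 : (Fin r → ℕ) → Submodule K R) (𝓜 : (Fin r → ℤ) → Submodule K M) : Prop where
  isInternal : DirectSum.IsInternal 𝓜
  smul_mem : ∀ (d : Fin r → ℕ) (e : Fin r → ℤ) (a : R) (m : M),
    a ∈ 𝓡 d → m ∈ 𝓜 e → a • m ∈ 𝓜 (natToInt d + e)

section Series

variable {K R M : Type*} [Field K] [CommRing R] [Algebra K R]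
  [AddCommGroup M] [Module K M] [Module R M] [IsScalarTower K R M] {r : ℕ}

/-- `P` is a multi-graded submodule of `M = ⨁ M_d`, i.e. `P` is the sum of the `P ∩ M_d`. -/
def IsGradedSubmodule (𝓜 : (Fin r → ℤ) → Submodule K M) (P : Submodule R M) : Prop :=
  P.restrictScalars K = ⨆ d, P.restrictScalars K ⊓ 𝓜 d

/-- The Hilbert series `∑_{d ∈ ℤ^r} dim_K (P ∩ M_d) t^d` of a graded submodule `P` of `M`,
given by its coefficients. -/
def hilbertSeries (𝓜 : (Fin r → ℤ) → Submodule K M) (P : Submodule R M) :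
    (Fin r → ℤ) → ℚ :=
  fun d => (Module.finrank K ↥(P.restrictScalars K ⊓ 𝓜 d) : ℚ)

end Series

/-- The product `B(t) · ∑_d H_d t^d` of a polynomial and a formal Laurent series, given by its
coefficients. -/
def polyMul {r : ℕ} (B : MvPolynomial (Fin r) ℚ) (H : (Fin r → ℤ) → ℚ) : (Fin r → ℤ) → ℚ :=
  fun d => ∑ e ∈ B.support, B.coeff e * H (d - natToInt e)

/-- A formal series is a Laurent polynomial if it has only finitely many nonzero coefficients. -/
def IsLaurentPolynomial {r : ℕ} (F : (Fin r → ℤ) → ℚ) : Prop :=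
  (Function.support F).Finite

/-! ### The universal denominator -/

section UDenominator

variable {K : Type*} (R : Type*) {M : Type*} [Field K] [CommRing R] [Algebra K R]
  [AddCommGroup M] [Module K M] [Module R M] [IsScalarTower K R M] {r : ℕ}

/-- `B(0) = 1` and `B(t) H(P, t)` is a Laurent polynomial for every multi-graded `R`-submodule
`P ⊆ M`. -/
def IsCommonDenom (𝓜 : (Fin r → ℤ) → Submodule K M) (B : MvPolynomial (Fin r) ℚ) : Prop :=
  MvPolynomial.constantCoeff B = 1 ∧
    ∀ P : Submodule R M, IsGradedSubmodule 𝓜 P →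
      IsLaurentPolynomial (polyMul B (hilbertSeries 𝓜 P))

/-- `B` is the smallest (for divisibility) common denominator. -/
def IsUDenom (𝓜 : (Fin r → ℤ) → Submodule K M) (B : MvPolynomial (Fin r) ℚ) : Prop :=
  IsCommonDenom R 𝓜 B ∧ ∀ C, IsCommonDenom R 𝓜 C → B ∣ C

theorem IsUDenom.unique {𝓜 : (Fin r → ℤ) → Submodule K M} {B C : MvPolynomial (Fin r) ℚ}
    (hB : IsUDenom R 𝓜 B) (hC : IsUDenom R 𝓜 C) : B = C := by
  obtain ⟨u, hu⟩ := associated_of_dvd_dvd (hB.2 C hC.1) (hC.2 B hB.1)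
  obtain ⟨c, -, hc⟩ := MvPolynomial.isUnit_iff_eq_C_of_isReduced.1 u.isUnit
  have h := congrArg MvPolynomial.constantCoeff hu
  rw [map_mul, hB.1.1, hC.1.1, hc, MvPolynomial.constantCoeff_C, one_mul] at h
  rw [← hu, hc, h, map_one, mul_one]

open Classical in
/-- The universal denominator `udenom_R(M, t)` of the graded `R`-module `M = ⨁ M_d`
(with the value `0` if there is none). -/
def udenom (𝓜 : (Fin r → ℤ) → Submodule K M) : MvPolynomial (Fin r) ℚ :=
  if h : ∃ B, IsUDenom R 𝓜 B then h.choose else 0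

theorem IsUDenom.udenom_eq {𝓜 : (Fin r → ℤ) → Submodule K M} {B : MvPolynomial (Fin r) ℚ}
    (hB : IsUDenom R 𝓜 B) : udenom R 𝓜 = B := by
  have h : ∃ B, IsUDenom R 𝓜 B := ⟨B, hB⟩
  rw [udenom, dif_pos h]
  exact h.choose_spec.unique R hB

end UDenominator

/-! ### Tensor products -/

section TensorModule

variable {K R S M N : Type*} [Field K] [CommRing R] [Algebra K R] [CommRing S] [Algebra K S]
  [AddCommGroup M] [Module K M] [Module R M] [IsScalarTower K R M]
  [AddCommGroup N] [Module K N] [Module S N] [IsScalarTower K S N]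

/-- The action of `R ⊗ S` on `M ⊗ N` by `(a ⊗ b) (m ⊗ n) = (a m) ⊗ (b n)`. -/
def tensorAction (K R S M N : Type*) [Field K] [CommRing R] [Algebra K R] [CommRing S]
    [Algebra K S] [AddCommGroup M] [Module K M] [Module R M] [IsScalarTower K R M]
    [AddCommGroup N] [Module K N] [Module S N] [IsScalarTower K S N] :
    R ⊗[K] S →ₐ[K] Module.End K (M ⊗[K] N) :=
  (Module.endTensorEndAlgHom (R := K) (S := K) (A := K) (M := M) (N := N)).comp
    (Algebra.TensorProduct.map (Algebra.lsmul K K M) (Algebra.lsmul K K N))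

instance tensorModule : Module (R ⊗[K] S) (M ⊗[K] N) :=
  Module.compHom _ (tensorAction K R S M N).toRingHom

theorem tensor_smul_def (x : R ⊗[K] S) (y : M ⊗[K] N) :
    x • y = tensorAction K R S M N x y := rfl

theorem tmul_smul_tmul (a : R) (b : S) (m : M) (n : N) :
    (a ⊗ₜ[K] b) • (m ⊗ₜ[K] n) = (a • m) ⊗ₜ[K] (b • n) := by
  rw [tensor_smul_def, tensorAction, AlgHom.comp_apply, Algebra.TensorProduct.map_tmul,
    Module.endTensorEndAlgHom_apply]
  rfl

instance tensorModule_isScalarTower : IsScalarTower K (R ⊗[K] S) (M ⊗[K] N) where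
  smul_assoc c x y := by simp [tensor_smul_def]

end TensorModule

section TensorGrading

variable {K M N ι : Type*} [Field K] [AddCommGroup M] [Module K M] [AddCommGroup N] [Module K N]
  [AddCommMonoid ι]

/-- The grading `(M ⊗ N)_d = ⨁_{a + b = d} M_a ⊗ N_b`. -/
def tensorGrading (𝓜 : ι → Submodule K M) (𝓝 : ι → Submodule K N) :
    ι → Submodule K (M ⊗[K] N) :=
  fun d => ⨆ (a : ι) (b : ι) (_ : a + b = d), LinearMap.range (TensorProduct.mapIncl (𝓜 a) (𝓝 b))

theorem tmul_mem_tensorGrading {𝓜 : ι → Submodule K M} {𝓝 : ι → Submodule K N} {a b : ι}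
    {m : M} {n : N} (hm : m ∈ 𝓜 a) (hn : n ∈ 𝓝 b) :
    m ⊗ₜ[K] n ∈ tensorGrading 𝓜 𝓝 (a + b) := by
  refine Submodule.mem_iSup_of_mem a (Submodule.mem_iSup_of_mem b
    (Submodule.mem_iSup_of_mem rfl ?_))
  exact ⟨(⟨m, hm⟩ : 𝓜 a) ⊗ₜ[K] (⟨n, hn⟩ : 𝓝 b), by simp [TensorProduct.mapIncl]⟩

theorem tensorGrading_induction {𝓜 : ι → Submodule K M} {𝓝 : ι → Submodule K N} {d : ι}
    (Q : Submodule K (M ⊗[K] N))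
    (h : ∀ a b, a + b = d → ∀ m ∈ 𝓜 a, ∀ n ∈ 𝓝 b, m ⊗ₜ[K] n ∈ Q) :
    tensorGrading 𝓜 𝓝 d ≤ Q := by
  refine iSup_le fun a => iSup_le fun b => iSup_le fun hab => ?_
  rintro _ ⟨x, rfl⟩
  induction x with
  | zero => simp
  | add x y hx hy => rw [map_add]; exact Q.add_mem hx hy
  | tmul m n => simpa [TensorProduct.mapIncl] using h a b hab m m.2 n n.2

/-- The tensor product of two gradings is a grading. -/
theorem tensorGrading_isInternal [DecidableEq ι] {𝓜 : ι → Submodule K M} {𝓝 : ι → Submodule K N}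
    (hM : DirectSum.IsInternal 𝓜) (hN : DirectSum.IsInternal 𝓝) :
    DirectSum.IsInternal (tensorGrading 𝓜 𝓝) := by
  classical
  let := hM.chooseDecomposition
  let := hN.chooseDecomposition
  let φ : (⨁ p : ι × ι, (𝓜 p.1 ⊗[K] 𝓝 p.2)) →ₗ[K] ⨁ d, tensorGrading 𝓜 𝓝 d :=
    DirectSum.toModule K _ _ fun p =>
      (DirectSum.lof K ι (fun d => tensorGrading 𝓜 𝓝 d) (p.1 + p.2)).comp
        ((TensorProduct.mapIncl (𝓜 p.1) (𝓝 p.2)).codRestrict (tensorGrading 𝓜 𝓝 (p.1 + p.2))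
          fun x => Submodule.mem_iSup_of_mem p.1 (Submodule.mem_iSup_of_mem p.2
            (Submodule.mem_iSup_of_mem rfl ⟨x, rfl⟩)))
  let ψ : M ⊗[K] N →ₗ[K] ⨁ d, tensorGrading 𝓜 𝓝 d :=
    φ ∘ₗ (TensorProduct.directSum K K (fun a => 𝓜 a) (fun b => 𝓝 b)).toLinearMap ∘ₗ
      (TensorProduct.congr (DirectSum.decomposeLinearEquiv 𝓜)
        (DirectSum.decomposeLinearEquiv 𝓝)).toLinearMap
  have hψ : ∀ a b (m : M) (n : N) (hm : m ∈ 𝓜 a) (hn : n ∈ 𝓝 b),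
      ψ (m ⊗ₜ n) = DirectSum.lof K ι (fun d => tensorGrading 𝓜 𝓝 d) (a + b)
        ⟨m ⊗ₜ n, tmul_mem_tensorGrading hm hn⟩ := by
    intro a b m n hm hn
    have h1 : DirectSum.decompose 𝓜 m = DirectSum.lof K ι (fun a => 𝓜 a) a ⟨m, hm⟩ :=
      DirectSum.decompose_of_mem _ hm
    have h2 : DirectSum.decompose 𝓝 n = DirectSum.lof K ι (fun a => 𝓝 a) b ⟨n, hn⟩ :=
      DirectSum.decompose_of_mem _ hn
    simp only [ψ, LinearMap.comp_apply, LinearEquiv.coe_coe, TensorProduct.congr_tmul,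
      DirectSum.decomposeLinearEquiv_apply, h1, h2, TensorProduct.directSum_lof_tmul_lof, φ,
      DirectSum.toModule_lof]
    rfl
  have key : ∀ d, ∀ x (hx : x ∈ tensorGrading 𝓜 𝓝 d),
      ψ x = DirectSum.lof K ι (fun d => tensorGrading 𝓜 𝓝 d) d ⟨x, hx⟩ := by
    intro d
    let Q : Submodule K (M ⊗[K] N) := Submodule.map (tensorGrading 𝓜 𝓝 d).subtype
      (LinearMap.eqLocus (ψ ∘ₗ (tensorGrading 𝓜 𝓝 d).subtype)
        (DirectSum.lof K ι (fun d => tensorGrading 𝓜 𝓝 d) d))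
    have hQ : tensorGrading 𝓜 𝓝 d ≤ Q := by
      refine tensorGrading_induction Q ?_
      rintro a b rfl m hm n hn
      exact ⟨⟨m ⊗ₜ n, tmul_mem_tensorGrading hm hn⟩, hψ a b m n hm hn, rfl⟩
    intro x hx
    obtain ⟨y, hy, rfl⟩ := hQ hx
    exact hy
  refine ⟨?_, ?_⟩
  · have hleft : ψ ∘ₗ DirectSum.coeLinearMap (tensorGrading 𝓜 𝓝) = LinearMap.id := by
      refine DirectSum.linearMap_ext _ fun d => LinearMap.ext fun x => ?_
      simp only [LinearMap.comp_apply, DirectSum.coeLinearMap_lof, LinearMap.id_apply]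
      exact key d x x.2
    exact Function.LeftInverse.injective (g := ψ) fun x => LinearMap.congr_fun hleft x
  · have htop : LinearMap.range (DirectSum.coeLinearMap (tensorGrading 𝓜 𝓝)) = ⊤ := by
      rw [DirectSum.range_coeLinearMap, eq_top_iff, ← TensorProduct.span_tmul_eq_top,
        Submodule.span_le]
      rintro _ ⟨m, n, rfl⟩
      rw [SetLike.mem_coe, ← DirectSum.sum_support_decompose 𝓜 m,
        ← DirectSum.sum_support_decompose 𝓝 n, TensorProduct.sum_tmul]
      refine Submodule.sum_mem _ fun a _ => ?_
      rw [TensorProduct.tmul_sum]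
      exact Submodule.sum_mem _ fun b _ => Submodule.mem_iSup_of_mem (a + b)
        (tmul_mem_tensorGrading (SetLike.coe_mem _) (SetLike.coe_mem _))
    exact LinearMap.range_eq_top.1 htop

end TensorGrading

/-- `M ⊗ N` is a graded module over the graded ring `R ⊗ S`. -/
theorem IsGradedModule.tensor {K R S M N : Type*} [Field K] [CommRing R] [Algebra K R]
    [CommRing S] [Algebra K S] [AddCommGroup M] [Module K M] [Module R M] [IsScalarTower K R M]
    [AddCommGroup N] [Module K N] [Module S N] [IsScalarTower K S N] {r : ℕ}
    {𝓡 : (Fin r → ℕ) → Submodule K R} {𝓢 : (Fin r → ℕ) → Submodule K S}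
    {𝓜 : (Fin r → ℤ) → Submodule K M} {𝓝 : (Fin r → ℤ) → Submodule K N}
    (hM : IsGradedModule 𝓡 𝓜) (hN : IsGradedModule 𝓢 𝓝) :
    IsGradedModule (tensorGrading 𝓡 𝓢) (tensorGrading 𝓜 𝓝) where
  isInternal := tensorGrading_isInternal hM.isInternal hN.isInternal
  smul_mem d e x y hx hy := by
    have h1 : tensorGrading 𝓡 𝓢 d ≤ (tensorGrading 𝓜 𝓝 (natToInt d + e)).comap
        ((tensorAction K R S M N).toLinearMap.flip y) := by
      refine tensorGrading_induction _ ?_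
      rintro a b rfl p hp q hq
      have h2 : tensorGrading 𝓜 𝓝 e ≤ (tensorGrading 𝓜 𝓝 (natToInt (a + b) + e)).comap
          (tensorAction K R S M N (p ⊗ₜ q)) := by
        refine tensorGrading_induction _ ?_
        rintro a' b' rfl m hm n hn
        have h3 : natToInt (a + b) + (a' + b') = (natToInt a + a') + (natToInt b + b') := by
          funext i
          simp only [natToInt, Pi.add_apply, Nat.cast_add]
          ring
        rw [Submodule.mem_comap, ← tensor_smul_def, tmul_smul_tmul, h3]
        exact tmul_mem_tensorGrading (hM.smul_mem _ _ _ _ hp hm) (hN.smul_mem _ _ _ _ hq hn)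
      exact h2 hy
    exact h1 hx

end UDenom

end

/-!
Multiplied by a monomial, Hilbert series are rational power series, and the polynomials `B` for
which all `B H(P, t)` are polynomials form an ideal, which is principal because the polynomial ring
is factorial. It contains a product of factors `1 - t ^ δ`, so its generator can be normalised to
have constant term `1`.

Every common denominator of `M ⊗ N` is divisible by `B B'`, where `B` and `B'` are the universal
denominators of `M` and `N`: as `H(P ⊗ Q, t) = H(P, t) H(Q, t)`, it suffices to find, for each
prime divisor `p` of `B B'`, some `P` and `Q` such that `p` divides neither of the polynomials
`B H(P, t)` and `B' H(Q, t)`. If `p` divided all `B H(P, t)`, it would divide `B`, since the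
Hilbert series of `M` and of a suitable submodule differ by a monomial up to a nonzero constant,
and then `B / p` would be a denominator too.

Conversely, that `B B' H(P, t)` has no pole is checked at one prime `p` at a time. Noetherian
induction on annihilators reduces this to cyclic subquotients `(R ⊗ S) / L'` such that `L'` contains
an ideal `L` which is prime for homogeneous elements, and such that `p` divides `1 - t ^ d` for the
degree `d` of every homogeneous element outside `L`. All such degrees are multiples of a single `c`,
so that the Hilbert series is a rational function of `u = t ^ c`, and its pole along `p` is its pole
at `u = 1`. The preimages of `L` in `R` and `S` contain ideals `I` and `J` for which `R / I` and
`S / J` are subquotients of `M` and `N`. Since `(R ⊗ S) / L'` is a quotient of `R / I ⊗ S / J`, its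
coefficients are at most those of the product of the two Hilbert series. Hence its pole at `u = 1`
is of no larger order, and `B B'` removes it.
-/

open scoped TensorProduct DirectSum

noncomputable section

namespace UDenom

/-! ### Homogeneous components -/

section Components

variable {K M ι : Type*} [Semiring K] [AddCommMonoid M] [Module K M] [DecidableEq ι]
  {𝓜 : ι → Submodule K M}

/-- The projection of `M = ⨁ M_d` onto its component of degree `d`, as an endomorphism of `M`. -/
def gradedProj (h : DirectSum.IsInternal 𝓜) (d : ι) : M →ₗ[K] M :=
  let := h.chooseDecomposition
  (𝓜 d).subtype ∘ₗ DirectSum.component K ι (fun i => 𝓜 i) d ∘ₗ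
    (DirectSum.decomposeLinearEquiv 𝓜).toLinearMap

theorem gradedProj_mem (h : DirectSum.IsInternal 𝓜) (d : ι) (m : M) : gradedProj h d m ∈ 𝓜 d :=
  Subtype.property _

theorem gradedProj_of_mem (h : DirectSum.IsInternal 𝓜) {d : ι} {m : M} (hm : m ∈ 𝓜 d) :
    gradedProj h d m = m :=
  let := h.chooseDecomposition
  DirectSum.decompose_of_mem_same 𝓜 hm

theorem gradedProj_of_mem_ne (h : DirectSum.IsInternal 𝓜) {d e : ι} {m : M} (hm : m ∈ 𝓜 e)
    (hed : e ≠ d) : gradedProj h d m = 0 :=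
  let := h.chooseDecomposition
  DirectSum.decompose_of_mem_ne 𝓜 hm hed

theorem finite_gradedProj_ne_zero (h : DirectSum.IsInternal 𝓜) (m : M) :
    {d | gradedProj h d m ≠ 0}.Finite := by
  classical
  let := h.chooseDecomposition
  refine (DFinsupp.support (DirectSum.decompose 𝓜 m)).finite_toSet.subset fun d hd => ?_
  rw [Finset.mem_coe, DFinsupp.mem_support_iff]
  exact fun h0 => hd (congrArg Subtype.val h0)

theorem mem_of_gradedProj_mem (h : DirectSum.IsInternal 𝓜) {Q : Submodule K M} {m : M}
    (hm : ∀ d, gradedProj h d m ∈ Q) : m ∈ Q := by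
  classical
  let := h.chooseDecomposition
  rw [← DirectSum.sum_support_decompose 𝓜 m]
  exact Q.sum_mem fun d _ => hm d

theorem finite_map_gradedProj_ne_bot (h : DirectSum.IsInternal 𝓜) {F : Submodule K M}
    (hF : F.FG) : {d | F.map (gradedProj h d) ≠ ⊥}.Finite := by
  obtain ⟨X, rfl⟩ := hF
  refine (X.finite_toSet.biUnion fun x _ => finite_gradedProj_ne_zero h x).subset fun d hd => ?_
  contrapose! hd
  simp only [Set.mem_iUnion, Set.mem_ofPred_eq, not_exists, not_not] at hd
  rw [Set.mem_ofPred_eq, not_not, Submodule.map_span, Submodule.span_eq_bot]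
  rintro _ ⟨x, hx, rfl⟩
  exact hd x hx

end Components

/-! ### Graded submodules -/

section Degrees

variable {r : ℕ}

theorem natToInt_injective : Function.Injective (natToInt (r := r)) :=
  fun _ _ h => funext fun i => Int.ofNat_injective (congrFun h i)

theorem natToInt_add (a b : Fin r → ℕ) : natToInt (a + b) = natToInt a + natToInt b :=
  funext fun i => Nat.cast_add (a i) (b i)

theorem natToInt_nonneg (a : Fin r → ℕ) : 0 ≤ natToInt a := fun i => Int.natCast_nonneg (a i)

theorem natToInt_zero : natToInt (0 : Fin r → ℕ) = 0 := rfl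

theorem exists_eq_add_natToInt {s d : Fin r → ℤ} (h : s ≤ d) :
    ∃ n : Fin r → ℕ, d = s + natToInt n := by
  refine ⟨fun i => (d i - s i).toNat, funext fun i => ?_⟩
  simp only [natToInt, Pi.add_apply, Int.toNat_of_nonneg (sub_nonneg.2 (h i)), add_sub_cancel]

theorem degree_induction {s : Fin r → ℤ} {C : (Fin r → ℤ) → Prop} (hC : ∀ d, ¬ s ≤ d → C d)
    (ih : ∀ d, (∀ δ : Fin r → ℕ, δ ≠ 0 → C (d - natToInt δ)) → C d) (d : Fin r → ℤ) : C d := by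
  suffices ∀ n : Fin r → ℕ, C (s + natToInt n) by
    by_cases hd : s ≤ d
    · obtain ⟨n, rfl⟩ := exists_eq_add_natToInt hd
      exact this n
    · exact hC d hd
  intro n
  induction n using WellFoundedLT.induction with
  | ind n hn =>
    refine ih _ fun δ hδ => ?_
    by_cases hd : s ≤ s + natToInt n - natToInt δ
    · obtain ⟨k, hk⟩ := exists_eq_add_natToInt hd
      have hkn : k + δ = n := natToInt_injective (by
        rw [natToInt_add]
        linear_combination -hk)
      rw [hk]
      exact hn k (hkn ▸ lt_add_of_pos_right k (pos_of_ne_zero hδ))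
    · exact hC _ hd

theorem exists_minimal_degree {K M : Type*} [Semiring K] [AddCommMonoid M] [Module K M]
    [Nontrivial M] {𝓜 : (Fin r → ℤ) → Submodule K M} (h : DirectSum.IsInternal 𝓜)
    {s : Fin r → ℤ} (hs : ∀ d, 𝓜 d ≠ ⊥ → s ≤ d) :
    ∃ d₀, 𝓜 d₀ ≠ ⊥ ∧ ∀ δ : Fin r → ℕ, δ ≠ 0 → 𝓜 (d₀ - natToInt δ) = ⊥ := by
  by_contra! hne
  have hbot : ∀ d, 𝓜 d = ⊥ := by
    refine degree_induction (fun d hd => not_not.1 (mt (hs d) hd)) fun d ih => ?_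
    by_contra hd
    obtain ⟨δ, hδ, hne⟩ := hne d hd
    exact hne (ih δ hδ)
  obtain ⟨m, hm⟩ := exists_ne (0 : M)
  refine hm ((Submodule.mem_bot K).1 (mem_of_gradedProj_mem h fun d => ?_))
  exact hbot d ▸ gradedProj_mem h d m

end Degrees

section Graded

variable {K R M : Type*} [Field K] [CommRing R] [Algebra K R]
  [AddCommGroup M] [Module K M] [Module R M] [IsScalarTower K R M] {r : ℕ}
  {𝓡 : (Fin r → ℕ) → Submodule K R} {𝓜 : (Fin r → ℤ) → Submodule K M}

theorem mem_of_forall_le (h𝓡 : iSup 𝓡 = ⊤) {Q : Submodule K R} (hQ : ∀ d, 𝓡 d ≤ Q) (a : R) :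
    a ∈ Q :=
  (h𝓡 ▸ iSup_le hQ : (⊤ : Submodule K R) ≤ Q) trivial

theorem restrictScalars_span_le (h𝓡 : iSup 𝓡 = ⊤) {X : Set M} {V : Submodule K M}
    (hV : ∀ d, ∀ a ∈ 𝓡 d, ∀ x ∈ X, a • x ∈ V) :
    (Submodule.span R X).restrictScalars K ≤ V := by
  have htop : Submodule.span K (⋃ d, (𝓡 d : Set R)) = ⊤ := by
    rw [← h𝓡, ← Submodule.iSup_eq_span]
  rw [← Submodule.span_smul_of_span_eq_top htop, Submodule.span_le]
  rintro _ ⟨a, ha, x, hx, rfl⟩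
  obtain ⟨d, hd⟩ := Set.mem_iUnion.1 ha
  exact hV d a hd x hx

theorem isGradedSubmodule_iff (h : DirectSum.IsInternal 𝓜) {P : Submodule R M} :
    IsGradedSubmodule 𝓜 P ↔ ∀ m ∈ P, ∀ d, gradedProj h d m ∈ P := by
  constructor
  · intro hP m hm d
    have hle : P.restrictScalars K ≤ (P.restrictScalars K).comap (gradedProj h d) := by
      conv_lhs => rw [hP]
      refine iSup_le fun e x ⟨hx, hxe⟩ => ?_
      rw [Submodule.mem_comap]
      by_cases hed : e = d
      · rwa [gradedProj_of_mem h (hed ▸ hxe)]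
      · rw [gradedProj_of_mem_ne h hxe hed]
        exact zero_mem _
    exact hle hm
  · intro hP
    refine le_antisymm (fun m hm => ?_) (iSup_le fun d => inf_le_left)
    exact mem_of_gradedProj_mem h fun d =>
      Submodule.mem_iSup_of_mem d ⟨hP m hm d, gradedProj_mem h d m⟩

theorem IsGradedSubmodule.gradedProj_mem {P : Submodule R M} (hP : IsGradedSubmodule 𝓜 P)
    (h : DirectSum.IsInternal 𝓜) {m : M} (hm : m ∈ P) (d : Fin r → ℤ) : gradedProj h d m ∈ P :=
  (isGradedSubmodule_iff h).1 hP m hm d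

theorem gradedProj_smul (hM : IsGradedModule 𝓡 𝓜) {δ : Fin r → ℕ} {a : R} (ha : a ∈ 𝓡 δ)
    (d : Fin r → ℤ) (m : M) :
    gradedProj hM.isInternal (natToInt δ + d) (a • m) = a • gradedProj hM.isInternal d m := by
  suffices m ∈ LinearMap.eqLocus
      (gradedProj hM.isInternal (natToInt δ + d) ∘ₗ Algebra.lsmul K K M a)
      (Algebra.lsmul K K M a ∘ₗ gradedProj hM.isInternal d) from this
  refine mem_of_gradedProj_mem hM.isInternal fun e => ?_
  have he := gradedProj_mem hM.isInternal e m
  have hae := hM.smul_mem _ _ _ _ ha he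
  simp only [LinearMap.mem_eqLocus, LinearMap.comp_apply, Algebra.lsmul_coe]
  by_cases hed : e = d
  · subst hed
    rw [gradedProj_of_mem _ he, gradedProj_of_mem _ hae]
  · rw [gradedProj_of_mem_ne _ he hed, gradedProj_of_mem_ne _ hae (mt add_left_cancel hed),
      smul_zero]

namespace IsGradedSubmodule

variable {P Q : Submodule R M}

theorem bot (h : DirectSum.IsInternal 𝓜) : IsGradedSubmodule 𝓜 (⊥ : Submodule R M) := by
  rw [isGradedSubmodule_iff h]
  simp only [Submodule.mem_bot]
  rintro _ rfl d
  exact map_zero _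

theorem top (h : DirectSum.IsInternal 𝓜) : IsGradedSubmodule 𝓜 (⊤ : Submodule R M) :=
  (isGradedSubmodule_iff h).2 fun _ _ _ => trivial

theorem sup (h : DirectSum.IsInternal 𝓜) (hP : IsGradedSubmodule 𝓜 P)
    (hQ : IsGradedSubmodule 𝓜 Q) : IsGradedSubmodule 𝓜 (P ⊔ Q) := by
  rw [isGradedSubmodule_iff h]
  intro m hm d
  obtain ⟨p, hp, q, hq, rfl⟩ := Submodule.mem_sup.1 hm
  rw [map_add]
  exact Submodule.add_mem_sup (hP.gradedProj_mem h hp d) (hQ.gradedProj_mem h hq d)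

theorem inf (h : DirectSum.IsInternal 𝓜) (hP : IsGradedSubmodule 𝓜 P)
    (hQ : IsGradedSubmodule 𝓜 Q) : IsGradedSubmodule 𝓜 (P ⊓ Q) :=
  (isGradedSubmodule_iff h).2 fun _ hm d =>
    ⟨hP.gradedProj_mem h hm.1 d, hQ.gradedProj_mem h hm.2 d⟩

theorem map_lsmul (hM : IsGradedModule 𝓡 𝓜) (hP : IsGradedSubmodule 𝓜 P) {δ : Fin r → ℕ} {a : R}
    (ha : a ∈ 𝓡 δ) : IsGradedSubmodule 𝓜 (P.map (LinearMap.lsmul R M a)) := by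
  rw [isGradedSubmodule_iff hM.isInternal]
  rintro _ ⟨m, hm, rfl⟩ d
  rw [LinearMap.lsmul_apply, ← add_sub_cancel (natToInt δ) d, gradedProj_smul hM ha]
  exact ⟨_, hP.gradedProj_mem _ hm _, rfl⟩

theorem comap_lsmul (hM : IsGradedModule 𝓡 𝓜) (hP : IsGradedSubmodule 𝓜 P) {δ : Fin r → ℕ}
    {a : R} (ha : a ∈ 𝓡 δ) : IsGradedSubmodule 𝓜 (P.comap (LinearMap.lsmul R M a)) := by
  rw [isGradedSubmodule_iff hM.isInternal]
  intro m hm d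
  rw [Submodule.mem_comap, LinearMap.lsmul_apply, ← gradedProj_smul hM ha]
  exact hP.gradedProj_mem _ hm _

theorem span (hM : IsGradedModule 𝓡 𝓜) (h𝓡 : iSup 𝓡 = ⊤) {X : Set M}
    (hX : ∀ x ∈ X, ∃ d, x ∈ 𝓜 d) : IsGradedSubmodule 𝓜 (Submodule.span R X) := by
  refine le_antisymm (restrictScalars_span_le h𝓡 fun δ a ha x hx => ?_)
    (iSup_le fun d => inf_le_left)
  obtain ⟨e, he⟩ := hX x hx
  exact Submodule.mem_iSup_of_mem (natToInt δ + e)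
    ⟨Submodule.smul_mem _ a (Submodule.subset_span hx), hM.smul_mem _ _ _ _ ha he⟩

theorem span_homogeneous (h : DirectSum.IsInternal 𝓜) (hP : IsGradedSubmodule 𝓜 P) :
    Submodule.span R {m | m ∈ P ∧ ∃ d, m ∈ 𝓜 d} = P := by
  refine le_antisymm (Submodule.span_le.2 fun m hm => hm.1) fun m hm => ?_
  suffices m ∈ (Submodule.span R {m | m ∈ P ∧ ∃ d, m ∈ 𝓜 d}).restrictScalars K from this
  exact mem_of_gradedProj_mem h fun d =>
    Submodule.subset_span ⟨hP.gradedProj_mem h hm d, d, UDenom.gradedProj_mem h d m⟩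

theorem exists_finset_span_eq [IsNoetherian R M] (h : DirectSum.IsInternal 𝓜)
    (hP : IsGradedSubmodule 𝓜 P) :
    ∃ X : Finset M, (∀ x ∈ X, ∃ d, x ∈ 𝓜 d) ∧ Submodule.span R (X : Set M) = P := by
  obtain ⟨X, hX, hspan⟩ := (Submodule.fg_span_iff_fg_span_finset_subset
    {m | m ∈ P ∧ ∃ d, m ∈ 𝓜 d}).1 (IsNoetherian.noetherian (R := R) _)
  exact ⟨X, fun x hx => (hX hx).2, hspan ▸ hP.span_homogeneous h⟩

end IsGradedSubmodule

theorem exists_lower_bound [IsNoetherian R M] (hM : IsGradedModule 𝓡 𝓜) (h𝓡 : iSup 𝓡 = ⊤) :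
    ∃ s : Fin r → ℤ, ∀ d, 𝓜 d ≠ ⊥ → s ≤ d := by
  obtain ⟨X, hX, hspan⟩ := (IsGradedSubmodule.top (R := R) hM.isInternal).exists_finset_span_eq
    hM.isInternal
  choose! deg hdeg using hX
  obtain ⟨s, hs⟩ := (X.image deg).finite_toSet.bddBelow
  refine ⟨s, fun d hd => ?_⟩
  contrapose! hd
  have hker : (Submodule.span R (X : Set M)).restrictScalars K ≤
      LinearMap.ker (gradedProj hM.isInternal d) := by
    refine restrictScalars_span_le h𝓡 fun δ a ha x hx => ?_
    refine gradedProj_of_mem_ne _ (hM.smul_mem _ _ _ _ ha (hdeg x hx)) ?_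
    rintro rfl
    exact hd ((hs (Finset.mem_image_of_mem deg hx)).trans
      (le_add_of_nonneg_left (natToInt_nonneg δ)))
  rw [hspan] at hker
  refine (Submodule.eq_bot_iff _).2 fun m hm => ?_
  rw [← gradedProj_of_mem hM.isInternal hm]
  exact hker trivial

end Graded

/-! ### Denominators over a factorial ring -/

section Denominators

variable {A E : Type*} [CommRing A] [IsDomain A] [CommRing E] [Algebra A E] [FaithfulSMul A E]
  [Module.IsTorsionFree A E]

theorem smul_mem_one_iff_dvd {D a : A} (hD : D ≠ 0) {f : E} (hf : D • f = algebraMap A E a)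
    (F : A) : F • f ∈ (1 : Submodule A E) ↔ D ∣ F * a := by
  rw [Submodule.mem_one]
  refine exists_congr fun q => ?_
  rw [← (smul_right_injective E hD).eq_iff, smul_comm D F f, hf, eq_comm,
    ← (FaithfulSMul.algebraMap_injective A E).eq_iff, map_mul, map_mul, Algebra.smul_def,
    Algebra.smul_def]

variable [UniqueFactorizationMonoid A]

theorem dvd_of_forall_prime_dvd {D a : A} (hD : D ≠ 0)
    (h : ∀ p, Prime p → p ∣ D → ∃ G, ¬ p ∣ G ∧ D ∣ G * a) : D ∣ a := by
  obtain ⟨D', a', c, hrel, rfl, rfl⟩ := UniqueFactorizationMonoid.exists_reduced_factors D hD a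
  have hc : c ≠ 0 := left_ne_zero_of_mul hD
  by_cases hu : IsUnit D'
  · exact mul_dvd_mul_left c hu.dvd
  · obtain ⟨p, hp, hpD⟩ := WfDvdMonoid.exists_irreducible_factor hu (right_ne_zero_of_mul hD)
    obtain ⟨G, hG, hdvd⟩ := h p hp.prime (hpD.mul_left c)
    rw [mul_left_comm, mul_dvd_mul_iff_left hc] at hdvd
    exact absurd (hpD.trans (hrel.dvd_of_dvd_mul_right hdvd)) hG

theorem smul_mem_one_of_isRelPrime {g b c : A} (hgb : g * b ≠ 0) (hbc : IsRelPrime b c) {f : E}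
    (hb : (g * b) • f ∈ (1 : Submodule A E)) (hc : (g * c) • f ∈ (1 : Submodule A E)) :
    g • f ∈ (1 : Submodule A E) := by
  obtain ⟨a, ha⟩ := Submodule.mem_one.1 hb
  rw [smul_mem_one_iff_dvd hgb ha.symm] at hc ⊢
  rw [mul_assoc, mul_dvd_mul_iff_left (left_ne_zero_of_mul hgb)] at hc
  exact mul_dvd_mul_left g (hbc.dvd_of_dvd_mul_left hc)

theorem exists_colon_one_eq_span_singleton {S : Set E}
    (hS : (1 : Submodule A E).colon S ≠ ⊥) :
    ∃ B : A, (1 : Submodule A E).colon S = Ideal.span {B} := by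
  obtain ⟨D, hDS, hD⟩ := Submodule.exists_mem_ne_zero_of_ne_bot hS
  obtain ⟨B, ⟨hB0, hB⟩, hmin⟩ := WellFounded.has_min (wellFounded_dvdNotUnit (α := A))
    {B : A | B ≠ 0 ∧ B ∈ (1 : Submodule A E).colon S} ⟨D, hD, hDS⟩
  refine ⟨B, le_antisymm (fun C hC => Ideal.mem_span_singleton.2 ?_)
    ((Ideal.span_singleton_le_iff_mem _).2 hB)⟩
  obtain ⟨b, c, g, hrel, rfl, rfl⟩ := UniqueFactorizationMonoid.exists_reduced_factors B hB0 C
  have hg : g ∈ (1 : Submodule A E).colon S := Submodule.mem_colon.2 fun f hf =>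
    smul_mem_one_of_isRelPrime hB0 hrel (Submodule.mem_colon.1 hB f hf)
      (Submodule.mem_colon.1 hC f hf)
  have hu : IsUnit b := by
    by_contra hb
    exact hmin g ⟨left_ne_zero_of_mul hB0, hg⟩ ⟨left_ne_zero_of_mul hB0, b, hb, rfl⟩
  exact mul_dvd_mul_left g hu.dvd

end Denominators

section RegularAt

variable {A E : Type*} [CommRing A] [CommRing E] [Algebra A E] {p : A} {f g : E}

/-- The element `f` of the `A`-algebra `E` has no pole along `p`: it becomes an element of `A`
after multiplication by some element of `A` that is not divisible by `p`. -/
def IsRegularAt (p : A) (f : E) : Prop :=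
  ∃ G : A, ¬ p ∣ G ∧ G • f ∈ (1 : Submodule A E)

namespace IsRegularAt

theorem of_mem_one (hp : Prime p) (hf : f ∈ (1 : Submodule A E)) : IsRegularAt p f :=
  ⟨1, hp.not_dvd_one, by rwa [one_smul]⟩

theorem add (hp : Prime p) (hf : IsRegularAt p f) (hg : IsRegularAt p g) :
    IsRegularAt p (f + g) := by
  obtain ⟨F, hF, hf⟩ := hf
  obtain ⟨G, hG, hg⟩ := hg
  refine ⟨F * G, hp.not_dvd_mul hF hG, ?_⟩
  rw [smul_add, mul_smul F G g, mul_comm, mul_smul]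
  exact add_mem (Submodule.smul_mem _ G hf) (Submodule.smul_mem _ F hg)

theorem smul (hf : IsRegularAt p f) (q : A) : IsRegularAt p (q • f) := by
  obtain ⟨F, hF, hf⟩ := hf
  refine ⟨F, hF, ?_⟩
  rw [smul_comm]
  exact Submodule.smul_mem _ q hf

theorem sub (hp : Prime p) (hf : IsRegularAt p f) (hg : IsRegularAt p g) :
    IsRegularAt p (f - g) := by
  rw [sub_eq_add_neg, ← neg_one_smul A g]
  exact hf.add hp (hg.smul _)

theorem of_smul (hp : Prime p) {q : A} (hq : ¬ p ∣ q) (hf : IsRegularAt p (q • f)) :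
    IsRegularAt p f := by
  obtain ⟨F, hF, hf⟩ := hf
  exact ⟨F * q, hp.not_dvd_mul hF hq, by rwa [mul_smul]⟩

end IsRegularAt

theorem mem_one_of_forall_isRegularAt [IsDomain A] [UniqueFactorizationMonoid A]
    [FaithfulSMul A E] [Module.IsTorsionFree A E] {D : A} (hD : D ≠ 0)
    (hDf : D • f ∈ (1 : Submodule A E)) (h : ∀ p : A, Prime p → p ∣ D → IsRegularAt p f) :
    f ∈ (1 : Submodule A E) := by
  obtain ⟨a, ha⟩ := Submodule.mem_one.1 hDf
  rw [← one_smul A f, smul_mem_one_iff_dvd hD ha.symm, one_mul]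
  refine dvd_of_forall_prime_dvd hD fun p hp hpD => ?_
  obtain ⟨G, hG, hmem⟩ := h p hp hpD
  exact ⟨G, hG, (smul_mem_one_iff_dvd hD ha.symm G).1 hmem⟩

end RegularAt

/-! ### Formal Laurent series -/

section Monomials

variable {r : ℕ}

/-- The monomial `t^δ` with exponents given by a function on `Fin r`. -/
def tpow (δ : Fin r → ℕ) : MvPolynomial (Fin r) ℚ :=
  MvPolynomial.monomial (Finsupp.equivFunOnFinite.symm δ) 1

theorem tpow_coe (δ : Fin r →₀ ℕ) : tpow (δ : Fin r → ℕ) = MvPolynomial.monomial δ 1 := by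
  rw [tpow, Finsupp.equivFunOnFinite_symm_coe]

theorem tpow_add (a b : Fin r → ℕ) : tpow (a + b) = tpow a * tpow b := by
  rw [tpow, tpow, tpow, MvPolynomial.monomial_mul, one_mul]
  congr 2
  ext
  rfl

theorem tpow_zero : tpow (0 : Fin r → ℕ) = 1 := by
  simpa using tpow_coe (0 : Fin r →₀ ℕ)

theorem tpow_nsmul (k : ℕ) (a : Fin r → ℕ) : tpow (k • a) = tpow a ^ k := by
  induction k with
  | zero => rw [zero_smul, tpow_zero, pow_zero]
  | succ k ih => rw [succ_nsmul, tpow_add, ih, pow_succ]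

theorem constantCoeff_tpow {δ : Fin r → ℕ} (hδ : δ ≠ 0) :
    MvPolynomial.constantCoeff (tpow δ) = 0 := by
  rw [tpow, MvPolynomial.constantCoeff_monomial, if_neg]
  exact fun h => hδ (Finsupp.equivFunOnFinite.symm.injective (h.trans (by ext; rfl)))

theorem isRelPrime_tpow {g : MvPolynomial (Fin r) ℚ} (hg : MvPolynomial.constantCoeff g ≠ 0)
    (n : Fin r → ℕ) : IsRelPrime g (tpow n) := by
  rw [tpow, ← MvPolynomial.prod_X_pow_eq_monomial]
  refine IsRelPrime.prod_right fun i _ => IsRelPrime.pow_right (IsRelPrime.symm ?_)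
  rw [(MvPolynomial.X_prime (R := ℚ) (i := i)).irreducible.isRelPrime_iff_not_dvd]
  rintro ⟨c, rfl⟩
  exact hg (by rw [map_mul, MvPolynomial.constantCoeff_X, zero_mul])

theorem ne_zero_of_constantCoeff_eq_one {B : MvPolynomial (Fin r) ℚ}
    (hB : MvPolynomial.constantCoeff B = 1) : B ≠ 0 := by
  rintro rfl
  exact zero_ne_one hB

end Monomials

section Series

variable {r : ℕ}

/-- The power series that are polynomials, as a module over the ring of polynomials. -/
abbrev polys (r : ℕ) : Submodule (MvPolynomial (Fin r) ℚ) (MvPowerSeries (Fin r) ℚ) := 1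

theorem algebraMap_eq_coe (B : MvPolynomial (Fin r) ℚ) :
    algebraMap (MvPolynomial (Fin r) ℚ) (MvPowerSeries (Fin r) ℚ) B = B := by
  rw [MvPowerSeries.algebraMap_apply', Algebra.algebraMap_self, MvPowerSeries.map_id,
    RingHom.id_apply]

instance : FaithfulSMul (MvPolynomial (Fin r) ℚ) (MvPowerSeries (Fin r) ℚ) := by
  rw [faithfulSMul_iff_algebraMap_injective]
  intro B C h
  rwa [algebraMap_eq_coe, algebraMap_eq_coe, MvPolynomial.coe_inj] at h

theorem monomial_smul (e : Fin r →₀ ℕ) (c : ℚ) (f : MvPowerSeries (Fin r) ℚ) :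
    MvPolynomial.monomial e c • f = MvPowerSeries.monomial e c * f := by
  rw [Algebra.smul_def, algebraMap_eq_coe, MvPolynomial.coe_monomial]

theorem mem_polys_iff_finite {f : MvPowerSeries (Fin r) ℚ} :
    f ∈ polys r ↔ {n | MvPowerSeries.coeff n f ≠ 0}.Finite := by
  rw [Submodule.mem_one]
  simp only [algebraMap_eq_coe]
  constructor
  · rintro ⟨p, rfl⟩
    refine p.support.finite_toSet.subset fun n hn => ?_
    rwa [Set.mem_ofPred_eq, MvPolynomial.coeff_coe, ← MvPolynomial.mem_support_iff] at hn
  · intro h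
    refine ⟨∑ n ∈ h.toFinset, MvPolynomial.monomial n (MvPowerSeries.coeff n f), ?_⟩
    ext n
    rw [MvPolynomial.coeff_coe, MvPolynomial.coeff_sum]
    simp only [MvPolynomial.coeff_monomial, Finset.sum_ite_eq', Set.Finite.mem_toFinset,
      Set.mem_ofPred_eq, ne_eq, ite_not, ite_eq_right_iff]
    exact Eq.symm

theorem mul_mem_polys {f g : MvPowerSeries (Fin r) ℚ} (hf : f ∈ polys r) (hg : g ∈ polys r) :
    f * g ∈ polys r :=
  one_mul (polys r) ▸ Submodule.mul_mem_mul hf hg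

/-- The power series `∑_n H_{s + n} t^n`, i.e. the part in degrees `≥ s` of the formal Laurent
series `H`, multiplied by `t^{-s}`. -/
def toSeries (s : Fin r → ℤ) (H : (Fin r → ℤ) → ℚ) : MvPowerSeries (Fin r) ℚ :=
  fun n => H (s + natToInt n)

theorem coeff_toSeries (s : Fin r → ℤ) (H : (Fin r → ℤ) → ℚ) (n : Fin r →₀ ℕ) :
    MvPowerSeries.coeff n (toSeries s H) = H (s + natToInt n) := rfl

theorem toSeries_sub (s : Fin r → ℤ) (H₁ H₂ : (Fin r → ℤ) → ℚ) :
    toSeries s (H₁ - H₂) = toSeries s H₁ - toSeries s H₂ := rfl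

variable {s : Fin r → ℤ} {H : (Fin r → ℤ) → ℚ}

theorem coeff_monomial_smul_toSeries (hH : ∀ d, H d ≠ 0 → s ≤ d) (e : Fin r →₀ ℕ) (c : ℚ)
    (n : Fin r →₀ ℕ) :
    MvPowerSeries.coeff n (MvPolynomial.monomial e c • toSeries s H) =
      c * H (s + natToInt n - natToInt e) := by
  rw [monomial_smul, MvPowerSeries.coeff_monomial_mul]
  split_ifs with he
  · obtain ⟨k, rfl⟩ := le_iff_exists_add.1 he
    rw [add_tsub_cancel_left, coeff_toSeries, Finsupp.coe_add, natToInt_add]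
    congr 2
    abel
  · rw [eq_comm, mul_eq_zero]
    refine Or.inr (not_not.1 fun hne => he fun i => ?_)
    have := hH _ hne i
    simp only [natToInt, Pi.add_apply, Pi.sub_apply] at this
    omega

theorem coeff_tpow_smul_toSeries (hH : ∀ d, H d ≠ 0 → s ≤ d) (e : Fin r → ℕ) (n : Fin r →₀ ℕ) :
    MvPowerSeries.coeff n (tpow e • toSeries s H) = H (s + natToInt n - natToInt e) := by
  rw [tpow, coeff_monomial_smul_toSeries hH, one_mul, Finsupp.coe_equivFunOnFinite_symm]

theorem toSeries_eq_tpow_smul {e : Fin r → ℕ} (hH : ∀ d, H d ≠ 0 → s + natToInt e ≤ d) :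
    toSeries s H = tpow e • toSeries (s + natToInt e) H := by
  ext n
  rw [coeff_tpow_smul_toSeries hH, coeff_toSeries]
  congr 1
  abel

theorem coeff_smul_toSeries (hH : ∀ d, H d ≠ 0 → s ≤ d) (B : MvPolynomial (Fin r) ℚ)
    (n : Fin r →₀ ℕ) :
    MvPowerSeries.coeff n (B • toSeries s H) = polyMul B H (s + natToInt n) := by
  conv_lhs => rw [← B.support_sum_monomial_coeff]
  rw [Finset.sum_smul, map_sum, polyMul]
  exact Finset.sum_congr rfl fun e _ => coeff_monomial_smul_toSeries hH e _ n

theorem isLaurentPolynomial_iff {F : (Fin r → ℤ) → ℚ} (hF : ∀ d, F d ≠ 0 → s ≤ d) :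
    IsLaurentPolynomial F ↔ toSeries s F ∈ polys r := by
  have himage : Function.support F = (fun n : Fin r →₀ ℕ => s + natToInt n) ''
      {n | MvPowerSeries.coeff n (toSeries s F) ≠ 0} := by
    ext d
    refine ⟨fun hd => ?_, ?_⟩
    · obtain ⟨n, rfl⟩ := exists_eq_add_natToInt (hF d hd)
      exact ⟨Finsupp.equivFunOnFinite.symm n, hd, rfl⟩
    · rintro ⟨n, hn, rfl⟩
      exact hn
  have hinj : Function.Injective fun n : Fin r →₀ ℕ => s + natToInt n :=
    (add_right_injective s).comp (natToInt_injective.comp DFunLike.coe_injective)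
  rw [IsLaurentPolynomial, himage, Set.finite_image_iff hinj.injOn, mem_polys_iff_finite]

theorem isLaurentPolynomial_polyMul_iff (hH : ∀ d, H d ≠ 0 → s ≤ d)
    (B : MvPolynomial (Fin r) ℚ) :
    IsLaurentPolynomial (polyMul B H) ↔ B • toSeries s H ∈ polys r := by
  have hs : ∀ d, polyMul B H d ≠ 0 → s ≤ d := by
    intro d hd
    obtain ⟨e, -, he⟩ := Finset.exists_ne_zero_of_sum_ne_zero hd
    exact (hH _ (right_ne_zero_of_mul he)).trans (sub_le_self d (natToInt_nonneg e))
  rw [isLaurentPolynomial_iff hs]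
  congr! 1
  ext n
  rw [coeff_smul_toSeries hH, coeff_toSeries]

theorem mem_polys_of_tpow_smul_mem {e : Fin r → ℕ} {f : MvPowerSeries (Fin r) ℚ}
    (h : tpow e • f ∈ polys r) : f ∈ polys r := by
  rw [mem_polys_iff_finite] at h ⊢
  refine Set.Finite.of_finite_image (f := (Finsupp.equivFunOnFinite.symm e + ·))
    (h.subset ?_) (add_right_injective _).injOn
  rintro _ ⟨n, hn, rfl⟩
  rwa [Set.mem_ofPred_eq, tpow, monomial_smul, MvPowerSeries.coeff_add_monomial_mul, one_mul]

end Series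

/-! ### Hilbert series of subquotients -/

theorem finrank_map_add_finrank_inf_ker {K V W : Type*} [Field K] [AddCommGroup V] [Module K V]
    [AddCommGroup W] [Module K W] (f : V →ₗ[K] W) (U : Submodule K V) [Module.Finite K U] :
    Module.finrank K (U.map f) + Module.finrank K ↥(U ⊓ LinearMap.ker f) =
      Module.finrank K U := by
  rw [← (f.domRestrict U).finrank_range_add_finrank_ker, LinearMap.range_domRestrict,
    LinearMap.ker_domRestrict, ← Submodule.map_comap_subtype, Submodule.finrank_map_subtype_eq]

section HilbertSeries

variable {K R M : Type*} [Field K] [CommRing R] [Algebra K R]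
  [AddCommGroup M] [Module K M] [Module R M] [IsScalarTower K R M] {r : ℕ}
  {𝓡 : (Fin r → ℕ) → Submodule K R} {𝓜 : (Fin r → ℤ) → Submodule K M} {s : Fin r → ℤ}
  {P₁ P₂ : Submodule R M}

theorem le_of_hilbertSeries_ne_zero (hs : ∀ d, 𝓜 d ≠ ⊥ → s ≤ d) (P : Submodule R M)
    (d : Fin r → ℤ) (h : hilbertSeries 𝓜 P d ≠ 0) : s ≤ d := by
  refine hs d fun hbot => h ?_
  rw [hilbertSeries, hbot, inf_bot_eq, finrank_bot, Nat.cast_zero]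

theorem hilbertSeries_sub (hfin : ∀ d, Module.Finite K (𝓜 d)) (hle : P₁ ≤ P₂) (d : Fin r → ℤ) :
    hilbertSeries 𝓜 P₂ d - hilbertSeries 𝓜 P₁ d =
      Module.finrank K ((P₂.restrictScalars K ⊓ 𝓜 d).map (P₁.mkQ.restrictScalars K)) := by
  have := hfin d
  have : Module.Finite K ↥(P₂.restrictScalars K ⊓ 𝓜 d) :=
    Submodule.finiteDimensional_of_le inf_le_right
  have hker : P₂.restrictScalars K ⊓ 𝓜 d ⊓ LinearMap.ker (P₁.mkQ.restrictScalars K) =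
      P₁.restrictScalars K ⊓ 𝓜 d := by
    rw [LinearMap.ker_restrictScalars, Submodule.ker_mkQ, inf_right_comm,
      inf_eq_right.2 (Submodule.restrictScalars_mono K hle)]
  rw [hilbertSeries, hilbertSeries, ← finrank_map_add_finrank_inf_ker
    (P₁.mkQ.restrictScalars K) (P₂.restrictScalars K ⊓ 𝓜 d), hker, Nat.cast_add,
    add_sub_cancel_right]

theorem map_mkQ_sup_inf (h : DirectSum.IsInternal 𝓜) (h₁ : IsGradedSubmodule 𝓜 P₁)
    (h₂ : IsGradedSubmodule 𝓜 P₂) (d : Fin r → ℤ) :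
    ((P₁ ⊔ P₂).restrictScalars K ⊓ 𝓜 d).map (P₁.mkQ.restrictScalars K) =
      (P₂.restrictScalars K ⊓ 𝓜 d).map (P₁.mkQ.restrictScalars K) := by
  refine le_antisymm ?_ (Submodule.map_mono (inf_le_inf_right _
    (Submodule.restrictScalars_mono K le_sup_right)))
  rintro _ ⟨m, ⟨hm, hmd⟩, rfl⟩
  obtain ⟨p, hp, q, hq, rfl⟩ := Submodule.mem_sup.1 hm
  refine ⟨gradedProj h d q, ⟨h₂.gradedProj_mem h hq d, gradedProj_mem h d q⟩, ?_⟩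
  rw [← gradedProj_of_mem h hmd, map_add, map_add, right_eq_add]
  exact (Submodule.Quotient.mk_eq_zero P₁).2 (h₁.gradedProj_mem h hp d)

theorem map_lsmul_inf (hM : IsGradedModule 𝓡 𝓜) {P : Submodule R M}
    (hP : IsGradedSubmodule 𝓜 P) {δ : Fin r → ℕ} {a : R} (ha : a ∈ 𝓡 δ) (e : Fin r → ℤ) :
    (P.map (LinearMap.lsmul R M a)).restrictScalars K ⊓ 𝓜 (natToInt δ + e) =
      (P.restrictScalars K ⊓ 𝓜 e).map (Algebra.lsmul K K M a) := by
  ext m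
  constructor
  · rintro ⟨⟨p, hp, rfl⟩, hpd⟩
    refine ⟨gradedProj hM.isInternal e p,
      ⟨hP.gradedProj_mem _ hp e, gradedProj_mem hM.isInternal e p⟩, ?_⟩
    exact (gradedProj_smul hM ha e p).symm.trans (gradedProj_of_mem hM.isInternal hpd)
  · rintro ⟨p, ⟨hp, hpe⟩, rfl⟩
    exact ⟨⟨p, hp, rfl⟩, hM.smul_mem _ _ _ _ ha hpe⟩

theorem hilbertSeries_smul (hM : IsGradedModule 𝓡 𝓜) (hfin : ∀ d, Module.Finite K (𝓜 d))
    (h₁ : IsGradedSubmodule 𝓜 P₁) (h₂ : IsGradedSubmodule 𝓜 P₂) {δ : Fin r → ℕ} {a : R}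
    (ha : a ∈ 𝓡 δ) (e : Fin r → ℤ) :
    hilbertSeries 𝓜 (P₁ ⊔ P₂.map (LinearMap.lsmul R M a)) (natToInt δ + e) -
        hilbertSeries 𝓜 P₁ (natToInt δ + e) =
      hilbertSeries 𝓜 P₂ e -
        hilbertSeries 𝓜 (P₂ ⊓ P₁.comap (LinearMap.lsmul R M a)) e := by
  have := hfin e
  have : Module.Finite K ↥(P₂.restrictScalars K ⊓ 𝓜 e) :=
    Submodule.finiteDimensional_of_le inf_le_right
  have hker : P₂.restrictScalars K ⊓ 𝓜 e ⊓
      LinearMap.ker (P₁.mkQ.restrictScalars K ∘ₗ (Algebra.lsmul K K M a : M →ₗ[K] M)) =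
      (P₂ ⊓ P₁.comap (LinearMap.lsmul R M a)).restrictScalars K ⊓ 𝓜 e := by
    rw [LinearMap.ker_comp, LinearMap.ker_restrictScalars, Submodule.ker_mkQ, inf_right_comm]
    rfl
  rw [hilbertSeries_sub hfin le_sup_left, map_mkQ_sup_inf hM.isInternal h₁ (h₂.map_lsmul hM ha),
    map_lsmul_inf hM h₂ ha, ← Submodule.map_comp, eq_sub_iff_add_eq, hilbertSeries,
    hilbertSeries, ← hker, ← Nat.cast_add, finrank_map_add_finrank_inf_ker]

/-- The Hilbert series of `P` in degrees `≥ s`, multiplied by `t^{-s}` to make it a power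
series. -/
def hser (𝓜 : (Fin r → ℤ) → Submodule K M) (s : Fin r → ℤ) (P : Submodule R M) :
    MvPowerSeries (Fin r) ℚ :=
  toSeries s (hilbertSeries 𝓜 P)

theorem coeff_hser (s : Fin r → ℤ) (P : Submodule R M) (n : Fin r →₀ ℕ) :
    MvPowerSeries.coeff n (hser 𝓜 s P) = hilbertSeries 𝓜 P (s + natToInt n) := rfl

theorem hser_bot (s : Fin r → ℤ) : hser 𝓜 s (⊥ : Submodule R M) = 0 := by
  ext n
  rw [coeff_hser, hilbertSeries, map_zero, Nat.cast_eq_zero, Submodule.restrictScalars_bot,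
    bot_inf_eq, finrank_bot]

theorem hser_smul (hM : IsGradedModule 𝓡 𝓜) (hfin : ∀ d, Module.Finite K (𝓜 d))
    (hs : ∀ d, 𝓜 d ≠ ⊥ → s ≤ d) (h₁ : IsGradedSubmodule 𝓜 P₁) (h₂ : IsGradedSubmodule 𝓜 P₂)
    {δ : Fin r → ℕ} {a : R} (ha : a ∈ 𝓡 δ) :
    hser 𝓜 s (P₁ ⊔ P₂.map (LinearMap.lsmul R M a)) - hser 𝓜 s P₁ =
      tpow δ • (hser 𝓜 s P₂ - hser 𝓜 s (P₂ ⊓ P₁.comap (LinearMap.lsmul R M a))) := by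
  ext n
  rw [smul_sub, map_sub, map_sub, hser, hser, hser, hser,
    coeff_tpow_smul_toSeries (le_of_hilbertSeries_ne_zero hs _),
    coeff_tpow_smul_toSeries (le_of_hilbertSeries_ne_zero hs _),
    ← hilbertSeries_smul hM hfin h₁ h₂ ha, add_sub_cancel, coeff_toSeries, coeff_toSeries]

theorem one_sub_tpow_smul_hser_sub (hM : IsGradedModule 𝓡 𝓜)
    (hfin : ∀ d, Module.Finite K (𝓜 d)) (hs : ∀ d, 𝓜 d ≠ ⊥ → s ≤ d)
    (h₁ : IsGradedSubmodule 𝓜 P₁) (h₂ : IsGradedSubmodule 𝓜 P₂) {δ : Fin r → ℕ} {a : R}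
    (ha : a ∈ 𝓡 δ) :
    (1 - tpow δ) • (hser 𝓜 s P₂ - hser 𝓜 s P₁) =
      (hser 𝓜 s P₂ - hser 𝓜 s (P₁ ⊔ P₂.map (LinearMap.lsmul R M a))) -
        tpow δ • (hser 𝓜 s (P₂ ⊓ P₁.comap (LinearMap.lsmul R M a)) - hser 𝓜 s P₁) := by
  have h := hser_smul hM hfin hs h₁ h₂ ha
  simp only [sub_smul, one_smul, smul_sub] at h ⊢
  linear_combination h

end HilbertSeries

/-! ### Rationality of Hilbert series -/

section Rationality

variable {K R M : Type*} [Field K] [CommRing R] [Algebra K R]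
  [AddCommGroup M] [Module K M] [Module R M] [IsScalarTower K R M] {r : ℕ}
  {𝓡 : (Fin r → ℕ) → Submodule K R} {𝓜 : (Fin r → ℤ) → Submodule K M} {s : Fin r → ℤ}

/-- Homogeneous elements of nonzero degree which generate an ideal of finite codimension. -/
structure IsIrrelevantSystem (𝓡 : (Fin r → ℕ) → Submodule K R) {ι : Type*} (x : ι → R)
    (δ : ι → Fin r → ℕ) : Prop where
  mem : ∀ i, x i ∈ 𝓡 (δ i)
  ne_zero : ∀ i, δ i ≠ 0
  exists_fg : ∃ F : Submodule K R, F.FG ∧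
    F ⊔ (Ideal.span (Set.range x)).restrictScalars K = ⊤

namespace IsIrrelevantSystem

variable {ι : Type*} {x : ι → R} {δ : ι → Fin r → ℕ} {P₁ P₂ : Submodule R M}

theorem exists_fg_le_sup [IsNoetherian R M] (hx : IsIrrelevantSystem 𝓡 x δ)
    (h : ∀ i, ∀ p ∈ P₂, x i • p ∈ P₁) :
    ∃ F : Submodule K M, F.FG ∧ P₂.restrictScalars K ≤ P₁.restrictScalars K ⊔ F := by
  obtain ⟨F₀, hF₀, htop⟩ := hx.exists_fg
  obtain ⟨X, rfl⟩ := IsNoetherian.noetherian P₂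
  let φ : M → R →ₗ[K] M := fun m => (LinearMap.toSpanSingleton R M m).restrictScalars K
  refine ⟨⨆ m ∈ X, F₀.map (φ m), Submodule.fg_biSup _ _ fun m _ => hF₀.map _, fun p hp => ?_⟩
  obtain ⟨c, -, rfl⟩ := Submodule.mem_span_finset.1 hp
  refine Submodule.sum_mem _ fun m hm => ?_
  have hirr : Ideal.span (Set.range x) ≤ P₁.comap (LinearMap.toSpanSingleton R M m) := by
    rw [Ideal.span, Submodule.span_le]
    rintro _ ⟨i, rfl⟩
    exact h i m (Submodule.subset_span hm)
  obtain ⟨b, hb, e, he, hbe⟩ := Submodule.mem_sup.1 (htop.ge (Submodule.mem_top (x := c m)))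
  rw [← hbe, add_smul, add_comm]
  exact Submodule.add_mem_sup (hirr he)
    (Submodule.mem_iSup_of_mem m (Submodule.mem_iSup_of_mem hm ⟨b, hb, rfl⟩))

theorem finite [IsNoetherian R M] [Finite ι] (hx : IsIrrelevantSystem 𝓡 x δ)
    (hM : IsGradedModule 𝓡 𝓜) (hs : ∀ d, 𝓜 d ≠ ⊥ → s ≤ d) (d : Fin r → ℤ) :
    Module.Finite K (𝓜 d) := by
  let xM (i : ι) : Submodule R M := (⊤ : Submodule R M).map (LinearMap.lsmul R M (x i))
  obtain ⟨F, hF, htop⟩ := hx.exists_fg_le_sup (P₁ := ⨆ i, xM i) (P₂ := ⊤)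
    fun i p _ => Submodule.mem_iSup_of_mem i ⟨p, trivial, rfl⟩
  induction d using degree_induction (s := s) with
  | hC d hd => rw [not_ne_iff.1 (mt (hs d) hd)]; infer_instance
  | ih d ih =>
    have hcomp : ∀ i, ((xM i).restrictScalars K).map (gradedProj hM.isInternal d) ≤
        (𝓜 (d - natToInt (δ i))).map (Algebra.lsmul K K M (x i)) := by
      rintro i _ ⟨_, ⟨m, -, rfl⟩, rfl⟩
      refine ⟨_, gradedProj_mem hM.isInternal _ m, ?_⟩
      exact (gradedProj_smul hM (hx.mem i) _ m).symm.trans (by rw [add_sub_cancel]; rfl)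
    have hle : 𝓜 d ≤ (⨆ i, (𝓜 (d - natToInt (δ i))).map (Algebra.lsmul K K M (x i))) ⊔
        F.map (gradedProj hM.isInternal d) := by
      intro m hm
      have hmem := Submodule.mem_map_of_mem (f := gradedProj hM.isInternal d)
        (htop (x := m) trivial)
      rw [gradedProj_of_mem _ hm, Submodule.map_sup, Submodule.restrictScalars_iSup,
        Submodule.map_iSup] at hmem
      exact sup_le_sup_right (iSup_mono hcomp) _ hmem
    have : Module.Finite K _ := Module.Finite.iff_fg.2 ((Submodule.fg_iSup _ fun i =>
      (Module.Finite.iff_fg.1 (ih (δ i) (hx.ne_zero i))).map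
        (Algebra.lsmul K K M (x i) : M →ₗ[K] M)).sup (hF.map (gradedProj hM.isInternal d)))
    exact Submodule.finiteDimensional_of_le hle

theorem hser_sub_mem [IsNoetherian R M] (hx : IsIrrelevantSystem 𝓡 x δ)
    (hM : IsGradedModule 𝓡 𝓜) (hle : P₁ ≤ P₂) (h₁ : IsGradedSubmodule 𝓜 P₁)
    (h : ∀ i, ∀ p ∈ P₂, x i • p ∈ P₁) : hser 𝓜 s P₂ - hser 𝓜 s P₁ ∈ polys r := by
  rw [mem_polys_iff_finite]
  obtain ⟨F, hF, hle'⟩ := hx.exists_fg_le_sup h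
  refine Set.Finite.of_finite_image (f := fun n : Fin r →₀ ℕ => s + natToInt n)
    ((finite_map_gradedProj_ne_bot hM.isInternal hF).subset ?_)
    fun a _ b _ hab => DFunLike.coe_injective (natToInt_injective (add_left_cancel hab))
  rintro _ ⟨n, hn, rfl⟩
  contrapose! hn
  set d := s + natToInt n
  have hproj : ∀ f ∈ F, gradedProj hM.isInternal d f = 0 := fun f hf =>
    (Submodule.mem_bot K).1 (not_not.1 hn ▸ Submodule.mem_map_of_mem hf)
  have heq : P₂.restrictScalars K ⊓ 𝓜 d = P₁.restrictScalars K ⊓ 𝓜 d := by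
    refine le_antisymm (fun p ⟨hp, hpd⟩ => ⟨?_, hpd⟩)
      (inf_le_inf_right _ (Submodule.restrictScalars_mono K hle))
    obtain ⟨q, hq, f, hf, rfl⟩ := Submodule.mem_sup.1 (hle' hp)
    rw [← gradedProj_of_mem hM.isInternal hpd, map_add, hproj f hf, add_zero]
    exact h₁.gradedProj_mem hM.isInternal hq d
  rw [Set.mem_ofPred_eq, not_not, map_sub, coeff_hser, coeff_hser, hilbertSeries, hilbertSeries,
    heq, sub_self]

theorem prod_smul_hser_sub_mem [IsNoetherian R M] (hx : IsIrrelevantSystem 𝓡 x δ)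
    (hM : IsGradedModule 𝓡 𝓜) (hfin : ∀ d, Module.Finite K (𝓜 d))
    (hs : ∀ d, 𝓜 d ≠ ⊥ → s ≤ d) (A : Finset ι) (hle : P₁ ≤ P₂) (h₁ : IsGradedSubmodule 𝓜 P₁)
    (h₂ : IsGradedSubmodule 𝓜 P₂) (hA : ∀ i ∉ A, ∀ p ∈ P₂, x i • p ∈ P₁) :
    (∏ i ∈ A, (1 - tpow (δ i))) • (hser 𝓜 s P₂ - hser 𝓜 s P₁) ∈ polys r := by
  classical
  induction A using Finset.induction_on generalizing P₁ P₂ with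
  | empty =>
    rw [Finset.prod_empty, one_smul]
    exact hx.hser_sub_mem hM hle h₁ fun i => hA i (Finset.notMem_empty i)
  | insert i A hi ih =>
    rw [Finset.prod_insert hi, mul_comm, mul_smul,
      one_sub_tpow_smul_hser_sub hM hfin hs h₁ h₂ (hx.mem i), smul_sub,
      smul_comm _ (tpow (δ i))]
    refine sub_mem (ih ?_ ?_ h₂ fun j hj p hp => ?_)
      (Submodule.smul_mem _ _ (ih ?_ h₁ ?_ fun j hj p hp => ?_))
    · exact sup_le hle (Submodule.map_le_iff_le_comap.2 fun p hp => P₂.smul_mem _ hp)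
    · exact h₁.sup hM.isInternal (h₂.map_lsmul hM (hx.mem i))
    · by_cases hji : j = i
      · exact Submodule.mem_sup_right ⟨p, hp, by rw [hji]; rfl⟩
      · exact Submodule.mem_sup_left (hA j (Finset.mem_insert.not.2 (not_or.2 ⟨hji, hj⟩)) p hp)
    · exact le_inf hle fun p hp => P₁.smul_mem _ hp
    · exact h₂.inf hM.isInternal (h₁.comap_lsmul hM (hx.mem i))
    · by_cases hji : j = i
      · exact hji ▸ hp.2
      · exact hA j (Finset.mem_insert.not.2 (not_or.2 ⟨hji, hj⟩)) p hp.1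

end IsIrrelevantSystem

theorem exists_isIrrelevantSystem [IsNoetherianRing R] [Module.Finite K (𝓡 0)]
    (h𝓡 : iSup 𝓡 = ⊤) :
    ∃ (X : Finset R) (δ : X → Fin r → ℕ), IsIrrelevantSystem 𝓡 (fun a : X => (a : R)) δ := by
  let Y : Set R := {a | ∃ d, d ≠ 0 ∧ a ∈ 𝓡 d}
  obtain ⟨X, hXY, hX⟩ := (Submodule.fg_span_iff_fg_span_finset_subset (R := R) Y).1
    (IsNoetherian.noetherian _)
  choose δ hδ0 hδ using fun a : X => hXY a.2
  refine ⟨X, δ, hδ, hδ0, 𝓡 0, Module.Finite.iff_fg.1 inferInstance,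
    eq_top_iff.2 (h𝓡 ▸ iSup_le fun d => ?_)⟩
  by_cases hd : d = 0
  · exact hd ▸ le_sup_left
  · refine le_sup_of_le_right fun a ha => ?_
    have haY : a ∈ Submodule.span R Y := Submodule.subset_span ⟨d, hd, ha⟩
    rw [hX] at haY
    rwa [Submodule.restrictScalars_mem, Subtype.range_coe_subtype]

/-- `M = ⨁ M_d` is a graded module over `R = ⨁ R_d` with finite dimensional components, which
vanish unless `d ≥ s`, and `x` is an irrelevant system of `R`. These are the properties of
finitely generated modules over multi-graded rings of finite type used in the proof. -/
structure IsFiniteGraded (𝓡 : (Fin r → ℕ) → Submodule K R) (𝓜 : (Fin r → ℤ) → Submodule K M)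
    (s : Fin r → ℤ) {ι : Type*} (x : ι → R) (δ : ι → Fin r → ℕ) : Prop where
  graded : IsGradedModule 𝓡 𝓜
  iSup_eq_top : iSup 𝓡 = ⊤
  irrelevant : IsIrrelevantSystem 𝓡 x δ
  finite : ∀ d, Module.Finite K (𝓜 d)
  lower : ∀ d, 𝓜 d ≠ ⊥ → s ≤ d

theorem IsIrrelevantSystem.exists_isFiniteGraded [IsNoetherian R M] {ι : Type*} [Finite ι]
    {x : ι → R} {δ : ι → Fin r → ℕ} (hx : IsIrrelevantSystem 𝓡 x δ) (hM : IsGradedModule 𝓡 𝓜)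
    (h𝓡 : iSup 𝓡 = ⊤) : ∃ s, IsFiniteGraded 𝓡 𝓜 s x δ := by
  obtain ⟨s, hs⟩ := exists_lower_bound hM h𝓡
  exact ⟨s, hM, h𝓡, hx, hx.finite hM hs, hs⟩

end Rationality

/-! ### The ideal of denominators -/

section DenomIdeal

variable {K R M : Type*} [Field K] [CommRing R] [Algebra K R]
  [AddCommGroup M] [Module K M] [Module R M] [IsScalarTower K R M] {r : ℕ}
  {𝓡 : (Fin r → ℕ) → Submodule K R} {𝓜 : (Fin r → ℤ) → Submodule K M}
  {s : Fin r → ℤ} {ι : Type*} {x : ι → R} {δ : ι → Fin r → ℕ} {B : MvPolynomial (Fin r) ℚ}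

variable (R) in
/-- The ideal of all denominators of the Hilbert series of graded submodules of `M`, without the
normalisation `B(0) = 1` of `IsCommonDenom`. -/
def denomIdeal (𝓜 : (Fin r → ℤ) → Submodule K M) (s : Fin r → ℤ) :
    Ideal (MvPolynomial (Fin r) ℚ) :=
  (polys r).colon {f | ∃ P : Submodule R M, IsGradedSubmodule 𝓜 P ∧ hser 𝓜 s P = f}

theorem mem_denomIdeal : B ∈ denomIdeal R 𝓜 s ↔
    ∀ P : Submodule R M, IsGradedSubmodule 𝓜 P → B • hser 𝓜 s P ∈ polys r := by
  rw [denomIdeal, Submodule.mem_colon]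
  exact ⟨fun h P hP => h _ ⟨P, hP, rfl⟩, fun h _ ⟨P, hP, hf⟩ => hf ▸ h P hP⟩

theorem isCommonDenom_iff (hs : ∀ d, 𝓜 d ≠ ⊥ → s ≤ d) :
    IsCommonDenom R 𝓜 B ↔ MvPolynomial.constantCoeff B = 1 ∧ B ∈ denomIdeal R 𝓜 s := by
  rw [mem_denomIdeal]
  refine and_congr_right fun _ => forall₂_congr fun P _ => ?_
  exact isLaurentPolynomial_polyMul_iff (le_of_hilbertSeries_ne_zero hs P) B

theorem exists_isUDenom_span_eq (hs : ∀ d, 𝓜 d ≠ ⊥ → s ≤ d) (hB : IsCommonDenom R 𝓜 B) :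
    ∃ C, IsUDenom R 𝓜 C ∧ denomIdeal R 𝓜 s = Ideal.span {C} := by
  obtain ⟨hB1, hBJ⟩ := (isCommonDenom_iff hs).1 hB
  obtain ⟨C, hC⟩ := exists_colon_one_eq_span_singleton
    ((Submodule.ne_bot_iff _).2 ⟨B, hBJ, ne_zero_of_constantCoeff_eq_one hB1⟩)
  change denomIdeal R 𝓜 s = _ at hC
  have hC0 : MvPolynomial.constantCoeff C ≠ 0 := by
    rw [hC, Ideal.mem_span_singleton] at hBJ
    obtain ⟨q, rfl⟩ := hBJ
    exact left_ne_zero_of_mul_eq_one ((map_mul _ C q).symm.trans hB1)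
  have hu : IsUnit (MvPolynomial.C (σ := Fin r) (MvPolynomial.constantCoeff C)⁻¹) :=
    (IsUnit.mk0 _ (inv_ne_zero hC0)).map MvPolynomial.C
  rw [← Ideal.span_singleton_mul_left_unit hu] at hC
  refine ⟨_, ⟨(isCommonDenom_iff hs).2 ⟨?_, hC ▸ Ideal.mem_span_singleton_self _⟩,
    fun D hD => ?_⟩, hC⟩
  · rw [map_mul, MvPolynomial.constantCoeff_C, inv_mul_cancel₀ hC0]
  · exact Ideal.mem_span_singleton.1 (hC ▸ ((isCommonDenom_iff hs).1 hD).2)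

theorem IsUDenom.denomIdeal_eq (hs : ∀ d, 𝓜 d ≠ ⊥ → s ≤ d) (hB : IsUDenom R 𝓜 B) :
    denomIdeal R 𝓜 s = Ideal.span {B} := by
  obtain ⟨C, hC, hspan⟩ := exists_isUDenom_span_eq hs hB.1
  rwa [hB.unique R hC]

theorem constantCoeff_prod_one_sub_tpow (hδ : ∀ i, δ i ≠ 0) (A : Finset ι) :
    MvPolynomial.constantCoeff (∏ i ∈ A, (1 - tpow (δ i))) = 1 := by
  rw [map_prod]
  refine Finset.prod_eq_one fun i _ => ?_
  rw [map_sub, map_one, constantCoeff_tpow (hδ i), sub_zero]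

namespace IsFiniteGraded

theorem prod_smul_hser_sub_mem [IsNoetherian R M] [Fintype ι] (h : IsFiniteGraded 𝓡 𝓜 s x δ)
    {P₁ P₂ : Submodule R M} (hle : P₁ ≤ P₂) (h₁ : IsGradedSubmodule 𝓜 P₁)
    (h₂ : IsGradedSubmodule 𝓜 P₂) :
    (∏ i, (1 - tpow (δ i))) • (hser 𝓜 s P₂ - hser 𝓜 s P₁) ∈ polys r :=
  h.irrelevant.prod_smul_hser_sub_mem h.graded h.finite h.lower Finset.univ hle h₁ h₂
    fun i hi => absurd (Finset.mem_univ i) hi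

theorem exists_isUDenom [IsNoetherian R M] [Finite ι] (h : IsFiniteGraded 𝓡 𝓜 s x δ) :
    ∃ B, IsUDenom R 𝓜 B := by
  have := Fintype.ofFinite ι
  obtain ⟨B, hB, -⟩ := exists_isUDenom_span_eq h.lower ((isCommonDenom_iff h.lower).2
    ⟨constantCoeff_prod_one_sub_tpow h.irrelevant.ne_zero _, mem_denomIdeal.2 fun P hP => by
      simpa only [hser_bot, sub_zero] using
        h.prod_smul_hser_sub_mem bot_le (.bot h.graded.isInternal) hP⟩)
  exact ⟨B, hB⟩

/-- All components except one of minimal degree span a graded submodule. -/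
theorem exists_hser_top_sub_eq_monomial [Nontrivial M] (h : IsFiniteGraded 𝓡 𝓜 s x δ) :
    ∃ (P : Submodule R M) (n : Fin r → ℕ) (c : ℚ), IsGradedSubmodule 𝓜 P ∧ c ≠ 0 ∧
      hser 𝓜 s (⊤ : Submodule R M) - hser 𝓜 s P =
        algebraMap (MvPolynomial (Fin r) ℚ) _ (MvPolynomial.C c * tpow n) := by
  obtain ⟨d₀, hd₀, hmin⟩ := exists_minimal_degree h.graded.isInternal h.lower
  obtain ⟨n, rfl⟩ := exists_eq_add_natToInt (h.lower _ hd₀)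
  let P : Submodule R M := Submodule.span R {m | ∃ d, d ≠ s + natToInt n ∧ m ∈ 𝓜 d}
  have hker : P.restrictScalars K ≤
      LinearMap.ker (gradedProj h.graded.isInternal (s + natToInt n)) := by
    refine restrictScalars_span_le h.iSup_eq_top fun δ a ha m ⟨d, hd, hm⟩ => ?_
    rw [LinearMap.mem_ker, ← add_sub_cancel (natToInt δ) (s + natToInt n),
      gradedProj_smul h.graded ha]
    by_cases hδ : δ = 0
    · rw [hδ, natToInt_zero, sub_zero, gradedProj_of_mem_ne _ hm hd, smul_zero]
    · have hproj := gradedProj_mem h.graded.isInternal (s + natToInt n - natToInt δ) m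
      rw [hmin δ hδ, Submodule.mem_bot] at hproj
      rw [hproj, smul_zero]
  have hP₀ : P.restrictScalars K ⊓ 𝓜 (s + natToInt n) = ⊥ := by
    refine (Submodule.eq_bot_iff _).2 fun m ⟨hm, hmd⟩ => ?_
    rw [← gradedProj_of_mem h.graded.isInternal hmd]
    exact hker hm
  have := h.finite (s + natToInt n)
  refine ⟨P, n, Module.finrank K (𝓜 (s + natToInt n)),
    .span h.graded h.iSup_eq_top fun m ⟨d, _, hd⟩ => ⟨d, hd⟩,
    Nat.cast_ne_zero.2 (mt Submodule.finrank_eq_zero.1 hd₀), ?_⟩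
  ext k
  rw [map_sub, coeff_hser, coeff_hser, algebraMap_eq_coe, MvPolynomial.coeff_coe,
    MvPolynomial.coeff_C_mul, tpow, MvPolynomial.coeff_monomial, hilbertSeries, hilbertSeries,
    Submodule.restrictScalars_top, top_inf_eq]
  split_ifs with hnk
  · rw [← hnk, Finsupp.coe_equivFunOnFinite_symm, hP₀, finrank_bot, Nat.cast_zero, sub_zero,
      mul_one]
  · have hne : s + natToInt k ≠ s + natToInt n := fun heq => hnk (DFunLike.coe_injective
      (natToInt_injective (add_left_cancel heq)).symm)
    have hle : 𝓜 (s + natToInt k) ≤ P.restrictScalars K :=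
      fun m hm => Submodule.subset_span ⟨_, hne, hm⟩
    rw [inf_eq_right.2 hle, sub_self, mul_zero]

theorem exists_not_dvd_numerator [Nontrivial M] (h : IsFiniteGraded 𝓡 𝓜 s x δ)
    (hB : IsUDenom R 𝓜 B) {p : MvPolynomial (Fin r) ℚ} (hp : Prime p)
    (hp0 : MvPolynomial.constantCoeff p ≠ 0) :
    ∃ (P : Submodule R M) (a : MvPolynomial (Fin r) ℚ), IsGradedSubmodule 𝓜 P ∧
      B • hser 𝓜 s P = algebraMap _ _ a ∧ ¬ p ∣ a := by
  have hspan := hB.denomIdeal_eq h.lower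
  have hnum : ∀ P : Submodule R M, IsGradedSubmodule 𝓜 P → ∃ a, algebraMap _ _ a =
      B • hser 𝓜 s P := fun P hP =>
    Submodule.mem_one.1 (mem_denomIdeal.1 (hspan ▸ Ideal.mem_span_singleton_self B) P hP)
  by_contra! hdvd
  have hpB : p ∣ B := by
    obtain ⟨P, n, c, hP, hc, hsub⟩ := h.exists_hser_top_sub_eq_monomial
    have htop := IsGradedSubmodule.top (R := R) h.graded.isInternal
    obtain ⟨a, ha⟩ := hnum _ htop
    obtain ⟨b, hb⟩ := hnum P hP
    have hab : a - b = B * MvPolynomial.C c * tpow n := by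
      refine FaithfulSMul.algebraMap_injective _ (MvPowerSeries (Fin r) ℚ) ?_
      rw [map_sub, ha, hb, ← smul_sub, hsub, mul_assoc, Algebra.smul_def, ← map_mul]
    have hdvd' : p ∣ B * MvPolynomial.C c * tpow n :=
      hab ▸ dvd_sub (hdvd _ a htop ha.symm) (hdvd P b hP hb.symm)
    exact (((IsUnit.mk0 c hc).map MvPolynomial.C).dvd_mul_right).1
      ((isRelPrime_tpow hp0 n).dvd_of_dvd_mul_right hdvd')
  obtain ⟨B', rfl⟩ := hpB
  have hB' : B' ∈ denomIdeal R 𝓜 s := mem_denomIdeal.2 fun P hP => by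
    obtain ⟨a, ha⟩ := hnum P hP
    obtain ⟨a', rfl⟩ := hdvd P a hP ha.symm
    refine Submodule.mem_one.2 ⟨a', smul_right_injective _ hp.ne_zero ?_⟩
    rwa [map_mul, mul_smul, ← Algebra.smul_def] at ha
  rw [hspan, Ideal.mem_span_singleton] at hB'
  have hB'0 : B' ≠ 0 := right_ne_zero_of_mul (ne_zero_of_constantCoeff_eq_one hB.1.1)
  rw [← one_mul B', ← mul_assoc, mul_one, mul_dvd_mul_iff_right hB'0] at hB'
  exact hp.not_dvd_one hB'

end IsFiniteGraded

end DenomIdeal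

/-! ### Comparison of poles -/

section Growth

open PowerSeries

theorem coeff_mul_nonneg {f g : PowerSeries ℚ} (hf : ∀ n, 0 ≤ coeff n f)
    (hg : ∀ n, 0 ≤ coeff n g) (n : ℕ) : 0 ≤ coeff n (f * g) := by
  rw [coeff_mul]
  exact Finset.sum_nonneg fun p _ => mul_nonneg (hf _) (hg _)

theorem coeff_one_nonneg (n : ℕ) : 0 ≤ coeff n (1 : PowerSeries ℚ) := by
  rw [coeff_one]
  split_ifs
  exacts [zero_le_one, le_rfl]

theorem coeff_invOneSubPow_nonneg (d n : ℕ) : 0 ≤ coeff n (invOneSubPow ℚ d).val := by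
  cases d with
  | zero => exact coeff_one_nonneg n
  | succ d =>
    rw [invOneSubPow_val_succ_eq_mk_add_choose, coeff_mk]
    exact Nat.cast_nonneg _

theorem natDegree_hilbertPoly_add {p : Polynomial ℚ} (hp : p ≠ 0) {N : ℕ}
    (hN : p.rootMultiplicity 1 < N) :
    (p.hilbertPoly N).natDegree + p.rootMultiplicity 1 + 1 = N := by
  rw [Polynomial.natDegree_hilbertPoly_of_ne_zero_of_rootMultiplicity_lt hp hN]
  omega

/-- The coefficients of `p / (1 - X)^N` grow like a polynomial whose degree is the order of the
pole at `1` minus one. -/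
theorem rootMultiplicity_le_of_coeff_le {p q : Polynomial ℚ} (hp : p ≠ 0) (hq : q ≠ 0) {N : ℕ}
    (hN : q.rootMultiplicity 1 < N)
    (hp0 : ∀ n, 0 ≤ coeff n (p * (invOneSubPow ℚ N).val : PowerSeries ℚ))
    (hpq : ∀ n, coeff n (p * (invOneSubPow ℚ N).val : PowerSeries ℚ) ≤
      coeff n (q * (invOneSubPow ℚ N).val : PowerSeries ℚ)) :
    q.rootMultiplicity 1 ≤ p.rootMultiplicity 1 := by
  by_contra! hlt
  have hp' := natDegree_hilbertPoly_add hp (hlt.trans hN)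
  have hq' := natDegree_hilbertPoly_add hq hN
  have hdeg : (q.hilbertPoly N).degree < (p.hilbertPoly N).degree :=
    Polynomial.degree_lt_degree (by omega)
  have hquot := (Polynomial.div_tendsto_atTop_zero_of_degree_lt _ _ hdeg).comp
    (tendsto_natCast_atTop_atTop (R := ℚ))
  have hroot := (tendsto_natCast_atTop_atTop (R := ℚ)).eventually
    (Polynomial.eventually_atTop_not_isRoot _ (Polynomial.ne_zero_of_degree_gt hdeg))
  refine not_lt_of_ge (ge_of_tendsto hquot (b := 1) ?_) zero_lt_one
  filter_upwards [Filter.eventually_gt_atTop p.natDegree,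
    Filter.eventually_gt_atTop q.natDegree, hroot] with n hnp hnq hn
  have h0 := hp0 n
  have hle := hpq n
  rw [Polynomial.coeff_mul_invOneSubPow_eq_hilbertPoly_eval N hnp] at h0 hle
  rw [Polynomial.coeff_mul_invOneSubPow_eq_hilbertPoly_eval N hnq] at hle
  exact (one_le_div (h0.lt_of_ne' hn)).2 hle

/-- The products of polynomials `1 - X^n` with `n ≠ 0`. -/
def geomDenoms : Submonoid (Polynomial ℚ) :=
  Submonoid.closure {D | ∃ n ≠ 0, D = 1 - Polynomial.X ^ n}

theorem ne_zero_of_mem_geomDenoms {D : Polynomial ℚ} (hD : D ∈ geomDenoms) : D ≠ 0 := by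
  have h0 : D.coeff 0 = 1 := by
    induction hD using Submonoid.closure_induction with
    | mem _ h =>
      obtain ⟨n, hn, rfl⟩ := h
      rw [Polynomial.coeff_sub, Polynomial.coeff_one_zero, Polynomial.coeff_X_pow,
        if_neg hn.symm, sub_zero]
    | one => exact Polynomial.coeff_one_zero
    | mul D E _ _ hD hE => rw [Polynomial.mul_coeff_zero, hD, hE, one_mul]
  rintro rfl
  exact zero_ne_one h0

theorem exists_mul_eq_invOneSubPow {D : Polynomial ℚ} (hD : D ∈ geomDenoms) :
    ∃ (G : PowerSeries ℚ) (k : ℕ), (∀ n, 0 ≤ coeff n G) ∧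
      G = D * (invOneSubPow ℚ k).val := by
  induction hD using Submonoid.closure_induction with
  | mem _ h =>
    obtain ⟨n, -, rfl⟩ := h
    refine ⟨∑ j ∈ Finset.range n, X ^ j, 1, fun m => ?_, ?_⟩
    · rw [map_sum]
      refine Finset.sum_nonneg fun j _ => ?_
      rw [coeff_X_pow]
      split_ifs
      exacts [zero_le_one, le_rfl]
    · have hunit : (1 - X : PowerSeries ℚ) * (invOneSubPow ℚ 1).val = 1 := by
        rw [← pow_one (1 - X), ← invOneSubPow_inv_eq_one_sub_pow]
        exact (invOneSubPow ℚ 1).inv_val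
      rw [Polynomial.coe_sub, Polynomial.coe_one, Polynomial.coe_pow, Polynomial.coe_X,
        ← geom_sum_mul_neg, mul_assoc, hunit, mul_one]
  | one => exact ⟨1, 0, coeff_one_nonneg, by rw [Polynomial.coe_one, one_mul]; rfl⟩
  | mul D E _ _ hD hE =>
    obtain ⟨G, k, hG, rfl⟩ := hD
    obtain ⟨H, l, hH, rfl⟩ := hE
    refine ⟨_, k + l, coeff_mul_nonneg hG hH, ?_⟩
    rw [invOneSubPow_add, Units.val_mul, Polynomial.coe_mul, mul_mul_mul_comm]

theorem exists_mul_eq_mul_of_coeff_le {f g : PowerSeries ℚ} (hf : ∀ n, 0 ≤ coeff n f)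
    (hfg : ∀ n, coeff n f ≤ coeff n g) (hg : g ≠ 0) {D p q : Polynomial ℚ}
    (hD : D ∈ geomDenoms) (hp : D * f = (p : PowerSeries ℚ))
    (hq : D * g = (q : PowerSeries ℚ)) :
    ∃ S V : Polynomial ℚ, ¬ S.IsRoot 1 ∧ (S : PowerSeries ℚ) * f = V * g := by
  have hD0 : (D : PowerSeries ℚ) ≠ 0 :=
    Polynomial.coe_eq_zero_iff.not.2 (ne_zero_of_mem_geomDenoms hD)
  have hq0 : q ≠ 0 := Polynomial.coe_eq_zero_iff.not.1 (hq ▸ mul_ne_zero hD0 hg)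
  have hdvd : (Polynomial.X - Polynomial.C 1) ^ q.rootMultiplicity 1 ∣ p := by
    by_cases hp0 : p = 0
    · exact hp0 ▸ dvd_zero _
    refine (Polynomial.le_rootMultiplicity_iff hp0).1 ?_
    obtain ⟨G, k, hG, hGD⟩ := exists_mul_eq_invOneSubPow hD
    set m := q.rootMultiplicity 1 + 1
    have hmul : ∀ {f : PowerSeries ℚ} {p : Polynomial ℚ}, D * f = (p : PowerSeries ℚ) →
        p * (invOneSubPow ℚ (k + m)).val = G * (invOneSubPow ℚ m).val * f := by
      intro f p hp
      rw [← hp, hGD, invOneSubPow_add, Units.val_mul]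
      ring
    have hU := coeff_mul_nonneg hG (coeff_invOneSubPow_nonneg m)
    refine rootMultiplicity_le_of_coeff_le hp0 hq0 (N := k + m) (by omega) (fun n => ?_)
      fun n => ?_
    · rw [hmul hp]
      exact coeff_mul_nonneg hU hf n
    · rw [hmul hp, hmul hq, ← sub_nonneg, ← map_sub, ← mul_sub]
      exact coeff_mul_nonneg hU (fun i => by rw [map_sub, sub_nonneg]; exact hfg i) n
  obtain ⟨V, hV⟩ := hdvd
  obtain ⟨S, hS, hS1⟩ := Polynomial.exists_eq_pow_rootMultiplicity_mul_and_not_dvd q hq0 1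
  refine ⟨S, V, Polynomial.dvd_iff_isRoot.not.1 hS1, mul_left_cancel₀ hD0 ?_⟩
  rw [mul_left_comm, hp, mul_left_comm, hq, ← Polynomial.coe_mul, ← Polynomial.coe_mul, hV]
  congr 1
  conv_rhs => rw [hS]
  ring

end Growth

section Ray

variable {r : ℕ} {c : Fin r → ℕ}

theorem nsmul_left_injective_of_ne_zero (hc : c ≠ 0) : Function.Injective fun k : ℕ => k • c := by
  intro k l hkl
  obtain ⟨i, hi⟩ := Function.ne_iff.1 hc
  exact Nat.eq_of_mul_eq_mul_right (Nat.pos_of_ne_zero hi) (congrFun hkl i)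

theorem coe_tpow_pow (k : ℕ) : (tpow c : MvPowerSeries (Fin r) ℚ) ^ k =
    MvPowerSeries.monomial (Finsupp.equivFunOnFinite.symm (k • c)) 1 := by
  rw [← MvPolynomial.coe_pow, ← tpow_nsmul, tpow, MvPolynomial.coe_monomial]

theorem hasSubst_tpow (hc : c ≠ 0) :
    PowerSeries.HasSubst (S := ℚ) (tpow c : MvPowerSeries (Fin r) ℚ) := by
  rw [tpow, MvPolynomial.coe_monomial]
  exact PowerSeries.HasSubst.monomial
    (fun h => hc (Finsupp.equivFunOnFinite.symm.injective (h.trans (by ext; rfl)))) 1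

/-- The substitution `X ↦ t^c` into power series in one variable. -/
def raySeries (hc : c ≠ 0) : PowerSeries ℚ →ₐ[ℚ] MvPowerSeries (Fin r) ℚ :=
  PowerSeries.substAlgHom (hasSubst_tpow hc)

theorem raySeries_coe (hc : c ≠ 0) (p : Polynomial ℚ) :
    raySeries hc (p : PowerSeries ℚ) =
      algebraMap (MvPolynomial (Fin r) ℚ) _ (Polynomial.aeval (tpow c) p) := by
  rw [raySeries, PowerSeries.substAlgHom_coe, ← algebraMap_eq_coe,
    Polynomial.aeval_algebraMap_apply]

theorem raySeries_coe_mul (hc : c ≠ 0) (p : Polynomial ℚ) (f : PowerSeries ℚ) :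
    raySeries hc (p * f) = Polynomial.aeval (tpow c) p • raySeries hc f := by
  rw [map_mul, raySeries_coe, Algebra.smul_def]

theorem coeff_raySeries_nsmul (hc : c ≠ 0) (f : PowerSeries ℚ) (k : ℕ) :
    MvPowerSeries.coeff (Finsupp.equivFunOnFinite.symm (k • c)) (raySeries hc f) =
      PowerSeries.coeff k f := by
  rw [raySeries, PowerSeries.coe_substAlgHom, PowerSeries.coeff_subst (hasSubst_tpow hc),
    finsum_eq_single _ k]
  · rw [coe_tpow_pow, MvPowerSeries.coeff_monomial_same, smul_eq_mul, mul_one]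
  · intro l hl
    rw [coe_tpow_pow, MvPowerSeries.coeff_monomial_ne, smul_zero]
    exact fun h => hl
      (nsmul_left_injective_of_ne_zero hc (Finsupp.equivFunOnFinite.symm.injective h)).symm

theorem coeff_raySeries_eq_zero (hc : c ≠ 0) (f : PowerSeries ℚ) {n : Fin r →₀ ℕ}
    (hn : ∀ k : ℕ, (n : Fin r → ℕ) ≠ k • c) : MvPowerSeries.coeff n (raySeries hc f) = 0 := by
  rw [raySeries, PowerSeries.coe_substAlgHom, PowerSeries.coeff_subst (hasSubst_tpow hc)]
  refine finsum_eq_zero_of_forall_eq_zero fun l => ?_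
  rw [coe_tpow_pow, MvPowerSeries.coeff_monomial_ne, smul_zero]
  rintro rfl
  exact hn l rfl

theorem exists_raySeries_eq (hc : c ≠ 0) {f : MvPowerSeries (Fin r) ℚ}
    (hf : ∀ n : Fin r →₀ ℕ, MvPowerSeries.coeff n f ≠ 0 → ∃ k : ℕ, (n : Fin r → ℕ) = k • c) :
    ∃ α, raySeries hc α = f := by
  refine ⟨PowerSeries.mk fun k =>
    MvPowerSeries.coeff (Finsupp.equivFunOnFinite.symm (k • c)) f, ?_⟩
  ext n
  by_cases h : ∃ k : ℕ, (n : Fin r → ℕ) = k • c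
  · obtain ⟨k, hk⟩ := h
    rw [← Finsupp.equivFunOnFinite_symm_coe n, hk, coeff_raySeries_nsmul, PowerSeries.coeff_mk]
  · rw [not_imp_comm.1 (hf n) h, coeff_raySeries_eq_zero hc _]
    exact fun k hk => h ⟨k, hk⟩

theorem exists_polynomial_of_raySeries_mem (hc : c ≠ 0) {f : PowerSeries ℚ}
    (hf : raySeries hc f ∈ polys r) : ∃ p : Polynomial ℚ, f = p := by
  have hfin : {k | PowerSeries.coeff k f ≠ 0}.Finite := by
    refine Set.Finite.of_finite_image (f := fun k => Finsupp.equivFunOnFinite.symm (k • c))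
      ((mem_polys_iff_finite.1 hf).subset ?_)
      (Finsupp.equivFunOnFinite.symm.injective.comp (nsmul_left_injective_of_ne_zero hc)).injOn
    rintro _ ⟨k, hk, rfl⟩
    rwa [Set.mem_ofPred_eq, coeff_raySeries_nsmul]
  refine ⟨∑ k ∈ hfin.toFinset, Polynomial.monomial k (PowerSeries.coeff k f), ?_⟩
  ext n
  rw [Polynomial.coeff_coe, Polynomial.finsetSum_coeff]
  simp only [Polynomial.coeff_monomial, Finset.sum_ite_eq', Set.Finite.mem_toFinset,
    Set.mem_ofPred_eq, ne_eq, ite_not, right_eq_ite_iff]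
  exact id

theorem not_dvd_aeval_tpow {p : MvPolynomial (Fin r) ℚ} (hp : Prime p) (hpc : p ∣ 1 - tpow c)
    {g : Polynomial ℚ} (hg : ¬ g.IsRoot 1) : ¬ p ∣ Polynomial.aeval (tpow c) g := by
  intro h
  have heval : 1 - tpow c ∣ Polynomial.aeval 1 g - Polynomial.aeval (tpow c) g := by
    rw [← Polynomial.eval_map_algebraMap, ← Polynomial.eval_map_algebraMap]
    exact Polynomial.sub_dvd_eval_sub _ _ _
  have hdvd : p ∣ Polynomial.aeval (1 : MvPolynomial (Fin r) ℚ) g :=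
    (dvd_sub_left h).1 (hpc.trans heval)
  rw [← map_one (algebraMap ℚ (MvPolynomial (Fin r) ℚ)),
    Polynomial.aeval_algebraMap_apply_eq_algebraMap_eval] at hdvd
  exact hp.not_isUnit (isUnit_of_dvd_unit hdvd ((IsUnit.mk0 _ hg).map _))

theorem isRegularAt_smul_of_coeff_le {p : MvPolynomial (Fin r) ℚ} (hp : Prime p) (hc : c ≠ 0)
    (hpc : p ∣ 1 - tpow c) {f g : MvPowerSeries (Fin r) ℚ}
    (hf : ∀ n, 0 ≤ MvPowerSeries.coeff n f)
    (hfg : ∀ n, MvPowerSeries.coeff n f ≤ MvPowerSeries.coeff n g) (hg0 : g ≠ 0)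
    (hg : ∀ n : Fin r →₀ ℕ, MvPowerSeries.coeff n g ≠ 0 → ∃ k : ℕ, (n : Fin r → ℕ) = k • c)
    {D : Polynomial ℚ} (hD : D ∈ geomDenoms) (hDf : Polynomial.aeval (tpow c) D • f ∈ polys r)
    (hDg : Polynomial.aeval (tpow c) D • g ∈ polys r) {X : MvPolynomial (Fin r) ℚ}
    (hX : X • g ∈ polys r) : IsRegularAt p (X • f) := by
  obtain ⟨α, rfl⟩ := exists_raySeries_eq hc fun n hn => hg n fun h0 =>
    hn ((h0 ▸ hfg n).antisymm (hf n))
  obtain ⟨β, rfl⟩ := exists_raySeries_eq hc hg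
  rw [← raySeries_coe_mul] at hDf hDg
  obtain ⟨P, hP⟩ := exists_polynomial_of_raySeries_mem hc hDf
  obtain ⟨Q, hQ⟩ := exists_polynomial_of_raySeries_mem hc hDg
  have hα : ∀ n, 0 ≤ PowerSeries.coeff n α := fun n => by
    have h := hf (Finsupp.equivFunOnFinite.symm (n • c))
    rwa [coeff_raySeries_nsmul] at h
  have hαβ : ∀ n, PowerSeries.coeff n α ≤ PowerSeries.coeff n β := fun n => by
    have h := hfg (Finsupp.equivFunOnFinite.symm (n • c))
    rwa [coeff_raySeries_nsmul, coeff_raySeries_nsmul] at h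
  obtain ⟨S, V, hS, hSV⟩ := exists_mul_eq_mul_of_coeff_le hα hαβ
    (fun h0 => hg0 (by rw [h0, map_zero])) hD hP hQ
  refine ⟨Polynomial.aeval (tpow c) S, not_dvd_aeval_tpow hp hpc hS, ?_⟩
  rw [smul_comm, ← raySeries_coe_mul, hSV, raySeries_coe_mul, smul_comm]
  exact Submodule.smul_mem _ _ hX

end Ray

/-! ### Prime divisors of `1 - t^a` -/

section PrimeDivisors

open MvPolynomial

theorem prime_dvd_derivation_apply {A : Type*} [CommRing A] [IsDomain A] [WfDvdMonoid A]
    [Algebra ℚ A] (D : Derivation ℚ A A) {p f : A} (hp : Prime p) (hf : f ≠ 0) (hpf : p ∣ f)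
    (hDf : D f = 0) : p ∣ D p := by
  obtain ⟨n, q, hpq, rfl⟩ := WfDvdMonoid.max_power_factor hf hp.irreducible
  cases n with
  | zero => exact absurd (by simpa only [pow_zero, one_mul] using hpf) hpq
  | succ n =>
    have hcancel : p ^ n * (p * D q + (n + 1 : ℚ) • (q * D p)) = 0 := by
      rw [← hDf, Derivation.leibniz, Derivation.leibniz_pow, Algebra.smul_def]
      simp only [smul_eq_mul, nsmul_eq_mul, map_add, map_natCast, map_one, Nat.cast_add,
        Nat.cast_one, Nat.add_sub_cancel]
      ring
    have hsum := (mul_eq_zero_iff_left (pow_ne_zero n hp.ne_zero)).1 hcancel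
    have hdvd : p ∣ (n + 1 : ℚ) • (q * D p) :=
      (dvd_add_right (dvd_mul_right p (D q))).1 (hsum ▸ dvd_zero p)
    have hunit : IsUnit (algebraMap ℚ A (n + 1)) :=
      (IsUnit.mk0 _ (Nat.cast_add_one_ne_zero n)).map _
    rw [Algebra.smul_def, hunit.dvd_mul_left] at hdvd
    exact (hp.dvd_or_dvd hdvd).resolve_left hpq

theorem exists_eq_C_mul_of_dvd_of_support_subset {σ A : Type*} [CommRing A] [IsDomain A]
    {p q : MvPolynomial σ A} (h : p ∣ q) (hs : q.support ⊆ p.support) : ∃ k, q = C k * p := by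
  obtain ⟨c, rfl⟩ := h
  rcases eq_or_ne p 0 with rfl | hp
  · exact ⟨0, by rw [zero_mul, mul_zero]⟩
  rcases eq_or_ne c 0 with rfl | hc
  · exact ⟨0, by rw [C_0, mul_zero, zero_mul]⟩
  have hdeg : (p * c).totalDegree ≤ p.totalDegree := Finset.sup_mono hs
  rw [totalDegree_mul_of_isDomain hp hc] at hdeg
  exact ⟨_, by rw [mul_comm, ← totalDegree_eq_zero_iff_eq_C.1 (by omega : c.totalDegree = 0)]⟩

theorem coeff_X_mul_pderiv {σ : Type*} (i : σ) (p : MvPolynomial σ ℚ) (e : σ →₀ ℕ) :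
    coeff e (X i * pderiv i p) = e i * coeff e p := by
  classical
  induction p using MvPolynomial.induction_on' with
  | monomial u a =>
    rw [X_mul_pderiv_monomial, coeff_smul, coeff_monomial]
    split_ifs with h
    · rw [h, nsmul_eq_mul]
    · rw [smul_zero, mul_zero]
  | add p q hp hq => rw [map_add, mul_add, coeff_add, hp, hq, coeff_add, mul_add]

variable {r : ℕ}

/-- The invariant derivation `a_j t_i ∂_i - a_i t_j ∂_j` of the torus. It kills `t^a`. -/
def torusDerivation (a : Fin r → ℕ) (i j : Fin r) :
    Derivation ℚ (MvPolynomial (Fin r) ℚ) (MvPolynomial (Fin r) ℚ) :=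
  a j • (X i : MvPolynomial (Fin r) ℚ) • pderiv i - a i • (X j : MvPolynomial (Fin r) ℚ) • pderiv j

theorem coeff_torusDerivation (a : Fin r → ℕ) (i j : Fin r) (p : MvPolynomial (Fin r) ℚ)
    (e : Fin r →₀ ℕ) :
    coeff e (torusDerivation a i j p) = (a j * e i - a i * e j : ℚ) * coeff e p := by
  rw [torusDerivation, Derivation.sub_apply, coeff_sub, Derivation.smul_apply,
    Derivation.smul_apply, Derivation.smul_apply, Derivation.smul_apply, coeff_smul, coeff_smul,
    smul_eq_mul, smul_eq_mul, coeff_X_mul_pderiv, coeff_X_mul_pderiv, nsmul_eq_mul, nsmul_eq_mul]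
  ring

theorem torusDerivation_tpow (a : Fin r → ℕ) (i j : Fin r) :
    torusDerivation a i j (tpow a) = 0 := by
  ext e
  rw [coeff_torusDerivation, tpow, coeff_monomial, coeff_zero]
  split_ifs with h
  · rw [← h, Finsupp.equivFunOnFinite_symm_apply_apply, Finsupp.equivFunOnFinite_symm_apply_apply]
    ring
  · rw [mul_zero]

theorem constantCoeff_ne_zero_of_dvd_one_sub_tpow {p : MvPolynomial (Fin r) ℚ} {a : Fin r → ℕ}
    (ha0 : a ≠ 0) (ha : p ∣ 1 - tpow a) : constantCoeff p ≠ 0 := by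
  obtain ⟨q, hq⟩ := ha
  have h := congrArg constantCoeff hq
  rw [map_sub, map_one, constantCoeff_tpow ha0, sub_zero, map_mul] at h
  exact left_ne_zero_of_mul_eq_one h.symm

/-- The torus derivations that kill `t^a` map `p` to multiples of `p`. As they act diagonally on
monomials and kill the constant term, which is nonzero in `p`, they kill `p`. -/
theorem mul_eq_mul_of_mem_support {p : MvPolynomial (Fin r) ℚ} (hp : Prime p) {a : Fin r → ℕ}
    (ha : p ∣ 1 - tpow a) {e : Fin r →₀ ℕ} (he : e ∈ p.support) (i j : Fin r) :
    a j * e i = a i * e j := by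
  rcases eq_or_ne a 0 with rfl | ha0
  · rw [Pi.zero_apply, Pi.zero_apply, zero_mul, zero_mul]
  have hconst := constantCoeff_ne_zero_of_dvd_one_sub_tpow ha0 ha
  have hne : (1 - tpow a : MvPolynomial (Fin r) ℚ) ≠ 0 := ne_zero_of_constantCoeff_eq_one
    (by rw [map_sub, map_one, constantCoeff_tpow ha0, sub_zero])
  have hdvd : p ∣ torusDerivation a i j p := prime_dvd_derivation_apply _ hp hne ha (by
    rw [map_sub, Derivation.map_one_eq_zero, torusDerivation_tpow, sub_zero])
  obtain ⟨k, hk⟩ := exists_eq_C_mul_of_dvd_of_support_subset hdvd fun d hd => by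
    rw [mem_support_iff, coeff_torusDerivation] at hd
    exact mem_support_iff.2 (right_ne_zero_of_mul hd)
  have hcoeff : ∀ d, (a j * d i - a i * d j : ℚ) * coeff d p = k * coeff d p := fun d => by
    rw [← coeff_torusDerivation, hk, coeff_C_mul]
  have hk0 : k = 0 := by
    have h := hcoeff 0
    rw [Finsupp.zero_apply, Finsupp.zero_apply, Nat.cast_zero, mul_zero, mul_zero, sub_zero,
      zero_mul, zero_eq_mul] at h
    exact h.resolve_right hconst
  have h := hcoeff e
  rw [hk0, zero_mul, mul_eq_zero] at h
  exact_mod_cast sub_eq_zero.1 (h.resolve_right (mem_support_iff.1 he))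

theorem exists_mem_support_ne_zero {p : MvPolynomial (Fin r) ℚ} (hp : Prime p) :
    ∃ e ∈ p.support, ∃ i, e i ≠ 0 := by
  by_contra! h
  have hC := totalDegree_eq_zero_iff_eq_C.1 ((totalDegree_eq_zero_iff _ p).2 h)
  refine hp.not_isUnit (hC ▸ (IsUnit.mk0 (coeff 0 p) fun h0 => hp.ne_zero ?_).map C)
  rw [hC, h0, C_0]

theorem exists_forall_eq_nsmul_of_parallel {ι : Type*} {A : Set (ι → ℕ)} {e : ι → ℕ} {i : ι}
    (hi : e i ≠ 0) (hpar : ∀ b ∈ A, ∀ j, b j * e i = b i * e j)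
    (hsub : ∀ b ∈ A, ∀ c ∈ A, c ≤ b → b - c ∈ A) (hA : ∃ a ∈ A, a ≠ 0) :
    ∃ c ∈ A, c ≠ 0 ∧ ∀ b ∈ A, ∃ k : ℕ, b = k • c := by
  have hle : ∀ b ∈ A, ∀ c ∈ A, c i ≤ b i → c ≤ b := fun b hb c hc h j =>
    le_of_mul_le_mul_right (by rw [hpar b hb, hpar c hc]; gcongr) (Nat.pos_of_ne_zero hi)
  have hzero : ∀ b ∈ A, b i = 0 → b = 0 := fun b hb h => funext fun j =>
    (mul_eq_zero.1 (by rw [hpar b hb, h, zero_mul])).resolve_right hi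
  obtain ⟨c, ⟨hc, hc0⟩, hmin⟩ := (measure fun b : ι → ℕ => b i).wf.has_min
    {b | b ∈ A ∧ b ≠ 0} hA
  refine ⟨c, hc, hc0, fun b => ?_⟩
  induction hn : b i using Nat.strong_induction_on generalizing b with
  | _ n ih =>
    intro hb
    rcases eq_or_ne b 0 with rfl | hb0
    · exact ⟨0, (zero_smul _ _).symm⟩
    have hcb : c i ≤ b i := not_lt.1 (hmin b ⟨hb, hb0⟩)
    have hci : 0 < c i := Nat.pos_of_ne_zero fun h => hc0 (hzero c hc h)
    have hcb' := hle b hb c hc hcb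
    obtain ⟨k, hk⟩ := ih ((b - c) i) (by rw [Pi.sub_apply]; omega) (b - c) rfl (hsub b hb c hc hcb')
    exact ⟨k + 1, by rw [succ_nsmul, ← hk, tsub_add_cancel_of_le hcb']⟩

theorem exists_generator_of_prime_dvd {p : MvPolynomial (Fin r) ℚ} (hp : Prime p)
    {a : Fin r → ℕ} (ha0 : a ≠ 0) (ha : p ∣ 1 - tpow a) :
    ∃ c : Fin r → ℕ, c ≠ 0 ∧ p ∣ 1 - tpow c ∧
      ∀ b : Fin r → ℕ, p ∣ 1 - tpow b → ∃ k : ℕ, b = k • c := by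
  obtain ⟨e, he, i, hi⟩ := exists_mem_support_ne_zero hp
  have hsub : ∀ b ∈ {b | p ∣ 1 - tpow b}, ∀ c ∈ {b | p ∣ 1 - tpow b}, c ≤ b →
      b - c ∈ {b | p ∣ 1 - tpow b} := by
    intro b hb c hc hcb
    have hdvd : p ∣ tpow c * (1 - tpow (b - c)) := by
      rw [mul_sub, mul_one, ← tpow_add, add_tsub_cancel_of_le hcb, ← sub_sub_sub_cancel_left _ _ 1]
      exact dvd_sub hb hc
    have hp0 := constantCoeff_ne_zero_of_dvd_one_sub_tpow ha0 ha
    exact (isRelPrime_tpow hp0 c).dvd_of_dvd_mul_left hdvd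
  obtain ⟨c, hc, hc0, hgen⟩ := exists_forall_eq_nsmul_of_parallel hi
    (fun b hb j => mul_eq_mul_of_mem_support hp hb he i j) hsub ⟨a, ha, ha0⟩
  exact ⟨c, hc0, hc, hgen⟩

end PrimeDivisors

/-! ### Hilbert series of cyclic modules -/

section QuotSeries

variable {K R : Type*} [Field K] [CommRing R] [Algebra K R] {r : ℕ}
  {𝓡 : (Fin r → ℕ) → Submodule K R} {I : Ideal R}

/-- The Hilbert series of `R / I`, whose component of degree `n` is the image of `R_n`. -/
def quotSeries (𝓡 : (Fin r → ℕ) → Submodule K R) (I : Ideal R) : MvPowerSeries (Fin r) ℚ :=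
  fun n => (Module.finrank K ((𝓡 n).map (I.mkQ.restrictScalars K)) : ℚ)

theorem coeff_quotSeries (n : Fin r →₀ ℕ) :
    MvPowerSeries.coeff n (quotSeries 𝓡 I) =
      (Module.finrank K ((𝓡 n).map (I.mkQ.restrictScalars K)) : ℚ) := rfl

theorem coeff_quotSeries_nonneg (n : Fin r →₀ ℕ) :
    0 ≤ MvPowerSeries.coeff n (quotSeries 𝓡 I) := Nat.cast_nonneg _

theorem exists_notMem_of_coeff_quotSeries_ne_zero {n : Fin r →₀ ℕ}
    (h : MvPowerSeries.coeff n (quotSeries 𝓡 I) ≠ 0) : ∃ a ∈ 𝓡 n, a ∉ I := by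
  contrapose! h
  have hbot : (𝓡 n).map (I.mkQ.restrictScalars K) = ⊥ := by
    refine (Submodule.eq_bot_iff _).2 ?_
    rintro _ ⟨a, ha, rfl⟩
    exact (Submodule.Quotient.mk_eq_zero I).2 (h a ha)
  rw [coeff_quotSeries, hbot, finrank_bot, Nat.cast_zero]

theorem quotSeries_ne_zero (h𝓡 : iSup 𝓡 = ⊤)
    (hfin : ∀ n, Module.Finite K ((𝓡 n).map (I.mkQ.restrictScalars K))) (hI : I ≠ ⊤) :
    quotSeries 𝓡 I ≠ 0 := by
  contrapose! hI
  refine I.eq_top_iff_one.2 (mem_of_forall_le (Q := I.restrictScalars K) h𝓡 (fun n a ha => ?_) 1)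
  have := hfin n
  have h0 : Module.finrank K ((𝓡 n).map (I.mkQ.restrictScalars K)) = 0 :=
    Nat.cast_eq_zero.1 (congrFun hI (Finsupp.equivFunOnFinite.symm n))
  rw [Submodule.finrank_eq_zero] at h0
  exact (Submodule.Quotient.mk_eq_zero I).1 ((Submodule.mem_bot K).1
    (h0 ▸ Submodule.mem_map_of_mem ha))

end QuotSeries

section TensorQuotSeries

open Finset.HasAntidiagonal (antidiagonal mem_antidiagonal)

variable {K R S : Type*} [Field K] [CommRing R] [Algebra K R] [CommRing S] [Algebra K S] {r : ℕ}
  {𝓡 : (Fin r → ℕ) → Submodule K R} {𝓢 : (Fin r → ℕ) → Submodule K S}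

theorem finrank_biSup_le_sum {V κ : Type*} [AddCommGroup V] [Module K V] (A : κ → Submodule K V)
    [∀ k, Module.Finite K (A k)] (s : Finset κ) :
    Module.finrank K ↥(⨆ k ∈ s, A k) ≤ ∑ k ∈ s, Module.finrank K (A k) := by
  classical
  induction s using Finset.induction_on with
  | empty => rw [Finset.sum_empty, ← Finset.sup_eq_iSup, Finset.sup_empty, finrank_bot]
  | insert k s hk ih =>
    have : Module.Finite K ↥(⨆ k ∈ s, A k) := by
      rw [← Finset.sup_eq_iSup]
      infer_instance
    rw [Finset.iSup_insert, Finset.sum_insert hk]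
    exact (Submodule.finrank_add_le_finrank_add_finrank _ _).trans (Nat.add_le_add_left ih _)

theorem finrank_mul_le {A : Type*} [CommRing A] [Algebra K A] (U V : Submodule K A)
    [Module.Finite K U] [Module.Finite K V] :
    Module.finrank K ↥(U * V) ≤ Module.finrank K U * Module.finrank K V := by
  rw [← Module.finrank_tensorProduct]
  exact LinearMap.finrank_le_finrank_of_surjective (Submodule.mulMap'_surjective U V)

theorem map_mkQ_tensorGrading_le {L : Ideal (R ⊗[K] S)} {I : Ideal R} {J : Ideal S}
    (hI : ∀ a ∈ I, a ⊗ₜ[K] (1 : S) ∈ L) (hJ : ∀ b ∈ J, (1 : R) ⊗ₜ[K] b ∈ L) (n : Fin r →₀ ℕ) :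
    (tensorGrading 𝓡 𝓢 n).map (L.mkQ.restrictScalars K) ≤
      ⨆ p ∈ antidiagonal n,
        ((𝓡 p.1).map (I.mkQ.restrictScalars K)).map
            (Ideal.quotientMapₐ L Algebra.TensorProduct.includeLeft hI).toLinearMap *
          ((𝓢 p.2).map (J.mkQ.restrictScalars K)).map
            (Ideal.quotientMapₐ L Algebra.TensorProduct.includeRight hJ).toLinearMap := by
  have hI' : I ≤ L.comap (Algebra.TensorProduct.includeLeft : R →ₐ[K] R ⊗[K] S) := hI
  have hJ' : J ≤ L.comap (Algebra.TensorProduct.includeRight : S →ₐ[K] R ⊗[K] S) := hJ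
  rw [Submodule.map_le_iff_le_comap]
  refine tensorGrading_induction _ fun a b hab u hu v hv => ?_
  have hmem : (Finsupp.equivFunOnFinite.symm a, Finsupp.equivFunOnFinite.symm b) ∈
      antidiagonal n := mem_antidiagonal.2 (DFunLike.coe_injective hab)
  refine Submodule.mem_iSup_of_mem _ (Submodule.mem_iSup_of_mem hmem ?_)
  have huv := Submodule.mul_mem_mul
    (Submodule.mem_map_of_mem (f := (Ideal.quotientMapₐ L _ hI').toLinearMap)
      (Submodule.mem_map_of_mem (f := I.mkQ.restrictScalars K) hu))
    (Submodule.mem_map_of_mem (f := (Ideal.quotientMapₐ L _ hJ').toLinearMap)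
      (Submodule.mem_map_of_mem (f := J.mkQ.restrictScalars K) hv))
  have hmul : Ideal.Quotient.mk L (u ⊗ₜ v) =
      Ideal.Quotient.mk L (u ⊗ₜ 1) * Ideal.Quotient.mk L (1 ⊗ₜ v) := by
    rw [← map_mul, Algebra.TensorProduct.tmul_mul_tmul, mul_one, one_mul]
  exact (congrArg (· ∈ _) hmul).mpr huv

theorem coeff_quotSeries_tensorGrading_le {L : Ideal (R ⊗[K] S)} {I : Ideal R} {J : Ideal S}
    (hI : ∀ a ∈ I, a ⊗ₜ[K] (1 : S) ∈ L) (hJ : ∀ b ∈ J, (1 : R) ⊗ₜ[K] b ∈ L)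
    (hfinI : ∀ n, Module.Finite K ((𝓡 n).map (I.mkQ.restrictScalars K)))
    (hfinJ : ∀ n, Module.Finite K ((𝓢 n).map (J.mkQ.restrictScalars K))) (n : Fin r →₀ ℕ) :
    MvPowerSeries.coeff n (quotSeries (tensorGrading 𝓡 𝓢) L) ≤
      MvPowerSeries.coeff n (quotSeries 𝓡 I * quotSeries 𝓢 J) := by
  let U (p : (Fin r →₀ ℕ) × (Fin r →₀ ℕ)) :=
    ((𝓡 p.1).map (I.mkQ.restrictScalars K)).map
      (Ideal.quotientMapₐ L Algebra.TensorProduct.includeLeft hI).toLinearMap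
  let V (p : (Fin r →₀ ℕ) × (Fin r →₀ ℕ)) :=
    ((𝓢 p.2).map (J.mkQ.restrictScalars K)).map
      (Ideal.quotientMapₐ L Algebra.TensorProduct.includeRight hJ).toLinearMap
  have hUV : ∀ p, Module.Finite K ↥(U p * V p) := fun p =>
    Module.Finite.iff_fg.2 (.mul (.map _ (Module.Finite.iff_fg.1 (hfinI p.1)))
      (.map _ (Module.Finite.iff_fg.1 (hfinJ p.2))))
  have hsup : Module.Finite K ↥(⨆ p ∈ antidiagonal n, U p * V p) := by
    rw [← Finset.sup_eq_iSup]
    infer_instance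
  simp only [MvPowerSeries.coeff_mul, coeff_quotSeries, ← Nat.cast_mul, ← Nat.cast_sum,
    Nat.cast_le]
  calc _ ≤ Module.finrank K ↥(⨆ p ∈ antidiagonal n, U p * V p) :=
        Submodule.finrank_mono (map_mkQ_tensorGrading_le hI hJ n)
    _ ≤ ∑ p ∈ antidiagonal n, Module.finrank K ↥(U p * V p) := finrank_biSup_le_sum _ _
    _ ≤ _ := Finset.sum_le_sum fun p _ => (finrank_mul_le _ _).trans
        (Nat.mul_le_mul (Submodule.finrank_map_le _ _) (Submodule.finrank_map_le _ _))

theorem exists_nsmul_of_coeff_mul_ne_zero {f g : MvPowerSeries (Fin r) ℚ} {c : Fin r → ℕ}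
    (hf : ∀ n : Fin r →₀ ℕ, MvPowerSeries.coeff n f ≠ 0 → ∃ k : ℕ, (n : Fin r → ℕ) = k • c)
    (hg : ∀ n : Fin r →₀ ℕ, MvPowerSeries.coeff n g ≠ 0 → ∃ k : ℕ, (n : Fin r → ℕ) = k • c)
    {n : Fin r →₀ ℕ} (hn : MvPowerSeries.coeff n (f * g) ≠ 0) :
    ∃ k : ℕ, (n : Fin r → ℕ) = k • c := by
  classical
  rw [MvPowerSeries.coeff_mul] at hn
  obtain ⟨⟨a, b⟩, hab, hne⟩ := Finset.exists_ne_zero_of_sum_ne_zero hn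
  obtain ⟨i, hi⟩ := hf a (left_ne_zero_of_mul hne)
  obtain ⟨j, hj⟩ := hg b (right_ne_zero_of_mul hne)
  exact ⟨i + j, by rw [← mem_antidiagonal.1 hab, Finsupp.coe_add, hi, hj, add_smul]⟩

end TensorQuotSeries

section CyclicModule

variable {K R M : Type*} [Field K] [CommRing R] [Algebra K R]
  [AddCommGroup M] [Module K M] [Module R M] {r : ℕ}
  {𝓡 : (Fin r → ℕ) → Submodule K R} {𝓜 : (Fin r → ℤ) → Submodule K M} {w : M}

theorem comap_toSpanSingleton_bot_le (hM : IsGradedModule 𝓡 𝓜) (h𝓡 : iSup 𝓡 = ⊤)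
    {e : Fin r → ℤ} (hw : w ∈ 𝓜 e) {I : Ideal R} (hI : ∀ n, ∀ a ∈ 𝓡 n, a • w = 0 → a ∈ I) :
    (⊥ : Submodule R M).comap (LinearMap.toSpanSingleton R M w) ≤ I := by
  intro a ha
  obtain ⟨f, hf, rfl⟩ := (Submodule.mem_iSup_iff_exists_finsupp 𝓡 a).1 (h𝓡 ▸ Submodule.mem_top)
  refine sum_mem fun n _ => hI n _ (hf n) ?_
  have hproj : ∀ k, gradedProj hM.isInternal (natToInt n + e) (f k • w) =
      if k = n then f k • w else 0 := by
    intro k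
    have hk := hM.smul_mem _ _ _ _ (hf k) hw
    split_ifs with hkn
    · exact gradedProj_of_mem _ (hkn ▸ hk)
    · exact gradedProj_of_mem_ne _ hk fun h => hkn (natToInt_injective (add_right_cancel h))
  have h0 : gradedProj hM.isInternal (natToInt n + e) ((f.sum fun _ b => b) • w) = 0 :=
    (congrArg _ ((Submodule.mem_bot R).1 ha)).trans (map_zero _)
  rw [Finsupp.sum, Finset.sum_smul, map_sum] at h0
  simp only [hproj, Finset.sum_ite_eq'] at h0
  by_cases hn : n ∈ f.support
  · rwa [if_pos hn] at h0
  · rw [Finsupp.notMem_support_iff.1 hn, zero_smul]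

variable [IsScalarTower K R M]

theorem span_singleton_inf (hM : IsGradedModule 𝓡 𝓜) (h𝓡 : iSup 𝓡 = ⊤) {e : Fin r → ℤ}
    (hw : w ∈ 𝓜 e) (n : Fin r → ℕ) :
    (R ∙ w).restrictScalars K ⊓ 𝓜 (natToInt n + e) =
      (𝓡 n).map ((LinearMap.toSpanSingleton R M w).restrictScalars K) := by
  apply le_antisymm
  · rintro m ⟨hm, hmd⟩
    have hle : (R ∙ w).restrictScalars K ≤
        ((𝓡 n).map ((LinearMap.toSpanSingleton R M w).restrictScalars K)).comap
          (gradedProj hM.isInternal (natToInt n + e)) := by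
      refine restrictScalars_span_le h𝓡 fun δ a ha _ hx => ?_
      obtain rfl := Set.mem_singleton_iff.1 hx
      rw [Submodule.mem_comap]
      have haw := hM.smul_mem _ _ _ _ ha hw
      by_cases hδ : δ = n
      · subst hδ
        rw [gradedProj_of_mem _ haw]
        exact ⟨a, ha, rfl⟩
      · rw [gradedProj_of_mem_ne _ haw
          fun h => hδ (natToInt_injective (add_right_cancel h))]
        exact zero_mem _
    exact gradedProj_of_mem hM.isInternal hmd ▸ hle hm
  · rintro _ ⟨a, ha, rfl⟩
    exact ⟨Submodule.smul_mem _ a (Submodule.mem_span_singleton_self w), hM.smul_mem _ _ _ _ ha hw⟩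

theorem le_of_span_singleton_inf_ne_bot (hM : IsGradedModule 𝓡 𝓜) (h𝓡 : iSup 𝓡 = ⊤)
    {d e : Fin r → ℤ} (hw : w ∈ 𝓜 e) (hd : (R ∙ w).restrictScalars K ⊓ 𝓜 d ≠ ⊥) : e ≤ d := by
  contrapose! hd
  have hker : (R ∙ w).restrictScalars K ≤ LinearMap.ker (gradedProj hM.isInternal d) := by
    refine restrictScalars_span_le h𝓡 fun δ a ha _ hx => ?_
    obtain rfl := Set.mem_singleton_iff.1 hx
    refine gradedProj_of_mem_ne _ (hM.smul_mem _ _ _ _ ha hw) ?_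
    rintro rfl
    exact hd (le_add_of_nonneg_left (natToInt_nonneg δ))
  refine (Submodule.eq_bot_iff _).2 fun m ⟨hm, hmd⟩ => ?_
  rw [← gradedProj_of_mem hM.isInternal hmd]
  exact hker hm

theorem nonempty_map_mkQ_equiv (hM : IsGradedModule 𝓡 𝓜) (h𝓡 : iSup 𝓡 = ⊤)
    {e : Fin r → ℤ} (hw : w ∈ 𝓜 e) (P : Submodule R M) (n : Fin r → ℕ) :
    Nonempty ((𝓡 n).map
        ((P.comap (LinearMap.toSpanSingleton R M w)).mkQ.restrictScalars K) ≃ₗ[K]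
      ((R ∙ w).restrictScalars K ⊓ 𝓜 (natToInt n + e)).map (P.mkQ.restrictScalars K)) := by
  let φ : (R ⧸ P.comap (LinearMap.toSpanSingleton R M w)) →ₗ[R] M ⧸ P :=
    Submodule.mapQ _ _ (LinearMap.toSpanSingleton R M w) le_rfl
  have hφ : Function.Injective (φ.restrictScalars K) := by
    rw [LinearMap.coe_restrictScalars, ← LinearMap.ker_eq_bot, Submodule.ker_mapQ,
      Submodule.mkQ_map_self]
  have heq : ((𝓡 n).map ((P.comap (LinearMap.toSpanSingleton R M w)).mkQ.restrictScalars K)).map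
      (φ.restrictScalars K) =
      ((R ∙ w).restrictScalars K ⊓ 𝓜 (natToInt n + e)).map (P.mkQ.restrictScalars K) := by
    rw [span_singleton_inf hM h𝓡 hw, ← Submodule.map_comp, ← Submodule.map_comp]
    rfl
  exact ⟨(Submodule.equivMapOfInjective _ hφ _).trans (LinearEquiv.ofEq _ _ heq)⟩

theorem finite_map_mkQ_comap_toSpanSingleton (hM : IsGradedModule 𝓡 𝓜) (h𝓡 : iSup 𝓡 = ⊤)
    (hfin : ∀ d, Module.Finite K (𝓜 d)) {e : Fin r → ℤ} (hw : w ∈ 𝓜 e) (P : Submodule R M)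
    (n : Fin r → ℕ) :
    Module.Finite K ((𝓡 n).map
      ((P.comap (LinearMap.toSpanSingleton R M w)).mkQ.restrictScalars K)) := by
  obtain ⟨φ⟩ := nonempty_map_mkQ_equiv hM h𝓡 hw P n
  have := hfin (natToInt n + e)
  have : Module.Finite K ↥((R ∙ w).restrictScalars K ⊓ 𝓜 (natToInt n + e)) :=
    Submodule.finiteDimensional_of_le inf_le_right
  exact Module.Finite.equiv φ.symm

theorem hser_sup_span_singleton_sub {s : Fin r → ℤ} (hM : IsGradedModule 𝓡 𝓜)
    (h𝓡 : iSup 𝓡 = ⊤) (hfin : ∀ d, Module.Finite K (𝓜 d)) {P : Submodule R M}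
    (hP : IsGradedSubmodule 𝓜 P) {e : Fin r → ℕ} (hw : w ∈ 𝓜 (s + natToInt e)) :
    hser 𝓜 s (P ⊔ R ∙ w) - hser 𝓜 s P =
      tpow e • quotSeries 𝓡 (P.comap (LinearMap.toSpanSingleton R M w)) := by
  have hRw : IsGradedSubmodule 𝓜 (R ∙ w) := .span hM h𝓡 fun _ hx => ⟨_, hx ▸ hw⟩
  have hsub : ∀ d, (hilbertSeries 𝓜 (P ⊔ R ∙ w) - hilbertSeries 𝓜 P) d =
      Module.finrank K (((R ∙ w).restrictScalars K ⊓ 𝓜 d).map (P.mkQ.restrictScalars K)) :=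
    fun d => (hilbertSeries_sub hfin le_sup_left d).trans
      (by rw [map_mkQ_sup_inf hM.isInternal hP hRw])
  have hlow : ∀ d, (hilbertSeries 𝓜 (P ⊔ R ∙ w) - hilbertSeries 𝓜 P) d ≠ 0 →
      s + natToInt e ≤ d := by
    intro d hd
    refine le_of_span_singleton_inf_ne_bot hM h𝓡 hw fun hbot => hd ?_
    rw [hsub, hbot, Submodule.map_bot, finrank_bot, Nat.cast_zero]
  rw [hser, hser, ← toSeries_sub, toSeries_eq_tpow_smul hlow]
  congr 1
  ext n
  obtain ⟨φ⟩ := nonempty_map_mkQ_equiv hM h𝓡 hw P n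
  rw [coeff_toSeries, hsub, coeff_quotSeries, φ.finrank_eq, add_comm]

end CyclicModule

/-! ### Dévissage to critical ideals -/

section Critical

variable {K R M : Type*} [Field K] [CommRing R] [Algebra K R] [AddCommGroup M] [Module R M]
  {r : ℕ} {𝓡 : (Fin r → ℕ) → Submodule K R} {p : MvPolynomial (Fin r) ℚ}
  {I : Ideal R} {P₁ P₂ : Submodule R M}

/-- The ideals at which the noetherian induction of
`IsFiniteGraded.isRegularAt_smul_hser_sub` stops: `I` is prime as far as homogeneous elements can
tell, contains the homogeneous annihilators of `M`, and `p` divides `1 - t ^ d` for the degree `d`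
of every homogeneous element outside `I`. Homogeneity of `I` is not required. -/
structure IsCritical (𝓡 : (Fin r → ℕ) → Submodule K R) (M : Type*) [AddCommGroup M] [Module R M]
    (p : MvPolynomial (Fin r) ℚ) (I : Ideal R) : Prop where
  one_notMem : (1 : R) ∉ I
  mem_or_mem : ∀ {d e : Fin r → ℕ} {a b : R}, a ∈ 𝓡 d → b ∈ 𝓡 e → a * b ∈ I → a ∈ I ∨ b ∈ I
  mem_of_smul_eq_zero : ∀ {d : Fin r → ℕ} {a : R}, a ∈ 𝓡 d → (∀ m : M, a • m = 0) → a ∈ I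
  dvd : ∀ {d : Fin r → ℕ} {a : R}, a ∈ 𝓡 d → a ∉ I → p ∣ 1 - tpow d

theorem IsCritical.comap {T V : Type*} [CommRing T] [Algebra K T] [AddCommGroup V] [Module T V]
    {𝓣 : (Fin r → ℕ) → Submodule K T} {L : Ideal T} (hL : IsCritical 𝓣 V p L) {φ : R →+* T}
    (hφ : ∀ d, ∀ a ∈ 𝓡 d, φ a ∈ 𝓣 d)
    (hann : ∀ a, (∀ m : M, a • m = 0) → ∀ v : V, φ a • v = 0) :
    IsCritical 𝓡 M p (L.comap φ) where
  one_notMem h := hL.one_notMem (map_one φ ▸ h)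
  mem_or_mem ha hb hab := hL.mem_or_mem (hφ _ _ ha) (hφ _ _ hb) (map_mul φ _ _ ▸ hab)
  mem_of_smul_eq_zero ha h := hL.mem_of_smul_eq_zero (hφ _ _ ha) (hann _ h)
  dvd ha h := hL.dvd (hφ _ _ ha) h

theorem sup_span_singleton_smul_mem (hI : ∀ b ∈ I, ∀ q ∈ P₂, b • q ∈ P₁) {a : R}
    (ha : ∀ q ∈ P₂, a • q ∈ P₁) : ∀ b ∈ I ⊔ Ideal.span {a}, ∀ q ∈ P₂, b • q ∈ P₁ := by
  intro b hb q hq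
  have hle : I ⊔ Ideal.span {a} ≤ P₁.comap (LinearMap.toSpanSingleton R M q) :=
    sup_le (fun b hb => hI b hb q hq) ((Ideal.span_singleton_le_iff_mem _).2 (ha q hq))
  exact hle hb

theorem sup_map_lsmul_le (hle : P₁ ≤ P₂) (a : R) : P₁ ⊔ P₂.map (LinearMap.lsmul R M a) ≤ P₂ :=
  sup_le hle (Submodule.map_le_iff_le_comap.2 fun _ hq => P₂.smul_mem a hq)

theorem smul_mem_of_mem_sup_map_lsmul {a b : R} (hab : ∀ q ∈ P₂, (a * b) • q ∈ P₁) :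
    ∀ q ∈ P₁ ⊔ P₂.map (LinearMap.lsmul R M a), b • q ∈ P₁ := by
  have hle : P₁ ⊔ P₂.map (LinearMap.lsmul R M a) ≤ P₁.comap (LinearMap.lsmul R M b) :=
    sup_le (fun q hq => P₁.smul_mem b hq) (Submodule.map_le_iff_le_comap.2 fun q hq =>
      show b • a • q ∈ P₁ by rw [smul_smul, mul_comm]; exact hab q hq)
  exact fun q hq => hle hq

theorem smul_mem_of_mem_sup_span_singleton {P : Submodule R M} {w : M} {a : R} (ha : a • w ∈ P) :
    ∀ q ∈ P ⊔ R ∙ w, a • q ∈ P := by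
  have hle : P ⊔ R ∙ w ≤ P.comap (LinearMap.lsmul R M a) :=
    sup_le (fun q hq => P.smul_mem a hq) ((Submodule.span_singleton_le_iff_mem _ _).2 ha)
  exact fun q hq => hle hq

variable [Module K M] [IsScalarTower K R M] {𝓜 : (Fin r → ℤ) → Submodule K M} {s : Fin r → ℤ}
  {ι : Type*} {x : ι → R} {δ : ι → Fin r → ℕ} {X : MvPolynomial (Fin r) ℚ}

namespace IsFiniteGraded

theorem isRegularAt_smul_hser_sub_or_isCritical (hV : IsFiniteGraded 𝓡 𝓜 s x δ) (hp : Prime p)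
    (hle : P₁ ≤ P₂) (h₁ : IsGradedSubmodule 𝓜 P₁) (h₂ : IsGradedSubmodule 𝓜 P₂)
    (hI : ∀ b ∈ I, ∀ q ∈ P₂, b • q ∈ P₁)
    (ih : ∀ J, I < J → ∀ Q₁ Q₂ : Submodule R M, Q₁ ≤ Q₂ → IsGradedSubmodule 𝓜 Q₁ →
      IsGradedSubmodule 𝓜 Q₂ → (∀ b ∈ J, ∀ q ∈ Q₂, b • q ∈ Q₁) →
      IsRegularAt p (X • (hser 𝓜 s Q₂ - hser 𝓜 s Q₁))) :
    IsRegularAt p (X • (hser 𝓜 s P₂ - hser 𝓜 s P₁)) ∨ IsCritical 𝓡 M p I := by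
  refine or_iff_not_imp_left.2 fun hreg => ?_
  have regular_of_smul_mem {a : R} (haI : a ∉ I) {Q₁ Q₂ : Submodule R M} (hPQ₁ : P₁ ≤ Q₁)
      (hQ : Q₁ ≤ Q₂) (hPQ₂ : Q₂ ≤ P₂) (hQ₁ : IsGradedSubmodule 𝓜 Q₁)
      (hQ₂ : IsGradedSubmodule 𝓜 Q₂) (ha : ∀ q ∈ Q₂, a • q ∈ Q₁) :
      IsRegularAt p (X • (hser 𝓜 s Q₂ - hser 𝓜 s Q₁)) :=
    ih _ (left_lt_sup.2 fun h => haI (h (Ideal.mem_span_singleton_self a))) Q₁ Q₂ hQ hQ₁ hQ₂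
      (sup_span_singleton_smul_mem (fun b hb q hq => hPQ₁ (hI b hb q (hPQ₂ hq))) ha)
  have graded_map {d : Fin r → ℕ} {a : R} (ha : a ∈ 𝓡 d) :
      IsGradedSubmodule 𝓜 (P₁ ⊔ P₂.map (LinearMap.lsmul R M a)) :=
    h₁.sup hV.graded.isInternal (h₂.map_lsmul hV.graded ha)
  have regular_map {d : Fin r → ℕ} {a : R} (ha : a ∈ 𝓡 d) (haI : a ∉ I) : IsRegularAt p
      (X • (hser 𝓜 s P₂ - hser 𝓜 s (P₁ ⊔ P₂.map (LinearMap.lsmul R M a)))) :=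
    regular_of_smul_mem haI le_sup_left (sup_map_lsmul_le hle a) le_rfl (graded_map ha) h₂
      fun q hq => Submodule.mem_sup_right ⟨q, hq, rfl⟩
  refine ⟨fun h1 => hreg ?_, fun {d e a b} ha _ hab => ?_, fun {d a} _ h => ?_,
    fun {d a} ha haI => ?_⟩
  · have h : P₂ ≤ P₁ := fun q hq => one_smul R q ▸ hI 1 h1 q hq
    rw [le_antisymm hle h, sub_self, smul_zero]
    exact .of_mem_one hp (zero_mem _)
  · by_contra! hnot
    have h := (regular_map ha hnot.1).add hp
      (regular_of_smul_mem hnot.2 le_rfl le_sup_left (sup_map_lsmul_le hle a) h₁ (graded_map ha)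
        (smul_mem_of_mem_sup_map_lsmul (hI _ hab)))
    rw [← smul_add, sub_add_sub_cancel] at h
    exact hreg h
  · by_contra haI
    exact hreg (regular_of_smul_mem haI le_rfl hle le_rfl h₁ h₂ fun q _ => h q ▸ P₁.zero_mem)
  · by_contra hpd
    refine hreg (.of_smul hp hpd ?_)
    rw [smul_comm, one_sub_tpow_smul_hser_sub hV.graded hV.finite hV.lower h₁ h₂ ha, smul_sub,
      smul_comm X]
    exact (regular_map ha haI).sub hp (.smul (regular_of_smul_mem haI le_rfl
      (le_inf hle fun q hq => P₁.smul_mem a hq) inf_le_left h₁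
      (h₂.inf hV.graded.isInternal (h₁.comap_lsmul hV.graded ha)) fun q hq => hq.2) _)

theorem isRegularAt_smul_hser_sub_of_cyclic [IsNoetherian R M] (hV : IsFiniteGraded 𝓡 𝓜 s x δ)
    (hp : Prime p) (hle : P₁ ≤ P₂) (h₁ : IsGradedSubmodule 𝓜 P₁) (h₂ : IsGradedSubmodule 𝓜 P₂)
    (hcyc : ∀ P : Submodule R M, P₁ ≤ P → IsGradedSubmodule 𝓜 P → ∀ d, ∀ w ∈ 𝓜 d, w ∈ P₂ →
      IsRegularAt p (X • (hser 𝓜 s (P ⊔ R ∙ w) - hser 𝓜 s P))) :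
    IsRegularAt p (X • (hser 𝓜 s P₂ - hser 𝓜 s P₁)) := by
  classical
  obtain ⟨Y, hY, rfl⟩ := h₂.exists_finset_span_eq hV.graded.isInternal
  have graded_span {Z : Finset M} (hZ : Z ⊆ Y) :
      IsGradedSubmodule 𝓜 (P₁ ⊔ Submodule.span R (Z : Set M)) :=
    h₁.sup hV.graded.isInternal (.span hV.graded hV.iSup_eq_top fun w hw => hY w (hZ hw))
  suffices ∀ Z ⊆ Y, IsRegularAt p
      (X • (hser 𝓜 s (P₁ ⊔ Submodule.span R (Z : Set M)) - hser 𝓜 s P₁)) by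
    rw [← sup_eq_right.2 hle]
    exact this Y subset_rfl
  intro Z
  induction Z using Finset.induction_on with
  | empty =>
    intro _
    rw [Finset.coe_empty, Submodule.span_empty, sup_bot_eq, sub_self, smul_zero]
    exact .of_mem_one hp (zero_mem _)
  | insert w Z _ ih =>
    intro hZ
    have hwY : w ∈ Y := hZ (Finset.mem_insert_self w Z)
    have hZY : Z ⊆ Y := (Finset.subset_insert w Z).trans hZ
    obtain ⟨d, hd⟩ := hY w hwY
    have h := (hcyc _ le_sup_left (graded_span hZY) d w hd (Submodule.subset_span hwY)).add hp
      (ih hZY)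
    rwa [← smul_add, sub_add_sub_cancel, sup_assoc, sup_comm (Submodule.span R (Z : Set M)),
      ← Submodule.span_insert, ← Finset.coe_insert] at h

theorem isRegularAt_smul_hser_sub [IsNoetherianRing R] [IsNoetherian R M]
    (hV : IsFiniteGraded 𝓡 𝓜 s x δ) (hp : Prime p)
    (hcrit : ∀ I, IsCritical 𝓡 M p I → ∀ P : Submodule R M, IsGradedSubmodule 𝓜 P →
      ∀ d, ∀ w ∈ 𝓜 d, I ≤ P.comap (LinearMap.toSpanSingleton R M w) →
      IsRegularAt p (X • (hser 𝓜 s (P ⊔ R ∙ w) - hser 𝓜 s P)))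
    (hle : P₁ ≤ P₂) (h₁ : IsGradedSubmodule 𝓜 P₁) (h₂ : IsGradedSubmodule 𝓜 P₂) :
    IsRegularAt p (X • (hser 𝓜 s P₂ - hser 𝓜 s P₁)) := by
  suffices ∀ I : Ideal R, ∀ P₁ P₂ : Submodule R M, P₁ ≤ P₂ → IsGradedSubmodule 𝓜 P₁ →
      IsGradedSubmodule 𝓜 P₂ → (∀ b ∈ I, ∀ q ∈ P₂, b • q ∈ P₁) →
      IsRegularAt p (X • (hser 𝓜 s P₂ - hser 𝓜 s P₁)) by
    refine this ⊥ P₁ P₂ hle h₁ h₂ fun b hb q _ => ?_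
    rw [(Submodule.mem_bot R).1 hb, zero_smul]
    exact P₁.zero_mem
  intro I
  induction I using WellFoundedGT.induction with
  | ind I ih =>
  intro P₁ P₂ hle h₁ h₂ hI
  refine (hV.isRegularAt_smul_hser_sub_or_isCritical hp hle h₁ h₂ hI ih).elim id fun hcI => ?_
  exact hV.isRegularAt_smul_hser_sub_of_cyclic hp hle h₁ h₂ fun P hP hgP d w hwd hw =>
    hcrit I hcI P hgP d w hwd fun b hb => hP (hI b hb w hw)

end IsFiniteGraded

end Critical

/-! ### Denominators along a ray -/

section Ray

variable {K R M : Type*} [Field K] [CommRing R] [Algebra K R] [AddCommGroup M] [Module K M]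
  [Module R M] [IsScalarTower K R M] {r : ℕ} {𝓡 : (Fin r → ℕ) → Submodule K R}
  {𝓜 : (Fin r → ℤ) → Submodule K M} {s : Fin r → ℤ} {ι : Type*} {x : ι → R}
  {δ : ι → Fin r → ℕ} {c : Fin r → ℕ} {P₁ P₂ : Submodule R M}

theorem IsFiniteGraded.exists_aeval_smul_hser_sub_mem [IsNoetherian R M] [Finite ι]
    (hV : IsFiniteGraded 𝓡 𝓜 s x δ) (hle : P₁ ≤ P₂) (h₁ : IsGradedSubmodule 𝓜 P₁)
    (h₂ : IsGradedSubmodule 𝓜 P₂)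
    (hray : ∀ i, (∀ k : ℕ, δ i ≠ k • c) → ∀ q ∈ P₂, x i • q ∈ P₁) :
    ∃ D ∈ geomDenoms, Polynomial.aeval (tpow c) D • (hser 𝓜 s P₂ - hser 𝓜 s P₁) ∈ polys r := by
  classical
  cases nonempty_fintype ι
  let A : Finset ι := {i | ∃ k : ℕ, δ i = k • c}
  have hA : ∀ i ∈ A, ∃ k : ℕ, δ i = k • c := fun i hi => (Finset.mem_filter.1 hi).2
  choose! k hk using hA
  refine ⟨∏ i ∈ A, (1 - Polynomial.X ^ k i), prod_mem fun i hi => Submonoid.subset_closure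
    ⟨k i, fun h0 => hV.irrelevant.ne_zero i (by rw [hk i hi, h0, zero_smul]), rfl⟩, ?_⟩
  have hprod : Polynomial.aeval (tpow c) (∏ i ∈ A, (1 - Polynomial.X ^ k i) : Polynomial ℚ) =
      ∏ i ∈ A, (1 - tpow (δ i)) := by
    rw [map_prod]
    refine Finset.prod_congr rfl fun i hi => ?_
    rw [map_sub, map_one, map_pow, Polynomial.aeval_X, hk i hi, tpow_nsmul]
  rw [hprod]
  exact hV.irrelevant.prod_smul_hser_sub_mem hV.graded hV.finite hV.lower A hle h₁ h₂
    fun i hi => hray i fun j hj => hi (Finset.mem_filter.2 ⟨Finset.mem_univ i, j, hj⟩)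

end Ray

section CriticalRing

variable {K R M : Type*} [Field K] [CommRing R] [Algebra K R] [AddCommGroup M] [Module K M]
  [Module R M] [IsScalarTower K R M] {r : ℕ} {𝓡 : (Fin r → ℕ) → Submodule K R}
  [GradedAlgebra 𝓡] {𝓜 : (Fin r → ℤ) → Submodule K M} {p : MvPolynomial (Fin r) ℚ} {I : Ideal R}

theorem IsCritical.exists_annihilator_le [IsNoetherian R M] (hM : IsGradedModule 𝓡 𝓜)
    (hI : IsCritical 𝓡 M p I) : ∃ e, ∃ m ∈ 𝓜 e, ∀ d, ∀ a ∈ 𝓡 d, a • m = 0 → a ∈ I := by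
  classical
  by_contra! hcon
  obtain ⟨X, hX, hspan⟩ := IsGradedSubmodule.exists_finset_span_eq hM.isInternal
    (IsGradedSubmodule.top (R := R) hM.isInternal)
  have exists_annihilator : ∀ Y ⊆ X, ∃ d, ∃ a ∈ 𝓡 d, a ∉ I ∧ ∀ m ∈ Y, a • m = 0 := by
    intro Y
    induction Y using Finset.induction_on with
    | empty =>
      exact fun _ => ⟨0, 1, SetLike.GradedOne.one_mem, hI.one_notMem,
        fun m hm => absurd hm (Finset.notMem_empty m)⟩
    | insert m Y _ ih =>
      intro hY
      obtain ⟨d, a, ha, haI, haY⟩ := ih ((Finset.subset_insert m Y).trans hY)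
      obtain ⟨e, hm⟩ := hX m (hY (Finset.mem_insert_self m Y))
      obtain ⟨d', b, hb, hbm, hbI⟩ := hcon e m hm
      refine ⟨d + d', a * b, SetLike.GradedMul.mul_mem ha hb,
        fun hab => (hI.mem_or_mem ha hb hab).elim haI hbI,
        (Finset.forall_mem_insert _ _ _).2 ⟨?_, fun n hn => ?_⟩⟩
      · rw [mul_smul, hbm, smul_zero]
      · rw [mul_comm, mul_smul, haY n hn, smul_zero]
  obtain ⟨d, a, ha, haI, haX⟩ := exists_annihilator X subset_rfl
  have hle : Submodule.span R (X : Set M) ≤ LinearMap.ker (LinearMap.lsmul R M a) :=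
    Submodule.span_le.2 haX
  exact haI (hI.mem_of_smul_eq_zero ha fun m => hle (hspan ▸ Submodule.mem_top))

theorem IsCritical.exists_comap_toSpanSingleton_le [IsNoetherian R M]
    (hM : IsGradedModule 𝓡 𝓜) (h𝓡 : iSup 𝓡 = ⊤) (hI : IsCritical 𝓡 M p I) :
    ∃ e, ∃ m ∈ 𝓜 e, ∃ P : Submodule R M, IsGradedSubmodule 𝓜 P ∧
      P.comap (LinearMap.toSpanSingleton R M m) ≤ I ∧ ∀ d, ∀ a ∈ 𝓡 d, a ∈ I → a • m ∈ P := by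
  obtain ⟨e, m, hm, hmI⟩ := hI.exists_annihilator_le hM
  refine ⟨e, m, hm, Submodule.span R {v | ∃ d, ∃ a ∈ 𝓡 d, a ∈ I ∧ a • m = v},
    .span hM h𝓡 ?_, ?_, fun d a ha haI => Submodule.subset_span ⟨d, a, ha, haI, rfl⟩⟩
  · rintro _ ⟨d, a, ha, -, rfl⟩
    exact ⟨_, hM.smul_mem _ _ _ _ ha hm⟩
  · have hspan : Submodule.span R {v | ∃ d, ∃ a ∈ 𝓡 d, a ∈ I ∧ a • m = v} ≤
        Submodule.map (LinearMap.toSpanSingleton R M m) I := by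
      rw [Submodule.span_le]
      rintro _ ⟨d, a, -, haI, rfl⟩
      exact ⟨a, haI, rfl⟩
    refine (Submodule.comap_mono hspan).trans ?_
    rw [Submodule.comap_map_eq]
    exact sup_le le_rfl (comap_toSpanSingleton_bot_le hM h𝓡 hm hmI)

theorem IsCritical.exists_quotSeries_mem {s : Fin r → ℤ} {ι : Type*} [Finite ι]
    {x : ι → R} {δ : ι → Fin r → ℕ} [IsNoetherian R M] (hM : IsFiniteGraded 𝓡 𝓜 s x δ)
    (hI : IsCritical 𝓡 M p I) {B : MvPolynomial (Fin r) ℚ} (hB : B ∈ denomIdeal R 𝓜 s)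
    {c : Fin r → ℕ} (hray : ∀ b, p ∣ 1 - tpow b → ∃ k : ℕ, b = k • c) :
    ∃ J ≤ I, (∀ n : Fin r →₀ ℕ, MvPowerSeries.coeff n (quotSeries 𝓡 J) ≠ 0 →
        ∃ k : ℕ, (n : Fin r → ℕ) = k • c) ∧
      (∀ n, Module.Finite K ((𝓡 n).map (J.mkQ.restrictScalars K))) ∧
      B • quotSeries 𝓡 J ∈ polys r ∧
      ∃ D ∈ geomDenoms, Polynomial.aeval (tpow c) D • quotSeries 𝓡 J ∈ polys r := by
  obtain ⟨e, m, hm, P, hP, hPI, hIP⟩ := hI.exists_comap_toSpanSingleton_le hM.graded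
    hM.iSup_eq_top
  have hm0 : m ≠ 0 := fun h0 => hI.one_notMem
    (hPI (show (1 : R) • m ∈ P by rw [h0, smul_zero]; exact P.zero_mem))
  obtain ⟨e, rfl⟩ := exists_eq_add_natToInt (hM.lower e fun h => hm0 ((Submodule.mem_bot K).1
    (h ▸ hm)))
  have mem_ray {d : Fin r → ℕ} {a : R} (ha : a ∈ 𝓡 d) (haP : a • m ∉ P) :
      ∃ k : ℕ, d = k • c :=
    hray d (hI.dvd ha fun haI => haP (hIP d a ha haI))
  have hPm : IsGradedSubmodule 𝓜 (P ⊔ R ∙ m) := hP.sup hM.graded.isInternal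
    (.span hM.graded hM.iSup_eq_top fun _ h => ⟨_, h ▸ hm⟩)
  have hser_sub := hser_sup_span_singleton_sub hM.graded hM.iSup_eq_top hM.finite hP hm
  refine ⟨P.comap (LinearMap.toSpanSingleton R M m), hPI, fun n hn => ?_,
    finite_map_mkQ_comap_toSpanSingleton hM.graded hM.iSup_eq_top hM.finite hm P, ?_, ?_⟩
  · obtain ⟨a, ha, haP⟩ := exists_notMem_of_coeff_quotSeries_ne_zero hn
    exact mem_ray ha haP
  · refine mem_polys_of_tpow_smul_mem (e := e) ?_
    rw [smul_comm, ← hser_sub, smul_sub]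
    exact sub_mem (mem_denomIdeal.1 hB _ hPm) (mem_denomIdeal.1 hB _ hP)
  · obtain ⟨D, hD, hDm⟩ := hM.exists_aeval_smul_hser_sub_mem le_sup_left hP hPm fun i hi =>
      smul_mem_of_mem_sup_span_singleton (not_not.1 fun h =>
        (mem_ray (hM.irrelevant.mem i) h).elim hi)
    rw [hser_sub, smul_comm] at hDm
    exact ⟨D, hD, mem_polys_of_tpow_smul_mem hDm⟩

end CriticalRing

/-! ### Tensor products of graded submodules -/

theorem finrank_biSup_eq_sum {K V κ : Type*} [Field K] [AddCommGroup V] [Module K V]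
    {A : κ → Submodule K V} [∀ k, Module.Finite K (A k)] (hA : iSupIndep A) (s : Finset κ) :
    Module.finrank K ↥(⨆ k ∈ s, A k) = ∑ k ∈ s, Module.finrank K (A k) := by
  classical
  induction s using Finset.induction_on with
  | empty => rw [Finset.sum_empty, ← Finset.sup_eq_iSup, Finset.sup_empty, finrank_bot]
  | insert k s hk ih =>
    have : Module.Finite K ↥(⨆ k ∈ s, A k) := by
      rw [← Finset.sup_eq_iSup]
      infer_instance
    have hinf : A k ⊓ ⨆ l ∈ s, A l = ⊥ := (hA.disjoint_biSup (Finset.mem_coe.not.2 hk)).eq_bot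
    rw [Finset.iSup_insert, Finset.sum_insert hk, ← ih,
      ← Submodule.finrank_sup_add_finrank_inf_eq, hinf, finrank_bot, add_zero]

section MapIncl

variable {K M N : Type*} [Field K] [AddCommGroup M] [Module K M] [AddCommGroup N] [Module K N]

theorem tmul_mem_range_mapIncl {A : Submodule K M} {B : Submodule K N} {m : M} {n : N}
    (hm : m ∈ A) (hn : n ∈ B) : m ⊗ₜ[K] n ∈ LinearMap.range (TensorProduct.mapIncl A B) :=
  ⟨(⟨m, hm⟩ : A) ⊗ₜ[K] (⟨n, hn⟩ : B), TensorProduct.map_tmul _ _ _ _⟩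

theorem range_mapIncl_le {A : Submodule K M} {B : Submodule K N} {Q : Submodule K (M ⊗[K] N)}
    (h : ∀ m ∈ A, ∀ n ∈ B, m ⊗ₜ[K] n ∈ Q) : LinearMap.range (TensorProduct.mapIncl A B) ≤ Q := by
  rw [TensorProduct.range_mapIncl]
  exact Submodule.map₂_le.2 h

theorem finrank_range_mapIncl (A : Submodule K M) (B : Submodule K N) :
    Module.finrank K (LinearMap.range (TensorProduct.mapIncl A B)) =
      Module.finrank K A * Module.finrank K B := by
  rw [LinearMap.finrank_range_of_inj (Module.Flat.tensorProduct_mapIncl_injective_of_right A B),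
    Module.finrank_tensorProduct]

theorem iSupIndep_range_mapIncl {ι κ : Type*} [DecidableEq ι] [DecidableEq κ]
    {𝓜 : ι → Submodule K M} {𝓝 : κ → Submodule K N} (hM : DirectSum.IsInternal 𝓜)
    (hN : DirectSum.IsInternal 𝓝) :
    iSupIndep fun p : ι × κ => LinearMap.range (TensorProduct.mapIncl (𝓜 p.1) (𝓝 p.2)) := by
  rintro ⟨a, b⟩
  let π := TensorProduct.map (gradedProj hM a) (gradedProj hN b)
  have hid : LinearMap.range (TensorProduct.mapIncl (𝓜 a) (𝓝 b)) ≤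
      LinearMap.eqLocus π LinearMap.id := by
    refine range_mapIncl_le fun m hm n hn => ?_
    rw [LinearMap.mem_eqLocus, TensorProduct.map_tmul, gradedProj_of_mem hM hm,
      gradedProj_of_mem hN hn, LinearMap.id_apply]
  have hker : ⨆ q, ⨆ (_ : q ≠ (a, b)), LinearMap.range (TensorProduct.mapIncl (𝓜 q.1) (𝓝 q.2)) ≤
      LinearMap.ker π := by
    refine iSup₂_le fun q hq => range_mapIncl_le fun m hm n hn => ?_
    rw [LinearMap.mem_ker, TensorProduct.map_tmul]
    by_cases ha : q.1 = a
    · have hb : q.2 ≠ b := fun hb => hq (Prod.ext ha hb)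
      rw [gradedProj_of_mem_ne hN hn hb, TensorProduct.tmul_zero]
    · rw [gradedProj_of_mem_ne hM hm ha, TensorProduct.zero_tmul]
  exact Submodule.disjoint_def.2 fun v hv hv' => (hid hv).symm.trans (hker hv')

variable {r : ℕ} {𝓜 : (Fin r → ℤ) → Submodule K M} {𝓝 : (Fin r → ℤ) → Submodule K N}
  {s s' : Fin r → ℤ}

theorem le_of_tmul_ne_zero (hs : ∀ d, 𝓜 d ≠ ⊥ → s ≤ d) (hs' : ∀ d, 𝓝 d ≠ ⊥ → s' ≤ d)
    {a b : Fin r → ℤ} {m : M} {n : N} (hm : m ∈ 𝓜 a) (hn : n ∈ 𝓝 b) (h : m ⊗ₜ[K] n ≠ 0) :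
    s ≤ a ∧ s' ≤ b := by
  refine ⟨hs a (Submodule.ne_bot_iff _ |>.2 ⟨m, hm, ?_⟩),
    hs' b (Submodule.ne_bot_iff _ |>.2 ⟨n, hn, ?_⟩)⟩
  · rintro rfl
    exact h (TensorProduct.zero_tmul M n)
  · rintro rfl
    exact h (TensorProduct.tmul_zero N m)

theorem le_of_tensorGrading_ne_bot (hs : ∀ d, 𝓜 d ≠ ⊥ → s ≤ d) (hs' : ∀ d, 𝓝 d ≠ ⊥ → s' ≤ d)
    (d : Fin r → ℤ) (hd : tensorGrading 𝓜 𝓝 d ≠ ⊥) : s + s' ≤ d := by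
  contrapose! hd
  refine le_bot_iff.1 (tensorGrading_induction _ ?_)
  rintro a b rfl m hm n hn
  contrapose! hd
  obtain ⟨ha, hb⟩ := le_of_tmul_ne_zero hs hs' hm hn hd
  exact add_le_add ha hb

open Finset.HasAntidiagonal (antidiagonal mem_antidiagonal)

theorem tensorGrading_eq_biSup_antidiagonal (hs : ∀ d, 𝓜 d ≠ ⊥ → s ≤ d)
    (hs' : ∀ d, 𝓝 d ≠ ⊥ → s' ≤ d) (n : Fin r →₀ ℕ) :
    tensorGrading 𝓜 𝓝 (s + s' + natToInt n) = ⨆ p ∈ antidiagonal n,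
      LinearMap.range (TensorProduct.mapIncl (𝓜 (s + natToInt p.1)) (𝓝 (s' + natToInt p.2))) := by
  refine le_antisymm (tensorGrading_induction _ fun a b hab m hm y hy => ?_)
    (iSup₂_le fun p hp => range_mapIncl_le fun m hm y hy => ?_)
  · by_cases h0 : m ⊗ₜ[K] y = 0
    · rw [h0]
      exact zero_mem _
    obtain ⟨ha, hb⟩ := le_of_tmul_ne_zero hs hs' hm hy h0
    obtain ⟨i, rfl⟩ := exists_eq_add_natToInt ha
    obtain ⟨j, rfl⟩ := exists_eq_add_natToInt hb
    have hij : i + j = n := natToInt_injective (by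
      rw [natToInt_add]
      linear_combination hab)
    let i' := Finsupp.equivFunOnFinite.symm i
    let j' := Finsupp.equivFunOnFinite.symm j
    exact Submodule.mem_iSup_of_mem (i', j') (Submodule.mem_iSup_of_mem
      (mem_antidiagonal.2 (DFunLike.coe_injective hij)) (tmul_mem_range_mapIncl hm hy))
  · have hn : s + s' + natToInt n = (s + natToInt p.1) + (s' + natToInt p.2) := by
      rw [← mem_antidiagonal.1 hp, Finsupp.coe_add, natToInt_add]
      ring
    exact hn ▸ tmul_mem_tensorGrading hm hy

end MapIncl

section TensorSub

variable {K R S M N : Type*} [Field K] [CommRing R] [Algebra K R] [CommRing S] [Algebra K S]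
  [AddCommGroup M] [Module K M] [Module R M] [IsScalarTower K R M]
  [AddCommGroup N] [Module K N] [Module S N] [IsScalarTower K S N] {r : ℕ}
  {𝓜 : (Fin r → ℤ) → Submodule K M} {𝓝 : (Fin r → ℤ) → Submodule K N}

/-- The image of `P ⊗ Q` in `M ⊗ N`, as a submodule over `R ⊗ S`. -/
def tensorSub (P : Submodule R M) (Q : Submodule S N) : Submodule (R ⊗[K] S) (M ⊗[K] N) where
  __ := LinearMap.range (TensorProduct.mapIncl (P.restrictScalars K) (Q.restrictScalars K))
  smul_mem' x y hy := by
    set V := LinearMap.range (TensorProduct.mapIncl (P.restrictScalars K) (Q.restrictScalars K))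
    change x • y ∈ V
    induction x with
    | zero => rw [zero_smul]; exact V.zero_mem
    | add x x' hx hx' => rw [add_smul]; exact V.add_mem hx hx'
    | tmul a b =>
      suffices V ≤ V.comap (tensorAction K R S M N (a ⊗ₜ b)) from this hy
      refine range_mapIncl_le fun m hm n hn => ?_
      rw [Submodule.mem_comap, ← tensor_smul_def, tmul_smul_tmul]
      exact tmul_mem_range_mapIncl (P.smul_mem a hm) (Q.smul_mem b hn)

theorem tensorGrading_inf_le (P : Submodule R M) (Q : Submodule S N) (d : Fin r → ℤ) :
    tensorGrading (fun a => P.restrictScalars K ⊓ 𝓜 a) (fun b => Q.restrictScalars K ⊓ 𝓝 b) d ≤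
      (tensorSub (K := K) P Q).restrictScalars K ⊓ tensorGrading 𝓜 𝓝 d := by
  refine tensorGrading_induction _ ?_
  rintro a b rfl m hm n hn
  exact ⟨tmul_mem_range_mapIncl hm.1 hn.1, tmul_mem_tensorGrading hm.2 hn.2⟩

variable {P : Submodule R M} {Q : Submodule S N}

theorem gradedProj_tensorSub_mem (hM : DirectSum.IsInternal 𝓜) (hN : DirectSum.IsInternal 𝓝)
    (hP : IsGradedSubmodule 𝓜 P) (hQ : IsGradedSubmodule 𝓝 Q) {y : M ⊗[K] N}
    (hy : y ∈ tensorSub (K := K) P Q) (d : Fin r → ℤ) :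
    gradedProj (tensorGrading_isInternal hM hN) d y ∈
      tensorGrading (fun a => P.restrictScalars K ⊓ 𝓜 a)
        (fun b => Q.restrictScalars K ⊓ 𝓝 b) d := by
  set 𝓣 := tensorGrading (fun a => P.restrictScalars K ⊓ 𝓜 a) fun b => Q.restrictScalars K ⊓ 𝓝 b
  set π := gradedProj (tensorGrading_isInternal hM hN) d
  have hhom : ∀ a, ∀ m ∈ P.restrictScalars K ⊓ 𝓜 a, ∀ b, ∀ n ∈ Q.restrictScalars K ⊓ 𝓝 b,
      π (m ⊗ₜ n) ∈ 𝓣 d := by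
    intro a m hm b n hn
    have hmn := tmul_mem_tensorGrading hm.2 hn.2
    by_cases hab : a + b = d
    · subst hab
      rw [gradedProj_of_mem _ hmn]
      exact tmul_mem_tensorGrading (𝓜 := fun a => P.restrictScalars K ⊓ 𝓜 a) hm hn
    · rw [gradedProj_of_mem_ne _ hmn hab]
      exact zero_mem _
  suffices LinearMap.range (TensorProduct.mapIncl (P.restrictScalars K) (Q.restrictScalars K)) ≤
    (𝓣 d).comap π from this hy
  refine range_mapIncl_le fun m hm n hn => ?_
  refine mem_of_gradedProj_mem (Q := (𝓣 d).comap (π ∘ₗ (TensorProduct.mk K M N).flip n)) hM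
    fun a => ?_
  refine mem_of_gradedProj_mem (Q := (𝓣 d).comap (π ∘ₗ TensorProduct.mk K M N _)) hN fun b => ?_
  exact hhom a _ ⟨hP.gradedProj_mem hM hm a, gradedProj_mem hM a m⟩ b _
    ⟨hQ.gradedProj_mem hN hn b, gradedProj_mem hN b n⟩

theorem IsGradedSubmodule.tensorSub (hM : DirectSum.IsInternal 𝓜) (hN : DirectSum.IsInternal 𝓝)
    (hP : IsGradedSubmodule 𝓜 P) (hQ : IsGradedSubmodule 𝓝 Q) :
    IsGradedSubmodule (tensorGrading 𝓜 𝓝) (tensorSub (K := K) P Q) :=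
  (isGradedSubmodule_iff (tensorGrading_isInternal hM hN)).2 fun _ hy d =>
    (tensorGrading_inf_le P Q d (gradedProj_tensorSub_mem hM hN hP hQ hy d)).1

theorem tensorSub_inf_tensorGrading (hM : DirectSum.IsInternal 𝓜) (hN : DirectSum.IsInternal 𝓝)
    (hP : IsGradedSubmodule 𝓜 P) (hQ : IsGradedSubmodule 𝓝 Q) (d : Fin r → ℤ) :
    (tensorSub (K := K) P Q).restrictScalars K ⊓ tensorGrading 𝓜 𝓝 d =
      tensorGrading (fun a => P.restrictScalars K ⊓ 𝓜 a)
        (fun b => Q.restrictScalars K ⊓ 𝓝 b) d := by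
  refine le_antisymm (fun y ⟨hy, hyd⟩ => ?_) (tensorGrading_inf_le P Q d)
  rw [← gradedProj_of_mem (tensorGrading_isInternal hM hN) hyd]
  exact gradedProj_tensorSub_mem hM hN hP hQ hy d

variable {𝓡 : (Fin r → ℕ) → Submodule K R} {𝓢 : (Fin r → ℕ) → Submodule K S}
  {s s' : Fin r → ℤ} {ι ι' : Type*} {x : ι → R} {δ : ι → Fin r → ℕ} {y : ι' → S}
  {δ' : ι' → Fin r → ℕ}

theorem hser_tensorSub (hM : IsFiniteGraded 𝓡 𝓜 s x δ) (hN : IsFiniteGraded 𝓢 𝓝 s' y δ')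
    (hP : IsGradedSubmodule 𝓜 P) (hQ : IsGradedSubmodule 𝓝 Q) :
    hser (tensorGrading 𝓜 𝓝) (s + s') (tensorSub (K := K) P Q) = hser 𝓜 s P * hser 𝓝 s' Q := by
  classical
  ext n
  rw [coeff_hser, hilbertSeries, tensorSub_inf_tensorGrading hM.graded.isInternal
    hN.graded.isInternal hP hQ, MvPowerSeries.coeff_mul, tensorGrading_eq_biSup_antidiagonal
    (fun d hd => hM.lower d (ne_bot_of_le_ne_bot hd inf_le_right))
    fun d hd => hN.lower d (ne_bot_of_le_ne_bot hd inf_le_right)]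
  have hfinM (d) : Module.Finite K ↥(P.restrictScalars K ⊓ 𝓜 d) :=
    have := hM.finite d
    Submodule.finiteDimensional_of_le inf_le_right
  have hfinN (d) : Module.Finite K ↥(Q.restrictScalars K ⊓ 𝓝 d) :=
    have := hN.finite d
    Submodule.finiteDimensional_of_le inf_le_right
  have hdeg : Function.Injective fun p : (Fin r →₀ ℕ) × (Fin r →₀ ℕ) =>
      (s + natToInt p.1, s' + natToInt p.2) :=
    ((add_right_injective s).comp (natToInt_injective.comp DFunLike.coe_injective)).prodMap
      ((add_right_injective s').comp (natToInt_injective.comp DFunLike.coe_injective))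
  let A (p : (Fin r →₀ ℕ) × (Fin r →₀ ℕ)) : Submodule K (M ⊗[K] N) :=
    LinearMap.range (TensorProduct.mapIncl (P.restrictScalars K ⊓ 𝓜 (s + natToInt p.1))
      (Q.restrictScalars K ⊓ 𝓝 (s' + natToInt p.2)))
  have hA : iSupIndep A :=
    ((iSupIndep_range_mapIncl hM.graded.isInternal hN.graded.isInternal).comp hdeg).mono
      fun p => TensorProduct.range_mapIncl_mono inf_le_right inf_le_right
  rw [finrank_biSup_eq_sum hA, Nat.cast_sum]
  refine Finset.sum_congr rfl fun p _ => ?_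
  rw [finrank_range_mapIncl, Nat.cast_mul]
  rfl

end TensorSub

/-! ### The universal denominator of a tensor product -/

section TensorRegular

variable {K R S M N : Type*} [Field K] [CommRing R] [Algebra K R] [CommRing S] [Algebra K S]
  [AddCommGroup M] [Module K M] [Module R M] [IsScalarTower K R M]
  [AddCommGroup N] [Module K N] [Module S N] [IsScalarTower K S N] {r : ℕ}
  {𝓡 : (Fin r → ℕ) → Submodule K R} {𝓢 : (Fin r → ℕ) → Submodule K S}
  {𝓜 : (Fin r → ℤ) → Submodule K M} {𝓝 : (Fin r → ℤ) → Submodule K N}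

theorem tmul_one_smul_eq_zero {a : R} (h : ∀ m : M, a • m = 0) (v : M ⊗[K] N) :
    (a ⊗ₜ[K] (1 : S)) • v = 0 := by
  induction v with
  | zero => rw [smul_zero]
  | add v w hv hw => rw [smul_add, hv, hw, add_zero]
  | tmul m n => rw [tmul_smul_tmul, h, TensorProduct.zero_tmul]

theorem one_tmul_smul_eq_zero {b : S} (h : ∀ n : N, b • n = 0) (v : M ⊗[K] N) :
    ((1 : R) ⊗ₜ[K] b) • v = 0 := by
  induction v with
  | zero => rw [smul_zero]
  | add v w hv hw => rw [smul_add, hv, hw, add_zero]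
  | tmul m n => rw [tmul_smul_tmul, h, TensorProduct.tmul_zero]

theorem tmul_one_mem_tensorGrading [GradedAlgebra 𝓢] {d : Fin r → ℕ} {a : R} (ha : a ∈ 𝓡 d) :
    a ⊗ₜ[K] (1 : S) ∈ tensorGrading 𝓡 𝓢 d := by
  have h := tmul_mem_tensorGrading ha (SetLike.GradedOne.one_mem (A := 𝓢))
  rwa [add_zero] at h

theorem one_tmul_mem_tensorGrading [GradedAlgebra 𝓡] {d : Fin r → ℕ} {b : S} (hb : b ∈ 𝓢 d) :
    (1 : R) ⊗ₜ[K] b ∈ tensorGrading 𝓡 𝓢 d := by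
  have h := tmul_mem_tensorGrading (SetLike.GradedOne.one_mem (A := 𝓡)) hb
  rwa [zero_add] at h

variable {p : MvPolynomial (Fin r) ℚ} {L : Ideal (R ⊗[K] S)}

theorem IsCritical.comap_includeLeft [GradedAlgebra 𝓢]
    (hL : IsCritical (tensorGrading 𝓡 𝓢) (M ⊗[K] N) p L) :
    IsCritical 𝓡 M p (L.comap (Algebra.TensorProduct.includeLeftRingHom : R →+* R ⊗[K] S)) :=
  hL.comap (fun _ _ => tmul_one_mem_tensorGrading) fun _ => tmul_one_smul_eq_zero

theorem IsCritical.comap_includeRight [GradedAlgebra 𝓡]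
    (hL : IsCritical (tensorGrading 𝓡 𝓢) (M ⊗[K] N) p L) :
    IsCritical 𝓢 N p
      (L.comap (Algebra.TensorProduct.includeRight : S →ₐ[K] R ⊗[K] S).toRingHom) :=
  hL.comap (fun _ _ => one_tmul_mem_tensorGrading) fun _ => one_tmul_smul_eq_zero

variable [GradedAlgebra 𝓡] [GradedAlgebra 𝓢] [IsNoetherian R M] [IsNoetherian S N]
  {s s' : Fin r → ℤ} {ι ι' : Type*} [Finite ι] [Finite ι'] {x : ι → R} {δ : ι → Fin r → ℕ}
  {y : ι' → S} {δ' : ι' → Fin r → ℕ} {B B' : MvPolynomial (Fin r) ℚ}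

theorem IsCritical.isRegularAt_smul_quotSeries {c : Fin r → ℕ}
    (hL : IsCritical (tensorGrading 𝓡 𝓢) (M ⊗[K] N) p L)
    (hM : IsFiniteGraded 𝓡 𝓜 s x δ) (hN : IsFiniteGraded 𝓢 𝓝 s' y δ')
    (hB : B ∈ denomIdeal R 𝓜 s) (hB' : B' ∈ denomIdeal S 𝓝 s') (hp : Prime p) (hc : c ≠ 0)
    (hpc : p ∣ 1 - tpow c) (hray : ∀ b, p ∣ 1 - tpow b → ∃ k : ℕ, b = k • c)
    {L' : Ideal (R ⊗[K] S)} (hLL' : L ≤ L') {D : Polynomial ℚ} (hD : D ∈ geomDenoms)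
    (hDL' : Polynomial.aeval (tpow c) D • quotSeries (tensorGrading 𝓡 𝓢) L' ∈ polys r) :
    IsRegularAt p ((B * B') • quotSeries (tensorGrading 𝓡 𝓢) L') := by
  obtain ⟨I, hI, hrayI, hfinI, hBI, E, hE, hEI⟩ :=
    hL.comap_includeLeft.exists_quotSeries_mem hM hB hray
  obtain ⟨J, hJ, hrayJ, hfinJ, hBJ, F, hF, hFJ⟩ :=
    hL.comap_includeRight.exists_quotSeries_mem hN hB' hray
  have ne_zero_I : quotSeries 𝓡 I ≠ 0 := quotSeries_ne_zero hM.iSup_eq_top hfinI fun h =>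
    hL.comap_includeLeft.one_notMem (hI (h ▸ Submodule.mem_top))
  have ne_zero_J : quotSeries 𝓢 J ≠ 0 := quotSeries_ne_zero hN.iSup_eq_top hfinJ fun h =>
    hL.comap_includeRight.one_notMem (hJ (h ▸ Submodule.mem_top))
  refine isRegularAt_smul_of_coeff_le (g := quotSeries 𝓡 I * quotSeries 𝓢 J) (D := D * (E * F))
    hp hc hpc coeff_quotSeries_nonneg
    (coeff_quotSeries_tensorGrading_le (fun a ha => hLL' (hI ha)) (fun b hb => hLL' (hJ hb))
      hfinI hfinJ) (mul_ne_zero ne_zero_I ne_zero_J)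
    (fun n hn => exists_nsmul_of_coeff_mul_ne_zero hrayI hrayJ hn)
    (mul_mem hD (mul_mem hE hF)) ?_ ?_ ?_
  · rw [mul_comm, map_mul, mul_smul]
    exact Submodule.smul_mem _ _ hDL'
  · rw [map_mul, mul_smul, map_mul, mul_smul_mul_comm]
    exact Submodule.smul_mem _ _ (mul_mem_polys hEI hFJ)
  · rw [mul_smul_mul_comm]
    exact mul_mem_polys hBI hBJ

variable [IsNoetherian (R ⊗[K] S) (M ⊗[K] N)] {κ : Type*} [Finite κ] {z : κ → R ⊗[K] S}
  {γ : κ → Fin r → ℕ}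

theorem IsCritical.isRegularAt_smul_hser_sup_span_singleton_sub
    (hL : IsCritical (tensorGrading 𝓡 𝓢) (M ⊗[K] N) p L)
    (hM : IsFiniteGraded 𝓡 𝓜 s x δ) (hN : IsFiniteGraded 𝓢 𝓝 s' y δ')
    (hV : IsFiniteGraded (tensorGrading 𝓡 𝓢) (tensorGrading 𝓜 𝓝) (s + s') z γ)
    (hB : B ∈ denomIdeal R 𝓜 s) (hB' : B' ∈ denomIdeal S 𝓝 s') (hp : Prime p)
    {P : Submodule (R ⊗[K] S) (M ⊗[K] N)} (hP : IsGradedSubmodule (tensorGrading 𝓜 𝓝) P)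
    {d : Fin r → ℤ} {w : M ⊗[K] N} (hw : w ∈ tensorGrading 𝓜 𝓝 d)
    (hLw : L ≤ P.comap (LinearMap.toSpanSingleton (R ⊗[K] S) (M ⊗[K] N) w)) :
    IsRegularAt p ((B * B') • (hser (tensorGrading 𝓜 𝓝) (s + s') (P ⊔ (R ⊗[K] S) ∙ w) -
      hser (tensorGrading 𝓜 𝓝) (s + s') P)) := by
  rcases eq_or_ne w 0 with rfl | hw0
  · rw [Submodule.span_zero_singleton, sup_bot_eq, sub_self, smul_zero]
    exact .of_mem_one hp (zero_mem _)
  obtain ⟨e, rfl⟩ := exists_eq_add_natToInt (hV.lower d fun h => hw0 ((Submodule.mem_bot K).1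
    (h ▸ hw)))
  have hPw : IsGradedSubmodule (tensorGrading 𝓜 𝓝) (P ⊔ (R ⊗[K] S) ∙ w) :=
    hP.sup hV.graded.isInternal
      (.span hV.graded hV.iSup_eq_top fun _ h => ⟨_, h ▸ hw⟩)
  have smul_mem (i : κ) (hi : ¬ p ∣ 1 - tpow (γ i)) : ∀ q ∈ P ⊔ (R ⊗[K] S) ∙ w, z i • q ∈ P :=
    smul_mem_of_mem_sup_span_singleton (hLw (not_not.1 fun h =>
      hi (hL.dvd (hV.irrelevant.mem i) h)))
  by_cases hd : ∃ d : Fin r → ℕ, d ≠ 0 ∧ p ∣ 1 - tpow d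
  · obtain ⟨d, hd0, hpd⟩ := hd
    obtain ⟨c, hc, hpc, hray⟩ := exists_generator_of_prime_dvd hp hd0 hpd
    obtain ⟨D, hD, hDw⟩ := hV.exists_aeval_smul_hser_sub_mem (c := c) le_sup_left hP hPw
      fun i hi => smul_mem i fun h => (hray _ h).elim hi
    rw [hser_sup_span_singleton_sub hV.graded hV.iSup_eq_top hV.finite hP hw] at hDw ⊢
    rw [smul_comm] at hDw ⊢
    exact (hL.isRegularAt_smul_quotSeries hM hN hB hB' hp hc hpc hray hLw hD
      (mem_polys_of_tpow_smul_mem hDw)).smul _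
  · push Not at hd
    exact .of_mem_one hp (Submodule.smul_mem _ _ (hV.irrelevant.hser_sub_mem hV.graded
      le_sup_left hP fun i => smul_mem i (hd _ (hV.irrelevant.ne_zero i))))

theorem isRegularAt_smul_hser_sub_tensor [IsNoetherianRing (R ⊗[K] S)]
    (hM : IsFiniteGraded 𝓡 𝓜 s x δ) (hN : IsFiniteGraded 𝓢 𝓝 s' y δ')
    (hV : IsFiniteGraded (tensorGrading 𝓡 𝓢) (tensorGrading 𝓜 𝓝) (s + s') z γ)
    (hB : B ∈ denomIdeal R 𝓜 s) (hB' : B' ∈ denomIdeal S 𝓝 s') (hp : Prime p)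
    {P₁ P₂ : Submodule (R ⊗[K] S) (M ⊗[K] N)} (hle : P₁ ≤ P₂)
    (h₁ : IsGradedSubmodule (tensorGrading 𝓜 𝓝) P₁)
    (h₂ : IsGradedSubmodule (tensorGrading 𝓜 𝓝) P₂) :
    IsRegularAt p ((B * B') • (hser (tensorGrading 𝓜 𝓝) (s + s') P₂ -
      hser (tensorGrading 𝓜 𝓝) (s + s') P₁)) :=
  hV.isRegularAt_smul_hser_sub hp (fun _ hL _ hP _ _ hw hLw =>
    hL.isRegularAt_smul_hser_sup_span_singleton_sub hM hN hV hB hB' hp hP hw hLw) hle h₁ h₂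

end TensorRegular

section TensorFinite

variable {K R S M N : Type*} [Field K] [CommRing R] [Algebra K R] [CommRing S] [Algebra K S]
  [AddCommGroup M] [Module K M] [Module R M] [IsScalarTower K R M]
  [AddCommGroup N] [Module K N] [Module S N] [IsScalarTower K S N] {r : ℕ}
  {𝓡 : (Fin r → ℕ) → Submodule K R} {𝓢 : (Fin r → ℕ) → Submodule K S}

theorem tmul_mem_of_left_mem_span {L : Ideal (R ⊗[K] S)} {X : Set R}
    (h : ∀ a ∈ X, a ⊗ₜ[K] (1 : S) ∈ L) {a : R} (ha : a ∈ Ideal.span X) (b : S) :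
    a ⊗ₜ[K] b ∈ L := by
  have hle : Ideal.span X ≤
      L.comap (Algebra.TensorProduct.includeLeftRingHom : R →+* R ⊗[K] S) := Ideal.span_le.2 h
  simpa using L.mul_mem_left ((1 : R) ⊗ₜ[K] b) (hle ha)

theorem tmul_mem_of_right_mem_span {L : Ideal (R ⊗[K] S)} {Y : Set S}
    (h : ∀ b ∈ Y, (1 : R) ⊗ₜ[K] b ∈ L) (a : R) {b : S} (hb : b ∈ Ideal.span Y) :
    a ⊗ₜ[K] b ∈ L := by
  have hle : Ideal.span Y ≤
      L.comap (Algebra.TensorProduct.includeRight : S →ₐ[K] R ⊗[K] S).toRingHom :=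
    Ideal.span_le.2 h
  simpa using L.mul_mem_left (a ⊗ₜ[K] (1 : S)) (hle hb)

theorem IsIrrelevantSystem.tensor [GradedAlgebra 𝓡] [GradedAlgebra 𝓢] {ι ι' : Type*}
    {x : ι → R} {δ : ι → Fin r → ℕ} {y : ι' → S} {δ' : ι' → Fin r → ℕ}
    (hx : IsIrrelevantSystem 𝓡 x δ) (hy : IsIrrelevantSystem 𝓢 y δ') :
    IsIrrelevantSystem (tensorGrading 𝓡 𝓢)
      (Sum.elim (fun i => x i ⊗ₜ[K] (1 : S)) fun j => (1 : R) ⊗ₜ[K] y j) (Sum.elim δ δ') where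
  mem
    | .inl i => tmul_one_mem_tensorGrading (hx.mem i)
    | .inr j => one_tmul_mem_tensorGrading (hy.mem j)
  ne_zero
    | .inl i => hx.ne_zero i
    | .inr j => hy.ne_zero j
  exists_fg := by
    obtain ⟨F, hF, hFtop⟩ := hx.exists_fg
    obtain ⟨G, hG, hGtop⟩ := hy.exists_fg
    have := Module.Finite.iff_fg.2 hF
    have := Module.Finite.iff_fg.2 hG
    refine ⟨LinearMap.range (TensorProduct.mapIncl F G), Module.Finite.iff_fg.1 inferInstance, ?_⟩
    set L : Ideal (R ⊗[K] S) := Ideal.span (Set.range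
      (Sum.elim (fun i => x i ⊗ₜ[K] (1 : S)) fun j => (1 : R) ⊗ₜ[K] y j))
    rw [eq_top_iff, ← TensorProduct.span_tmul_eq_top, Submodule.span_le]
    rintro _ ⟨a, b, rfl⟩
    obtain ⟨f, hf, a', ha', rfl⟩ := Submodule.mem_sup.1 (hFtop.ge (Submodule.mem_top (x := a)))
    obtain ⟨g, hg, b', hb', rfl⟩ := Submodule.mem_sup.1 (hGtop.ge (Submodule.mem_top (x := b)))
    rw [TensorProduct.add_tmul, TensorProduct.tmul_add, add_assoc]
    refine Submodule.add_mem_sup (tmul_mem_range_mapIncl hf hg) (L.add_mem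
      (tmul_mem_of_right_mem_span (Set.forall_mem_range.2 fun j => ?_) f hb')
      (tmul_mem_of_left_mem_span (Set.forall_mem_range.2 fun i => ?_) ha' (g + b')))
    · exact Ideal.subset_span ⟨Sum.inr j, rfl⟩
    · exact Ideal.subset_span ⟨Sum.inl i, rfl⟩

theorem isNoetherianRing_tensor [Algebra.FiniteType K R] [Algebra.FiniteType K S] :
    IsNoetherianRing (R ⊗[K] S) :=
  have := Algebra.FiniteType.isNoetherianRing K R
  Algebra.FiniteType.isNoetherianRing R (R ⊗[K] S)

theorem tmul_mem_of_mem_span {L : Submodule (R ⊗[K] S) (M ⊗[K] N)} {X : Set M} {Y : Set N}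
    (h : ∀ m ∈ X, ∀ n ∈ Y, m ⊗ₜ[K] n ∈ L) {m : M} {n : N} (hm : m ∈ Submodule.span R X)
    (hn : n ∈ Submodule.span S Y) : m ⊗ₜ[K] n ∈ L := by
  induction hm using Submodule.span_induction with
  | mem m hm =>
    induction hn using Submodule.span_induction with
    | mem n hn => exact h m hm n hn
    | zero => rw [TensorProduct.tmul_zero]; exact L.zero_mem
    | add n n' _ _ hn hn' => rw [TensorProduct.tmul_add]; exact L.add_mem hn hn'
    | smul b n _ hn => simpa only [tmul_smul_tmul, one_smul] using L.smul_mem ((1 : R) ⊗ₜ[K] b) hn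
  | zero => rw [TensorProduct.zero_tmul]; exact L.zero_mem
  | add m m' _ _ hm hm' => rw [TensorProduct.add_tmul]; exact L.add_mem hm hm'
  | smul a m _ hm => simpa only [tmul_smul_tmul, one_smul] using L.smul_mem (a ⊗ₜ[K] (1 : S)) hm

theorem finite_tensor [Module.Finite R M] [Module.Finite S N] :
    Module.Finite (R ⊗[K] S) (M ⊗[K] N) := by
  obtain ⟨X, hX⟩ := Module.finite_def.1 ‹Module.Finite R M›
  obtain ⟨Y, hY⟩ := Module.finite_def.1 ‹Module.Finite S N›
  refine Module.finite_def.2 (Submodule.fg_def.2 ⟨Set.image2 (· ⊗ₜ[K] ·) X Y,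
    X.finite_toSet.image2 _ Y.finite_toSet, ?_⟩)
  rw [← Submodule.restrictScalars_eq_top_iff K, eq_top_iff, ← TensorProduct.span_tmul_eq_top,
    Submodule.span_le]
  rintro _ ⟨m, n, rfl⟩
  exact tmul_mem_of_mem_span (X := (X : Set M)) (Y := (Y : Set N))
    (fun m hm n hn => Submodule.subset_span (Set.mem_image2_of_mem hm hn)) (hX ▸ Submodule.mem_top)
    (hY ▸ Submodule.mem_top)

end TensorFinite

section TensorDenominator

variable {K R S M N : Type*} [Field K] [CommRing R] [Algebra K R] [CommRing S] [Algebra K S]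
  [AddCommGroup M] [Module K M] [Module R M] [IsScalarTower K R M]
  [AddCommGroup N] [Module K N] [Module S N] [IsScalarTower K S N] {r : ℕ}
  {𝓡 : (Fin r → ℕ) → Submodule K R} {𝓢 : (Fin r → ℕ) → Submodule K S}
  {𝓜 : (Fin r → ℤ) → Submodule K M} {𝓝 : (Fin r → ℤ) → Submodule K N}
  {s s' : Fin r → ℤ} {ι ι' κ : Type*} {x : ι → R} {δ : ι → Fin r → ℕ}
  {y : ι' → S} {δ' : ι' → Fin r → ℕ} {z : κ → R ⊗[K] S} {γ : κ → Fin r → ℕ}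
  {B B' C : MvPolynomial (Fin r) ℚ}

theorem mul_mem_denomIdeal_tensorGrading [GradedAlgebra 𝓡] [GradedAlgebra 𝓢] [IsNoetherian R M]
    [IsNoetherian S N] [IsNoetherianRing (R ⊗[K] S)] [IsNoetherian (R ⊗[K] S) (M ⊗[K] N)]
    [Finite ι] [Finite ι'] [Finite κ] (hM : IsFiniteGraded 𝓡 𝓜 s x δ)
    (hN : IsFiniteGraded 𝓢 𝓝 s' y δ')
    (hV : IsFiniteGraded (tensorGrading 𝓡 𝓢) (tensorGrading 𝓜 𝓝) (s + s') z γ)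
    (hB : B ∈ denomIdeal R 𝓜 s) (hB' : B' ∈ denomIdeal S 𝓝 s') :
    B * B' ∈ denomIdeal (R ⊗[K] S) (tensorGrading 𝓜 𝓝) (s + s') := by
  have := Fintype.ofFinite κ
  refine mem_denomIdeal.2 fun P hP => ?_
  have hbot := IsGradedSubmodule.bot (R := R ⊗[K] S) hV.graded.isInternal
  have hD := hV.prod_smul_hser_sub_mem bot_le hbot hP
  rw [hser_bot, sub_zero] at hD
  refine mem_one_of_forall_isRegularAt (ne_zero_of_constantCoeff_eq_one
    (constantCoeff_prod_one_sub_tpow hV.irrelevant.ne_zero Finset.univ))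
    (by rw [smul_comm]; exact Submodule.smul_mem _ _ hD) fun p hp _ => ?_
  simpa only [hser_bot, sub_zero] using
    isRegularAt_smul_hser_sub_tensor hM hN hV hB hB' hp bot_le hbot hP

theorem mul_dvd_of_mem_denomIdeal_tensorGrading [Nontrivial M] [Nontrivial N]
    (hM : IsFiniteGraded 𝓡 𝓜 s x δ) (hN : IsFiniteGraded 𝓢 𝓝 s' y δ') (hB : IsUDenom R 𝓜 B)
    (hB' : IsUDenom S 𝓝 B')
    (hC : C ∈ denomIdeal (R ⊗[K] S) (tensorGrading 𝓜 𝓝) (s + s')) : B * B' ∣ C := by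
  have hBB'1 : MvPolynomial.constantCoeff (B * B') = 1 := by
    rw [map_mul, hB.1.1, hB'.1.1, one_mul]
  refine dvd_of_forall_prime_dvd (ne_zero_of_constantCoeff_eq_one hBB'1) fun p hp ⟨q, hq⟩ => ?_
  have hp0 : MvPolynomial.constantCoeff p ≠ 0 :=
    left_ne_zero_of_mul_eq_one (by rw [← map_mul, ← hq, hBB'1])
  obtain ⟨P, a, hP, ha, hpa⟩ := hM.exists_not_dvd_numerator hB hp hp0
  obtain ⟨Q, b, hQ, hb, hpb⟩ := hN.exists_not_dvd_numerator hB' hp hp0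
  refine ⟨a * b, hp.not_dvd_mul hpa hpb, ?_⟩
  obtain ⟨c, hc⟩ := Submodule.mem_one.1 (mem_denomIdeal.1 hC (tensorSub P Q)
    (hP.tensorSub hM.graded.isInternal hN.graded.isInternal hQ))
  refine ⟨c, FaithfulSMul.algebraMap_injective _ (MvPowerSeries (Fin r) ℚ) ?_⟩
  rw [hser_tensorSub hM hN hP hQ] at hc
  simp only [map_mul, hc, ← ha, ← hb, Algebra.smul_def]
  ring

theorem IsUDenom.tensor [GradedAlgebra 𝓡] [GradedAlgebra 𝓢] [IsNoetherian R M]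
    [IsNoetherian S N] [IsNoetherianRing (R ⊗[K] S)] [IsNoetherian (R ⊗[K] S) (M ⊗[K] N)]
    [Nontrivial M] [Nontrivial N] [Finite ι] [Finite ι'] [Finite κ]
    (hM : IsFiniteGraded 𝓡 𝓜 s x δ) (hN : IsFiniteGraded 𝓢 𝓝 s' y δ')
    (hV : IsFiniteGraded (tensorGrading 𝓡 𝓢) (tensorGrading 𝓜 𝓝) (s + s') z γ)
    (hB : IsUDenom R 𝓜 B) (hB' : IsUDenom S 𝓝 B') :
    IsUDenom (R ⊗[K] S) (tensorGrading 𝓜 𝓝) (B * B') := by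
  obtain ⟨hB1, hBJ⟩ := (isCommonDenom_iff hM.lower).1 hB.1
  obtain ⟨hB'1, hB'J⟩ := (isCommonDenom_iff hN.lower).1 hB'.1
  refine ⟨(isCommonDenom_iff hV.lower).2 ⟨?_,
    mul_mem_denomIdeal_tensorGrading hM hN hV hBJ hB'J⟩, fun C hC => ?_⟩
  · rw [map_mul, hB1, hB'1, one_mul]
  · exact mul_dvd_of_mem_denomIdeal_tensorGrading hM hN hB hB' ((isCommonDenom_iff hV.lower).1 hC).2

end TensorDenominator

end UDenom

end

open UDenom TensorProduct in
theorem mainTheorem10 {K R S M N : Type*} [Field K] {r : ℕ}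
    [CommRing R] [Algebra K R] (𝓡 : (Fin r → ℕ) → Submodule K R) [GradedAlgebra 𝓡]
    [Algebra.FiniteType K R] [Module.Finite K (𝓡 0)]
    [CommRing S] [Algebra K S] (𝓢 : (Fin r → ℕ) → Submodule K S) [GradedAlgebra 𝓢]
    [Algebra.FiniteType K S] [Module.Finite K (𝓢 0)]
    [AddCommGroup M] [Module K M] [Module R M] [IsScalarTower K R M] [Module.Finite R M]
    [Nontrivial M] (𝓜 : (Fin r → ℤ) → Submodule K M) (h𝓜 : IsGradedModule 𝓡 𝓜)
    [AddCommGroup N] [Module K N] [Module S N] [IsScalarTower K S N] [Module.Finite S N]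
    [Nontrivial N] (𝓝 : (Fin r → ℤ) → Submodule K N) (h𝓝 : IsGradedModule 𝓢 𝓝) :
    IsUDenom R 𝓜 (udenom R 𝓜) ∧ IsUDenom S 𝓝 (udenom S 𝓝) ∧
      IsUDenom (R ⊗[K] S) (tensorGrading 𝓜 𝓝) (udenom (R ⊗[K] S) (tensorGrading 𝓜 𝓝)) ∧
      udenom (R ⊗[K] S) (tensorGrading 𝓜 𝓝) = udenom R 𝓜 * udenom S 𝓝 := by
  have := Algebra.FiniteType.isNoetherianRing K R
  have := Algebra.FiniteType.isNoetherianRing K S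
  have : IsNoetherianRing (R ⊗[K] S) := isNoetherianRing_tensor
  have : Module.Finite (R ⊗[K] S) (M ⊗[K] N) := finite_tensor
  have hR := DirectSum.Decomposition.isInternal 𝓡
  have hS := DirectSum.Decomposition.isInternal 𝓢
  obtain ⟨X, δ, hx⟩ := exists_isIrrelevantSystem hR.submodule_iSup_eq_top
  obtain ⟨Y, δ', hy⟩ := exists_isIrrelevantSystem hS.submodule_iSup_eq_top
  obtain ⟨s, hM⟩ := hx.exists_isFiniteGraded h𝓜 hR.submodule_iSup_eq_top
  obtain ⟨s', hN⟩ := hy.exists_isFiniteGraded h𝓝 hS.submodule_iSup_eq_top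
  have hlow := le_of_tensorGrading_ne_bot hM.lower hN.lower
  have hV : IsFiniteGraded (tensorGrading 𝓡 𝓢) (tensorGrading 𝓜 𝓝) (s + s') _ _ :=
    ⟨h𝓜.tensor h𝓝, (tensorGrading_isInternal hR hS).submodule_iSup_eq_top, hx.tensor hy,
      (hx.tensor hy).finite (h𝓜.tensor h𝓝) hlow, hlow⟩
  obtain ⟨B, hB⟩ := hM.exists_isUDenom
  obtain ⟨B', hB'⟩ := hN.exists_isUDenom
  have hBB' := IsUDenom.tensor hM hN hV hB hB'
  rw [hB.udenom_eq, hB'.udenom_eq, hBB'.udenom_eq]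
  exact ⟨hB, hB', hBB', rfl⟩
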